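/- **Conventions.** A *QPT circuit family* is a family of quantum circuits $(C_n)_{n\in\mathbb N}$ over the gate set $\{H, T, \mathrm{CNOT}\}$ such that a deterministic Turing machine on input $1^n$ writes down $C_n$ (with the sizes of its registers) in time polynomial in $n$. A function $f$ is negligible if for every constant $d>0$, $f(n)<n^{-d}$ for all large $n$. A *distinguisher* is a non-uniform family of polynomial-size circuits that receives a quantum state and zero-initialized ancilla qubits and outputs a measured bit. A *state generator* is a QPT circuit family that, for $k\in\{0,1\}^n$, maps $|k\rangle|0\cdots0\rangle$ to $|\phi_k\rangle\otimes|\eta_k\rangle$, where the $m=m(n)$-qubit pure state $|\phi_k\rangle$ is the output and $|\eta_k\rangle$ is a pure final ancilla state (of $a(n)$ qubits). It is a *pseudorandom quantum states generator* (PRSG) if for every polynomial $t$ and every distinguisher $\mathcal A$ there is a negligible function $\mathsf{negl}$ with $$\Big|\Pr_{k\leftarrow\{0,1\}^n}[\mathcal A(|\phi_k\rangle^{\otimes t(n)})\to1]-\Pr_{|\psi\rangle\leftarrow\mu_m}[\mathcal A(|\psi\rangle^{\otimes t(n)})\to1]\Big|\le\mathsf{negl}(n)\quad\text{for all } n,$$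 where $\mu_m$ is the Haar measure on $m$-qubit pure states, and it is *single-copy secure* if this holds for $t=1$ (every PRSG is single-copy secure). A *non-interactive quantum bit commitment scheme* is given by states $|\psi_b\rangle_{RC}$, $b\in\{0,1\}$ (for each value of the security parameter $n$), prepared from the all-zero state by QPT circuit families. To commit to $b$ the sender prepares $|\psi_b\rangle_{RC}$ and sends $C$; to open, the sender sends $b$ and $R$, and the receiver accepts $b$ iff the measurement $\{|\psi_b\rangle\langle\psi_b|, I-|\psi_b\rangle\langle\psi_b|\}$ on $RC$ yields $|\psi_b\rangle\langle\psi_b|$. It is * *perfectly correct* if an honestly committed $b$ is accepted with probability $1$; * *computationally hiding* if for every distinguisher $\mathcal A$ (in particular for every QPT adversary) there is a negligible function $\mathsf{negl}$ with $|\Pr[\mathcal A(\mathrm{Tr}_R|\psi_0\rangle\langle\psi_0|)\to1]-\Pr[\mathcal A(\mathrm{Tr}_R|\psi_1\rangle\langle\psi_1|)\to1]|\le\mathsf{negl}(n)$ for all $n$; * *statistically sum-binding* if for every unbounded adversary, i.e. for every family of states $|\Psi\rangle_{ERC}$ with a register $E$ of arbitrary finite dimension and of unitaries $U^{(0)}_{ER},U^{(1)}_{ER}$,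 there is a negligible function $\mathsf{negl}$ such that $p_b:=\langle\psi_b|\mathrm{Tr}_E(U^{(b)}_{ER}|\Psi\rangle\langle\Psi|U^{(b)\dagger}_{ER})|\psi_b\rangle$ satisfy $p_0+p_1\le1+\mathsf{negl}(n)$ for all $n$. **Theorem.** Let $c>1$ be a constant, and suppose there is a single-copy-secure PRSG (for instance a PRSG) with $m(n)\ge cn$ for all $n$. Then there is a non-interactive quantum commitment scheme for classical bits that is perfectly correct, computationally hiding and statistically sum-binding. More precisely, the states $$|\psi_b\rangle=\frac1{\sqrt{2^{2m+n}}}\sum_{x,z\in\{0,1\}^m}\sum_{k\in\{0,1\}^n}\big(|x,z,k\rangle\otimes|\eta_k\rangle\big)_R\otimes\big(P_{x,z}^b|\phi_k\rangle\big)_C,\qquad P_{x,z}=\bigotimes_{j=1}^mX_j^{x_j}Z_j^{z_j},$$ define such a scheme (in particular they can be prepared by QPT circuit families), and for every unbounded adversary and every $n$ it satisfies $$p_0+p_1\le1+2^{-(c-1)n/2}.$$ -/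

import Mathlib

open scoped Matrix Kronecker

noncomputable section

/-! ### Qubits and quantum circuits -/

/-- Computational-basis labels of `N` qubits. -/
abbrev Bits (N : ℕ) : Type := Fin N → Bool

/-- A (not necessarily normalized) vector in the state space of `N` qubits. -/
abbrev QVec (N : ℕ) : Type := Bits N → ℂ

/-- The computational basis vector `|x⟩`. -/
def ket {N : ℕ} (x : Bits N) : QVec N := Pi.single x 1

/-- The operator `|ψ⟩⟨ψ|`. -/
def pureState {ι : Type} (ψ : ι → ℂ) : Matrix ι ι ℂ := Matrix.vecMulVec ψ (star ψ)

/-- A gate on `N` wires, from the universal gate set Hadamard, `T = diag(1, exp(iπ/4))`, CNOT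
(first argument: control wire, second argument: target wire). -/
inductive Gate (N : ℕ) : Type
  | H (i : Fin N) : Gate N
  | T (i : Fin N) : Gate N
  | CNOT (i j : Fin N) (hij : i ≠ j) : Gate N

/-- The unitary matrix of a gate; the entry `(y, x)` is `⟨y| g |x⟩`. -/
def Gate.matrix {N : ℕ} : Gate N → Matrix (Bits N) (Bits N) ℂ
  | .H i => Matrix.of fun y x =>
      if ∀ j, j ≠ i → y j = x j then
        (if y i = true ∧ x i = true then -1 else 1) / ((Real.sqrt 2 : ℝ) : ℂ)
      else 0
  | .T i => Matrix.diagonal fun x =>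
      if x i = true then Complex.exp (Real.pi / 4 * Complex.I) else 1
  | .CNOT i j _ => Matrix.of fun y x =>
      if y = Function.update x j (xor (x j) (x i)) then 1 else 0

/-- A quantum circuit on `N` wires: a list of gates, the head being applied first. -/
abbrev Circuit (N : ℕ) : Type := List (Gate N)

/-- The unitary implemented by a circuit. -/
def Circuit.unitary {N : ℕ} : Circuit N → Matrix (Bits N) (Bits N) ℂ
  | [] => 1
  | g :: C => Circuit.unitary C * g.matrix

/-! ### Polynomial-time uniform circuit families -/

/-- The finite alphabet in which circuits are written down. -/
inductive CircuitSymbol : Type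
  | tick | sep | h | t | cx
  deriving DecidableEq

/-- A natural number in unary, closed by a separator. -/
def encodeIndex (i : ℕ) : List CircuitSymbol := List.replicate i CircuitSymbol.tick ++ [CircuitSymbol.sep]

/-- The description of a gate: its name followed by its wire(s). -/
def Gate.encode {N : ℕ} : Gate N → List CircuitSymbol
  | .H i => CircuitSymbol.h :: encodeIndex i
  | .T i => CircuitSymbol.t :: encodeIndex i
  | .CNOT i j _ => CircuitSymbol.cx :: (encodeIndex i ++ encodeIndex j)

/-- The description of a circuit on `p + q` wires, the wires being split into a first register of
`p` wires and a second register of `q` wires. -/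
def Circuit.encode (p q : ℕ) (C : Circuit (p + q)) : List CircuitSymbol :=
  encodeIndex p ++ encodeIndex q ++ C.flatMap Gate.encode

/-- A family of circuits (with the sizes of their two registers) is polynomial-time uniform if
some deterministic Turing machine, on input `1ⁿ`, writes the description of the `n`-th circuit
within a number of steps polynomial in `n`. -/
def PolyTimeUniform (p q : ℕ → ℕ) (C : ∀ n, Circuit (p n + q n)) : Prop :=
  Nonempty (Turing.TM2ComputableInPolyTime Computability.unaryEncodeNat
    (id : List CircuitSymbol → List CircuitSymbol) (fun n => Circuit.encode (p n) (q n) (C n)))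

/-! ### Negligible functions and quantum polynomial-time distinguishers -/

/-- `f` is negligible if for every constant `c > 0`, `f n < n ^ (-c)` for all large `n`. -/
def Negligible (f : ℕ → ℝ) : Prop :=
  ∀ c : ℝ, 0 < c → ∀ᶠ n : ℕ in Filter.atTop, f n < (n : ℝ) ^ (-c)

/-- A non-uniform quantum polynomial-time distinguisher that receives a state of `q n` qubits:
for each `n` a circuit of polynomial size acting on the input qubits and on `anc n + 1` ancilla
qubits that start in state zero. Its output bit is the measured value of the last wire. -/
structure Distinguisher (q : ℕ → ℕ) where
  anc : ℕ → ℕ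
  circ : ∀ n, Circuit (q n + (anc n + 1))
  poly : ∃ p : Polynomial ℕ, ∀ n, anc n + (circ n).length ≤ p.eval n

/-- `ρ ⊗ |0…0⟩⟨0…0|` on `q + a` qubits. -/
def withAncilla {q : ℕ} (a : ℕ) (ρ : Matrix (Bits q) (Bits q) ℂ) :
    Matrix (Bits (q + a)) (Bits (q + a)) ℂ :=
  Matrix.of fun y y' =>
    if (∀ i, y (Fin.natAdd q i) = false) ∧ (∀ i, y' (Fin.natAdd q i) = false) then
      ρ (fun i => y (Fin.castAdd a i)) (fun i => y' (Fin.castAdd a i))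
    else 0

/-- The probability that the distinguisher outputs `1` on the (mixed) input state `ρ`. -/
def Distinguisher.prob {q : ℕ → ℕ} (A : Distinguisher q) (n : ℕ)
    (ρ : Matrix (Bits (q n)) (Bits (q n)) ℂ) : ℝ :=
  ∑ y : Bits (q n + (A.anc n + 1)), if y (Fin.last (q n + A.anc n)) = true then
    (((A.circ n).unitary * withAncilla (A.anc n + 1) ρ * ((A.circ n).unitary)ᴴ) y y).re else 0

/-! ### Pseudorandom quantum states generators -/

/-- A quantum polynomial-time algorithm that, on input `k ∈ {0,1}ⁿ`, outputs an `m n`-qubit pure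
state `φ n k`. For every `n` a polynomial-time uniform circuit is run on `|k⟩|0…0⟩` and ends in the
state `|φ_k⟩ ⊗ |η_k⟩`; the first `m n` wires are output, the other `a n` wires hold the final
ancilla state `|η_k⟩`. -/
structure StateGen where
  m : ℕ → ℕ
  a : ℕ → ℕ
  circ : ∀ n, Circuit (m n + a n)
  input_le : ∀ n, n ≤ m n + a n
  uniform : PolyTimeUniform m a circ
  φ : ∀ n, Bits n → QVec (m n)
  η : ∀ n, Bits n → QVec (a n)
  φ_norm : ∀ n k, ∑ x, ‖φ n k x‖ ^ 2 = 1
  η_norm : ∀ n k, ∑ x, ‖η n k x‖ ^ 2 = 1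
  run : ∀ n (k : Bits n) (u : Bits (m n)) (e : Bits (a n)),
    ((circ n).unitary *ᵥ ket (fun i => if h : (i : ℕ) < n then k ⟨i, h⟩ else false))
      (Fin.append u e) = φ n k u * η n k e

/-- The Haar measure on pure `m`-qubit states: the normalized surface measure of the unit sphere
of the `2 ^ m`-dimensional complex Hilbert space. -/
def haarState (m : ℕ) :
    MeasureTheory.Measure (Metric.sphere (0 : EuclideanSpace ℂ (Bits m)) 1) :=
  ((MeasureTheory.volume : MeasureTheory.Measure (EuclideanSpace ℂ (Bits m))).toSphere
    Set.univ)⁻¹ •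
      (MeasureTheory.volume : MeasureTheory.Measure (EuclideanSpace ℂ (Bits m))).toSphere

/-- `|ψ⟩^{⊗ t}`, the qubit `j` of the copy `i` being the wire `j + m * i`. -/
def copies {m : ℕ} (t : ℕ) (ψ : QVec m) : QVec (t * m) :=
  fun y => ∏ i : Fin t, ψ fun j => y (finProdFinEquiv (i, j))

/-- `t` copies of `|φ_k⟩` for uniformly random `k` are computationally indistinguishable from `t`
copies of a Haar random state. -/
def StateGen.IndistinguishableFromHaar (G : StateGen) (t : ℕ → ℕ) : Prop :=
  ∀ A : Distinguisher (fun n => t n * G.m n), ∃ negl : ℕ → ℝ, Negligible negl ∧ ∀ n,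
    |(∑ k : Bits n, A.prob n (pureState (copies (t n) (G.φ n k)))) / 2 ^ n
      - ∫ ψ, A.prob n (pureState (copies (t n) (WithLp.ofLp ψ.1))) ∂(haarState (G.m n))|
      ≤ negl n

/-- Pseudorandom quantum states generator: security for every polynomial number of copies. -/
def StateGen.IsPRSG (G : StateGen) : Prop :=
  ∀ t : Polynomial ℕ, G.IndistinguishableFromHaar (fun n => t.eval n)

/-- Single-copy-secure pseudorandom quantum states generator: the case of one copy. -/
def StateGen.IsSingleCopyPRSG (G : StateGen) : Prop :=
  G.IndistinguishableFromHaar (fun _ => 1)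

theorem StateGen.IsPRSG.isSingleCopyPRSG {G : StateGen} (h : G.IsPRSG) : G.IsSingleCopyPRSG := by
  simpa [StateGen.IsSingleCopyPRSG] using h 1

/-! ### Non-interactive quantum commitments -/

/-- A non-interactive quantum bit commitment scheme with security parameter `n`: the sender
prepares `|ψ_b⟩` on a register `C` of `c n` qubits (the commitment) and a register `R` of `r n`
qubits (the opening) from the all-zero state by polynomial-time uniform circuits. The receiver's
verification is the projective measurement onto `|ψ_b⟩`, see `openProb`. -/
structure QuantumCommitment (c r : ℕ → ℕ) where
  circ : Bool → ∀ n, Circuit (c n + r n)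
  uniform : ∀ b, PolyTimeUniform c r (circ b)

namespace QuantumCommitment

variable {c r : ℕ → ℕ} (S : QuantumCommitment c r)

/-- The state `|ψ_b⟩` on the registers `C` and `R`. -/
def state (n : ℕ) (b : Bool) : Bits (c n) × Bits (r n) → ℂ :=
  fun p => ((S.circ b n).unitary *ᵥ ket (fun _ => false)) (Fin.append p.1 p.2)

/-- The probability that the receiver, asked to open `b` and holding the state `τ` on the
registers `C` and `R`, obtains `|ψ_b⟩⟨ψ_b|` in the measurement `{|ψ_b⟩⟨ψ_b|, I - |ψ_b⟩⟨ψ_b|}`. -/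
def openProb (n : ℕ) (b : Bool)
    (τ : Matrix (Bits (c n) × Bits (r n)) (Bits (c n) × Bits (r n)) ℂ) : ℝ :=
  (star (S.state n b) ⬝ᵥ (τ *ᵥ S.state n b)).re

/-- When the honest sender commits `b`, the honest receiver opens `b` with probability `1`. -/
def PerfectlyCorrect : Prop :=
  ∀ n b, S.openProb n b (pureState (S.state n b)) = 1

/-- The state `Tr_R |ψ_b⟩⟨ψ_b|` of the register `C`, which the receiver holds after the commit
phase. -/
def commitment (n : ℕ) (b : Bool) : Matrix (Bits (c n)) (Bits (c n)) ℂ :=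
  Matrix.of fun u u' => ∑ v : Bits (r n), pureState (S.state n b) (u, v) (u', v)

/-- No quantum polynomial-time adversary (not even a non-uniform one) distinguishes the
commitments to `0` and to `1`. -/
def ComputationallyHiding : Prop :=
  ∀ A : Distinguisher c, ∃ negl : ℕ → ℝ, Negligible negl ∧ ∀ n,
    |A.prob n (S.commitment n false) - A.prob n (S.commitment n true)| ≤ negl n

end QuantumCommitment

/-- An unbounded malicious sender: a state on the registers `E`, `R`, `C`, where `E` has an
arbitrary finite dimension, and for each `b` a unitary on `E` and `R` applied in order to open
`b`. -/
structure BindingAdversary (c r : ℕ → ℕ) where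
  dimE : ℕ → ℕ
  Ψ : ∀ n, (Fin (dimE n) × Bits (r n)) × Bits (c n) → ℂ
  Ψ_norm : ∀ n, ∑ x, ‖Ψ n x‖ ^ 2 = 1
  U : Bool → ∀ n, Matrix.unitaryGroup (Fin (dimE n) × Bits (r n)) ℂ

/-- `Tr_E (U |Ψ⟩⟨Ψ| U†)`, where `U = U_b` acts on the registers `E` and `R`: the state of the
registers `C` and `R` that the receiver measures. -/
def BindingAdversary.revealed {c r : ℕ → ℕ} (A : BindingAdversary c r) (n : ℕ) (b : Bool) :
    Matrix (Bits (c n) × Bits (r n)) (Bits (c n) × Bits (r n)) ℂ :=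
  Matrix.of fun p p' => ∑ e : Fin (A.dimE n),
    pureState (((A.U b n : Matrix _ _ ℂ) ⊗ₖ (1 : Matrix (Bits (c n)) (Bits (c n)) ℂ)) *ᵥ A.Ψ n)
      ((e, p.2), p.1) ((e, p'.2), p'.1)

namespace QuantumCommitment

variable {c r : ℕ → ℕ} (S : QuantumCommitment c r)

/-- `p_b`: the probability that the malicious sender makes the receiver open `b`. -/
def cheatProb (A : BindingAdversary c r) (n : ℕ) (b : Bool) : ℝ :=
  S.openProb n b (A.revealed n b)

/-- Statistical sum-binding: `p_0 + p_1 ≤ 1 + negl` for every unbounded adversary. -/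
def StatisticallySumBinding : Prop :=
  ∀ A : BindingAdversary c r, ∃ negl : ℕ → ℝ, Negligible negl ∧ ∀ n,
    S.cheatProb A n false + S.cheatProb A n true ≤ 1 + negl n

end QuantumCommitment

/-! ### The Pauli operators of the quantum one-time pad -/

/-- The Pauli matrix `X`. -/
def pauliX : Matrix Bool Bool ℂ := Matrix.of fun u v => if u = v then 0 else 1

/-- The Pauli matrix `Z`. -/
def pauliZ : Matrix Bool Bool ℂ := Matrix.diagonal fun u => if u then -1 else 1

/-- `P_{x,z} = ⨂_j X_j^{x_j} Z_j^{z_j}` on `m` qubits. -/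
def pauli {m : ℕ} (x z : Bits m) : Matrix (Bits m) (Bits m) ℂ :=
  Matrix.of fun u v =>
    ∏ j, (pauliX ^ (x j).toNat * pauliZ ^ (z j).toNat) (u j) (v j)

end

/-! ### Stack programs

A stack program is a `TM2` machine without designated input and output stacks; halting is its exit.
Programs over the same stacks can be composed sequentially and iterated. -/

/-! The commitment to 0 purifies the pseudorandom state by its key; the commitment to 1 additionally
encrypts it with a quantum one-time pad whose Pauli keys stay in the opening register.

Hiding: tracing out R leaves the mixture of the |φ_k⟩⟨φ_k| for b = 0 and, by the Pauli twirl
`sum_pureState_pauli`, the maximally mixed state I/2^m for b = 1. A Haar random state also averages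
to I/2^m (`integral_haarState`), because the Haar measure is invariant under the Pauli operators.
Acceptance probabilities are linear in the input, so distinguishing the commitments is exactly the
single-copy game of the generator.

Binding: with f_b = U_b†(I ⊗ |ψ_b⟩⟨ψ_b|)U_b Ψ one has p_b = ‖f_b‖² = ⟨f_b, Ψ⟩, and two nearly
orthogonal projections cannot both capture the unit vector Ψ (`add_le_one_add_of_inner`). For the
overlap of f_0 and f_1, write ψ_0 = ∑_k ζ_k ⊗ φ_k with ‖ζ_k‖² = 2^{-n}. The unitary U_0 U_1† does
not touch C, so the term of k involves ψ_1 only through its component along φ_k on C, of squared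
norm 2^{-m} since C is maximally mixed in ψ_1. Cauchy–Schwarz for each of the 2^n keys
(`norm_star_tensor_kronecker_le`) gives the factor 2^n · 2^{-n/2} · 2^{-m/2} = 2^{(n-m)/2}.

Preparation: each key bit is put into superposition by H and copied by CNOT to the input of the
generator's circuit, so that the key survives the run; the pad is a sequence of controlled X and
controlled Z gates, the latter being CNOT conjugated by H (`circuit_mulVec`). Uniformity needs an
actual machine: it runs the generator's machine on a copy of 1^n and rewrites the resulting
description, from back to front because the output is a stack (`polyTime_descCommit`). Its running
time is polynomial because a machine pushes boundedly many symbols per step, so that the generator's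
description is polynomially long. -/

namespace StackProgram

open Turing Turing.TM2 Turing.TM2.Stmt

section Semantics

variable {K : Type} [DecidableEq K] {Γ : K → Type} {Λ Λ' σ : Type}

/-- `RunsIn M t c c'`: the machine `M` gets from `c` to `c'` in exactly `t` steps. -/
inductive RunsIn (M : Λ → Stmt Γ Λ σ) : ℕ → Cfg Γ Λ σ → Cfg Γ Λ σ → Prop
  | refl (c) : RunsIn M 0 c c
  | head {t c c' c''} : step M c = some c' → RunsIn M t c' c'' → RunsIn M (t + 1) c c''

theorem RunsIn.trans {M : Λ → Stmt Γ Λ σ} {t t' : ℕ} {c c' c'' : Cfg Γ Λ σ}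
    (h : RunsIn M t c c') (h' : RunsIn M t' c' c'') : RunsIn M (t + t') c c'' := by
  induction h with
  | refl c => simpa using h'
  | head hs _ ih => rw [Nat.add_right_comm]; exact .head hs (ih h')

theorem iterate_bind_none {α : Type} (f : α → Option α) (t : ℕ) :
    (flip bind f)^[t] none = none := by
  induction t with
  | zero => rfl
  | succ t ih => rw [Function.iterate_succ_apply]; exact ih

/-- The bridge to `TM2OutputsInTime`, which counts iterations of the partial step function;
inductive runs are easier to compose. -/
theorem runsIn_iff {M : Λ → Stmt Γ Λ σ} {t : ℕ} {c c' : Cfg Γ Λ σ} :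
    RunsIn M t c c' ↔ (flip bind (step M))^[t] (some c) = some c' := by
  constructor
  · intro h
    induction h with
    | refl c => rfl
    | head hs _ ih =>
      rw [Function.iterate_succ_apply]
      simpa [flip, hs] using ih
  · intro h
    induction t generalizing c with
    | zero => obtain rfl : c = c' := by simpa using h
              exact .refl _
    | succ t ih =>
      rw [Function.iterate_succ_apply] at h
      cases hs : step M c with
      | none =>
        simp [flip, hs] at h
        exact absurd h (by have := iterate_bind_none (step M) t; simp_all)
      | some d => exact .head hs (ih (by simpa [flip, hs] using h))

/-- Rename the labels of a statement by `f` and replace halting by a jump to `e`. -/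
def relabel (f : Λ → Λ') (e : Option Λ') : Stmt Γ Λ σ → Stmt Γ Λ' σ
  | push k g q => push k g (relabel f e q)
  | peek k g q => peek k g (relabel f e q)
  | pop k g q => pop k g (relabel f e q)
  | load g q => load g (relabel f e q)
  | branch g q₁ q₂ => branch g (relabel f e q₁) (relabel f e q₂)
  | goto l => goto fun v => f (l v)
  | halt => match e with
    | none => halt
    | some l => goto fun _ => l

/-- The effect of `relabel f e` on the label of a configuration. -/
def exitLabel (f : Λ → Λ') (e : Option Λ') : Option Λ → Option Λ'
  | some l => some (f l)
  | none => e

/-- Labels enter a statement only through its final jump, so relabelling affects neither the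
internal state nor the stacks. -/
theorem stepAux_relabel (f : Λ → Λ') (e : Option Λ') (q : Stmt Γ Λ σ) (v : σ)
    (S : ∀ k, List (Γ k)) :
    stepAux (relabel f e q) v S =
      ⟨exitLabel f e (stepAux q v S).l, (stepAux q v S).var, (stepAux q v S).stk⟩ := by
  induction q generalizing v S with
  | push k g q ih => exact ih _ _
  | peek k g q ih => exact ih _ _
  | pop k g q ih => exact ih _ _
  | load g q ih => exact ih _ _
  | branch g q₁ q₂ ih₁ ih₂ =>
    cases h : g v <;> simp [relabel, h, ih₁, ih₂]
  | goto l => rfl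
  | halt => cases e <;> rfl

/-- A run of `M` up to its halting is a run of any machine `M'` containing a relabelled copy
of `M`, up to the exit label. -/
theorem RunsIn.relabel {M : Λ → Stmt Γ Λ σ} {M' : Λ' → Stmt Γ Λ' σ} {f : Λ → Λ'} {e : Option Λ'}
    (hM : ∀ l, M' (f l) = StackProgram.relabel f e (M l)) {t : ℕ} {l : Λ} {v : σ}
    {S : ∀ k, List (Γ k)} {v' : σ} {S' : ∀ k, List (Γ k)}
    (h : RunsIn M t ⟨some l, v, S⟩ ⟨none, v', S'⟩) :
    RunsIn M' t ⟨some (f l), v, S⟩ ⟨e, v', S'⟩ := by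
  induction t generalizing l v S with
  -- No running configuration is halted, so at least one step is made.
  | zero => cases h
  | succ t ih =>
    cases h with
    | head hs hr =>
      simp only [step, Option.some.injEq] at hs
      refine .head (c' := ⟨exitLabel f e (stepAux (M l) v S).l, (stepAux (M l) v S).var,
        (stepAux (M l) v S).stk⟩) ?_ ?_
      · simp only [step, hM, stepAux_relabel]
      · rw [hs]
        rename_i c'
        obtain ⟨o, w, S₁⟩ := c'
        cases o with
        | some l' => exact ih hr
        | none =>
          cases hr with
          | refl => exact .refl _
          | head hs' _ => simp [step] at hs'

end Semantics

/-- A stack program over the stacks `Γ` with internal states `σ`. -/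
structure Prog {K : Type} (Γ : K → Type) (σ : Type) where
  Λ : Type
  [fin : Fintype Λ]
  entry : Λ
  code : Λ → Stmt Γ Λ σ

attribute [instance] Prog.fin

section Combinators

variable {K : Type} [DecidableEq K] {Γ : K → Type} {σ : Type}

/-- `p.Exec t v S v' S'`: started with state `v` and stacks `S`, the program `p` halts within
`t` steps with state `v'` and stacks `S'`. -/
def Prog.Exec (p : Prog Γ σ) (t : ℕ) (v : σ) (S : ∀ k, List (Γ k)) (v' : σ)
    (S' : ∀ k, List (Γ k)) : Prop :=
  ∃ t' ≤ t, RunsIn p.code t' ⟨some p.entry, v, S⟩ ⟨none, v', S'⟩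

theorem Prog.Exec.mono {p : Prog Γ σ} {t t' : ℕ} {v v' : σ} {S S' : ∀ k, List (Γ k)}
    (h : p.Exec t v S v' S') (ht : t ≤ t') : p.Exec t' v S v' S' :=
  let ⟨s, hs, hr⟩ := h
  ⟨s, hs.trans ht, hr⟩

/-- Run `p`, then `q`. -/
def Prog.seq (p q : Prog Γ σ) : Prog Γ σ where
  Λ := p.Λ ⊕ q.Λ
  entry := .inl p.entry
  code := Sum.elim (fun l => relabel Sum.inl (some (.inr q.entry)) (p.code l))
    (fun l => relabel Sum.inr none (q.code l))

/-- The halting statements of `p` have become jumps to the entry of `q`, so the times add without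
overhead. -/
theorem Prog.Exec.seq {p q : Prog Γ σ} {t₁ t₂ : ℕ} {v₁ v₂ v₃ : σ} {S₁ S₂ S₃ : ∀ k, List (Γ k)}
    (hp : p.Exec t₁ v₁ S₁ v₂ S₂) (hq : q.Exec t₂ v₂ S₂ v₃ S₃) :
    (p.seq q).Exec (t₁ + t₂) v₁ S₁ v₃ S₃ := by
  obtain ⟨s₁, h₁, r₁⟩ := hp
  obtain ⟨s₂, h₂, r₂⟩ := hq
  refine ⟨s₁ + s₂, add_le_add h₁ h₂, ?_⟩
  exact (r₁.relabel (f := Sum.inl) (e := some (.inr q.entry)) (M' := (p.seq q).code)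
    fun _ => rfl).trans (r₂.relabel (f := Sum.inr) (e := none) fun _ => rfl)

/-- A program consisting of a single statement. -/
def Prog.single (q : Stmt Γ Unit σ) : Prog Γ σ where
  Λ := Unit
  entry := ()
  code _ := q

theorem Prog.exec_single {q : Stmt Γ Unit σ} {v v' : σ} {S S' : ∀ k, List (Γ k)}
    (h : stepAux q v S = ⟨none, v', S'⟩) : (Prog.single q).Exec 1 v S v' S' :=
  ⟨1, le_rfl, .head (c' := ⟨none, v', S'⟩) (congrArg some h) (.refl _)⟩

/-- Pop the stack `k` into the internal state by `g`; halt unless `c` holds, else run `p` and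
repeat. -/
def Prog.loop (k : K) (g : σ → Option (Γ k) → σ) (c : σ → Bool) (p : Prog Γ σ) : Prog Γ σ where
  Λ := Option p.Λ
  entry := none
  code
    | none => pop k g (branch c (goto fun _ => some p.entry) halt)
    | some l => relabel some (some none) (p.code l)

/-- The pop precedes the test, so the symbol that ends the loop is consumed as well. The parser
exploits this to skip separators. -/
theorem Prog.exec_loop_exit {k : K} {g : σ → Option (Γ k) → σ} {c : σ → Bool} {p : Prog Γ σ}
    {v : σ} {S : ∀ k, List (Γ k)} (hc : c (g v (S k).head?) = false) :
    (p.loop k g c).Exec 1 v S (g v (S k).head?) (Function.update S k (S k).tail) :=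
  ⟨1, le_rfl, .head (by simp only [step, loop, stepAux, hc, cond_false]) (.refl _)⟩

theorem Prog.exec_loop_next {k : K} {g : σ → Option (Γ k) → σ} {c : σ → Bool} {p : Prog Γ σ}
    {v v' v'' : σ} {S S' S'' : ∀ k, List (Γ k)} {t t' : ℕ} (hc : c (g v (S k).head?) = true)
    (hp : p.Exec t (g v (S k).head?) (Function.update S k (S k).tail) v' S')
    (hl : (p.loop k g c).Exec t' v' S' v'' S'') :
    (p.loop k g c).Exec (t + t' + 1) v S v'' S'' := by
  obtain ⟨s, hs, r⟩ := hp
  obtain ⟨s', hs', r'⟩ := hl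
  refine ⟨s + s' + 1, by omega, .head (c' := ⟨some (some p.entry), g v (S k).head?,
    Function.update S k (S k).tail⟩) ?_ ?_⟩
  · simp only [step, loop, stepAux, hc, cond_true]
  · exact (r.relabel (f := some) (e := some none) (M' := (p.loop k g c).code) fun _ => rfl).trans r'

end Combinators

/-! ### Programs on disjoint sets of stacks -/

section Lift

variable {K₁ K₂ : Type} [DecidableEq K₁] [DecidableEq K₂] {Γ₁ : K₁ → Type} {Γ₂ : K₂ → Type}
  {Λ σ₁ σ₂ : Type}

/-- Stacks over `K₁ ⊕ K₂`. -/
def sumStacks (S₁ : ∀ k, List (Γ₁ k)) (S₂ : ∀ k, List (Γ₂ k)) (k : K₁ ⊕ K₂) :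
    List (Sum.elim Γ₁ Γ₂ k) :=
  match k with
  | .inl k => S₁ k
  | .inr k => S₂ k

theorem update_sumStacks_inl (S₁ : ∀ k, List (Γ₁ k)) (S₂ : ∀ k, List (Γ₂ k)) (k : K₁)
    (x : List (Γ₁ k)) :
    Function.update (sumStacks S₁ S₂) (.inl k) x = sumStacks (Function.update S₁ k x) S₂ := by
  funext j
  rcases j with j | j
  · by_cases h : j = k
    · subst h
      exact (Function.update_self ..).trans (Function.update_self j x S₁).symm
    · have hj : S₁ j = Function.update S₁ k x j := (Function.update_of_ne h ..).symm
      exact (Function.update_of_ne (by simpa using h) ..).trans hj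
  · exact Function.update_of_ne (by simp) ..

theorem update_sumStacks_inr (S₁ : ∀ k, List (Γ₁ k)) (S₂ : ∀ k, List (Γ₂ k)) (k : K₂)
    (x : List (Γ₂ k)) :
    Function.update (sumStacks S₁ S₂) (.inr k) x = sumStacks S₁ (Function.update S₂ k x) := by
  funext j
  rcases j with j | j
  · exact Function.update_of_ne (by simp) ..
  · by_cases h : j = k
    · subst h
      exact (Function.update_self ..).trans (Function.update_self j x S₂).symm
    · have hj : S₂ j = Function.update S₂ k x j := (Function.update_of_ne h ..).symm
      exact (Function.update_of_ne (by simpa using h) ..).trans hj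

/-- A statement acting on the first family of stacks. -/
def liftLeft : Stmt Γ₁ Λ σ₁ → Stmt (Sum.elim Γ₁ Γ₂) Λ (σ₁ × σ₂)
  | push k g q => push (.inl k) (fun v => g v.1) (liftLeft q)
  | peek k g q => peek (.inl k) (fun v s => (g v.1 s, v.2)) (liftLeft q)
  | pop k g q => pop (.inl k) (fun v s => (g v.1 s, v.2)) (liftLeft q)
  | load g q => load (fun v => (g v.1, v.2)) (liftLeft q)
  | branch g q₁ q₂ => branch (fun v => g v.1) (liftLeft q₁) (liftLeft q₂)
  | goto l => goto fun v => l v.1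
  | halt => halt

/-- A statement acting on the second family of stacks. -/
def liftRight : Stmt Γ₂ Λ σ₂ → Stmt (Sum.elim Γ₁ Γ₂) Λ (σ₁ × σ₂)
  | push k g q => push (.inr k) (fun v => g v.2) (liftRight q)
  | peek k g q => peek (.inr k) (fun v s => (v.1, g v.2 s)) (liftRight q)
  | pop k g q => pop (.inr k) (fun v s => (v.1, g v.2 s)) (liftRight q)
  | load g q => load (fun v => (v.1, g v.2)) (liftRight q)
  | branch g q₁ q₂ => branch (fun v => g v.2) (liftRight q₁) (liftRight q₂)
  | goto l => goto fun v => l v.2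
  | halt => halt

theorem stepAux_liftLeft (q : Stmt Γ₁ Λ σ₁) (v₁ : σ₁) (v₂ : σ₂) (S₁ : ∀ k, List (Γ₁ k))
    (S₂ : ∀ k, List (Γ₂ k)) :
    stepAux (liftLeft q) (v₁, v₂) (sumStacks S₁ S₂) =
      ⟨(stepAux q v₁ S₁).l, ((stepAux q v₁ S₁).var, v₂), sumStacks (stepAux q v₁ S₁).stk S₂⟩ := by
  induction q generalizing v₁ S₁ with
  | push k g q ih =>
    simp only [liftLeft, stepAux]
    rw [← ih, ← update_sumStacks_inl]; rfl
  | peek k g q ih => exact ih _ _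
  | pop k g q ih =>
    simp only [liftLeft, stepAux]
    rw [← ih, ← update_sumStacks_inl]; rfl
  | load g q ih => exact ih _ _
  | branch g q₁ q₂ ih₁ ih₂ => cases h : g v₁ <;> simp [liftLeft, h, ih₁, ih₂]
  | goto l => rfl
  | halt => rfl

theorem stepAux_liftRight (q : Stmt Γ₂ Λ σ₂) (v₁ : σ₁) (v₂ : σ₂) (S₁ : ∀ k, List (Γ₁ k))
    (S₂ : ∀ k, List (Γ₂ k)) :
    stepAux (liftRight q) (v₁, v₂) (sumStacks S₁ S₂) =
      ⟨(stepAux q v₂ S₂).l, (v₁, (stepAux q v₂ S₂).var), sumStacks S₁ (stepAux q v₂ S₂).stk⟩ := by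
  induction q generalizing v₂ S₂ with
  | push k g q ih =>
    simp only [liftRight, stepAux]
    rw [← ih, ← update_sumStacks_inr]; rfl
  | peek k g q ih => exact ih _ _
  | pop k g q ih =>
    simp only [liftRight, stepAux]
    rw [← ih, ← update_sumStacks_inr]; rfl
  | load g q ih => exact ih _ _
  | branch g q₁ q₂ ih₁ ih₂ => cases h : g v₂ <;> simp [liftRight, h, ih₁, ih₂]
  | goto l => rfl
  | halt => rfl

/-- A program acting on the first family of stacks. -/
def Prog.left (p : Prog Γ₁ σ₁) : Prog (Sum.elim Γ₁ Γ₂) (σ₁ × σ₂) where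
  Λ := p.Λ
  entry := p.entry
  code l := liftLeft (p.code l)

/-- A program acting on the second family of stacks. -/
def Prog.right (p : Prog Γ₂ σ₂) : Prog (Sum.elim Γ₁ Γ₂) (σ₁ × σ₂) where
  Λ := p.Λ
  entry := p.entry
  code l := liftRight (p.code l)

/-- A frame rule: stacks and state of the second machine are carried along untouched. It lets the
generator's machine run as a subroutine beside the registers. -/
theorem Prog.Exec.left {p : Prog Γ₁ σ₁} {t : ℕ} {v v' : σ₁} {S S' : ∀ k, List (Γ₁ k)}
    (h : p.Exec t v S v' S') (v₂ : σ₂) (S₂ : ∀ k, List (Γ₂ k)) :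
    p.left.Exec t (v, v₂) (sumStacks S S₂) (v', v₂) (sumStacks S' S₂) := by
  obtain ⟨s, hs, r⟩ := h
  refine ⟨s, hs, ?_⟩
  -- The induction on the run needs arbitrary end configurations in place of the entry and the
  -- halted one.
  suffices ∀ c c' : Cfg Γ₁ p.Λ σ₁, RunsIn p.code s c c' →
      RunsIn (Prog.left (Γ₂ := Γ₂) (σ₂ := σ₂) p).code s ⟨c.l, (c.var, v₂), sumStacks c.stk S₂⟩
        ⟨c'.l, (c'.var, v₂), sumStacks c'.stk S₂⟩ from this _ _ r
  clear r hs
  intro c c' hr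
  induction hr with
  | refl c => exact .refl _
  | @head t c c₁ c₂ h _ ih =>
    refine .head ?_ ih
    obtain ⟨_ | l, w, S⟩ := c
    · simp [step] at h
    · simp only [step, Option.some.injEq] at h ⊢
      subst h
      exact stepAux_liftLeft _ _ _ _ _

theorem Prog.Exec.right {p : Prog Γ₂ σ₂} {t : ℕ} {v v' : σ₂} {S S' : ∀ k, List (Γ₂ k)}
    (h : p.Exec t v S v' S') (v₁ : σ₁) (S₁ : ∀ k, List (Γ₁ k)) :
    p.right.Exec t (v₁, v) (sumStacks S₁ S) (v₁, v') (sumStacks S₁ S') := by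
  obtain ⟨s, hs, r⟩ := h
  refine ⟨s, hs, ?_⟩
  suffices ∀ c c' : Cfg Γ₂ p.Λ σ₂, RunsIn p.code s c c' →
      RunsIn (Prog.right (Γ₁ := Γ₁) (σ₁ := σ₁) p).code s ⟨c.l, (v₁, c.var), sumStacks S₁ c.stk⟩
        ⟨c'.l, (v₁, c'.var), sumStacks S₁ c'.stk⟩ from this _ _ r
  clear r hs
  intro c c' hr
  induction hr with
  | refl c => exact .refl _
  | @head t c c₁ c₂ h _ ih =>
    refine .head ?_ ih
    obtain ⟨_ | l, w, S⟩ := c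
    · simp [step] at h
    · simp only [step, Option.some.injEq] at h ⊢
      subst h
      exact stepAux_liftRight _ _ _ _ _

end Lift

/-! ### The stacks grow by a bounded amount in each step -/

section Growth

variable {K : Type} [DecidableEq K] {Γ : K → Type} {Λ σ : Type}

/-- An upper bound for the number of symbols that a statement pushes. -/
def pushes : Stmt Γ Λ σ → ℕ
  | push _ _ q => pushes q + 1
  | peek _ _ q => pushes q
  | pop _ _ q => pushes q
  | load _ q => pushes q
  | branch _ q₁ q₂ => pushes q₁ + pushes q₂
  | goto _ => 0
  | halt => 0

/-- Only pushes lengthen a stack. Counting both arms of a branch is wasteful but independent of the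
state. -/
theorem length_stepAux_le (q : Stmt Γ Λ σ) (v : σ) (S : ∀ k, List (Γ k)) (k : K) :
    ((stepAux q v S).stk k).length ≤ (S k).length + pushes q := by
  induction q generalizing v S with
  | push j g q ih =>
    refine (ih _ _).trans ?_
    by_cases h : k = j
    · subst h; simp [pushes]; omega
    · simp [pushes, h]; try omega
  | peek j g q ih => exact ih _ _
  | pop j g q ih =>
    refine (ih _ _).trans ?_
    by_cases h : k = j
    · subst h; simp [pushes]
    · simp [pushes, h]
  | load g q ih => exact ih _ _
  | branch g q₁ q₂ ih₁ ih₂ =>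
    have h₁ := ih₁ v S
    have h₂ := ih₂ v S
    cases h : g v <;> simp only [stepAux, h, cond_true, cond_false, pushes] <;> omega
  | goto l => simp [pushes]
  | halt => simp [pushes]

/-- Gives a bound, linear in the number of steps, on what a machine can write; this controls the
length of the generator's description. -/
theorem RunsIn.length_le [Fintype Λ] {M : Λ → Stmt Γ Λ σ} {t : ℕ} {c c' : Cfg Γ Λ σ}
    (h : RunsIn M t c c') (k : K) :
    (c'.stk k).length ≤ (c.stk k).length + t * ∑ l, pushes (M l) := by
  induction h with
  | refl c => simp
  | @head t c c₁ c₂ h _ ih =>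
    refine ih.trans ?_
    obtain ⟨_ | l, w, S⟩ := c
    · simp [step] at h
    · simp only [step, Option.some.injEq] at h
      subst h
      have h₁ := length_stepAux_le (M l) w S k
      have h₂ : pushes (M l) ≤ ∑ l, pushes (M l) :=
        Finset.single_le_sum (f := fun l => pushes (M l)) (fun _ _ => Nat.zero_le _)
          (Finset.mem_univ l)
      rw [Nat.succ_mul]
      simp only
      omega

end Growth

end StackProgram

/-! ### Register programs over the alphabet of circuit descriptions -/

instance : Fintype CircuitSymbol :=
  ⟨{.tick, .sep, .h, .t, .cx}, by intro x; cases x <;> simp⟩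

namespace StackProgram

open Turing Turing.TM2 Turing.TM2.Stmt

section Registers

variable {R : Type} [DecidableEq R]

/-- Programs whose stacks, the registers `R`, all carry the alphabet of circuit descriptions. -/
abbrev RegProg (R : Type) : Type 1 := Prog (fun _ : R => CircuitSymbol) (Option CircuitSymbol)

/-- Whatever the internal state, `p` turns the stacks `S` into `S'` within `t` steps. -/
structure RegProg.Maps (p : RegProg R) (t : ℕ) (S S' : R → List CircuitSymbol) : Prop where
  exec : ∀ v, ∃ v', p.Exec t v S v' S'

theorem RegProg.Maps.mono {p : RegProg R} {t t' : ℕ} {S S' : R → List CircuitSymbol}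
    (h : p.Maps t S S') (ht : t ≤ t') : p.Maps t' S S' :=
  ⟨fun v => let ⟨v', hv⟩ := h.exec v; ⟨v', hv.mono ht⟩⟩

theorem RegProg.Maps.congr {p : RegProg R} {t t' : ℕ} {S S' S'' : R → List CircuitSymbol}
    (h : p.Maps t S S') (ht : t ≤ t') (hS : S' = S'') : p.Maps t' S S'' :=
  hS ▸ h.mono ht

theorem RegProg.Maps.seq {p q : RegProg R} {t t' : ℕ} {S S' S'' : R → List CircuitSymbol}
    (hp : p.Maps t S S') (hq : q.Maps t' S' S'') : RegProg.Maps (p.seq q) (t + t') S S'' :=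
  ⟨fun v =>
    let ⟨v', hv⟩ := hp.exec v
    let ⟨v'', hv'⟩ := hq.exec v'
    ⟨v'', hv.seq hv'⟩⟩

/-- Push the symbol `s` on the register `k`. -/
def pushReg (k : R) (s : CircuitSymbol) : RegProg R := .single (push k (fun _ => s) halt)

theorem maps_pushReg {k : R} {s : CircuitSymbol} {S S' : R → List CircuitSymbol}
    (h : S' = Function.update S k (s :: S k)) : (pushReg k s).Maps 1 S S' :=
  ⟨fun v => ⟨v, Prog.exec_single (by rw [h]; rfl)⟩⟩

/-- Remove the top symbol of the register `k`. -/
def dropReg (k : R) : RegProg R := .single (pop k (fun v _ => v) halt)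

theorem maps_dropReg {k : R} {S S' : R → List CircuitSymbol}
    (h : S' = Function.update S k (S k).tail) : (dropReg k).Maps 1 S S' :=
  ⟨fun v => ⟨v, Prog.exec_single (by rw [h]; rfl)⟩⟩

/-- Move all symbols of the register `k` to the register `d`, thereby reversing their order. -/
def moveReg (k d : R) : RegProg R :=
  .loop k (fun _ o => o) Option.isSome
    (.single (push d (fun v => v.getD CircuitSymbol.tick) halt))

/-- Each symbol costs one test and one push, and the failing test on the empty register costs the
last step. -/
theorem maps_moveReg {k d : R} (hkd : k ≠ d) {S S' : R → List CircuitSymbol}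
    (h : S' = Function.update (Function.update S k []) d ((S k).reverse ++ S d)) :
    (moveReg k d).Maps (2 * (S k).length + 1) S S' := by
  subst h
  refine ⟨fun v => ?_⟩
  generalize hl : S k = l
  induction l generalizing S v with
  | nil =>
    refine ⟨none, ?_⟩
    have := Prog.exec_loop_exit (k := k) (g := fun _ o => o) (c := Option.isSome)
      (p := .single (push d (fun v => v.getD CircuitSymbol.tick) halt)) (v := v) (S := S)
      (by simp [hl])
    convert this using 1
    · rfl
    · simp
    · simp [hl]
    · funext r
      by_cases hr : r = d
      · subst hr; simp [hkd.symm]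
      · simp [hr, hl]
  | cons s l ih =>
    obtain ⟨v', hv'⟩ := ih (S := Function.update (Function.update S k l) d (s :: S d)) (some s)
      (by simp [hkd])
    refine ⟨v', ?_⟩
    have h₁ : (Prog.single (push d (fun v => v.getD CircuitSymbol.tick) halt)).Exec 1
        (some s) (Function.update S k l) (some s)
        (Function.update (Function.update S k l) d (s :: S d)) :=
      Prog.exec_single (by simp [hkd.symm])
    have h₂ : (moveReg k d).Exec (1 + (2 * l.length + 1) + 1) v S v' _ :=
      Prog.exec_loop_next (by simp [hl]) (by simpa [hl] using h₁) hv'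
    have hS : Function.update (Function.update (Function.update (Function.update S k l) d (s :: S d))
        k []) d (l.reverse ++ Function.update (Function.update S k l) d (s :: S d) d) =
        Function.update (Function.update S k []) d ((s :: l).reverse ++ S d) := by
      funext r
      by_cases hr : r = d
      · subst hr; simp
      · by_cases hr' : r = k
        · subst hr'; simp [hr]
        · simp [hr, hr']
    rw [hS] at h₂
    exact h₂.mono (by simp; omega)

/-- As long as a `tick` can be popped from the register `k`, run `p`. -/
def whileTick (k : R) (p : RegProg R) : RegProg R :=
  .loop k (fun _ o => o) (fun o => o = some CircuitSymbol.tick) p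

/-- `F j` describes the registers when `j` iterations are left. -/
theorem maps_whileTick {k : R} {p : RegProg R} {N T : ℕ} (F : ℕ → R → List CircuitSymbol)
    (htick : ∀ j < N, (F (j + 1) k).head? = some CircuitSymbol.tick)
    (hzero : (F 0 k).head? ≠ some CircuitSymbol.tick)
    (hp : ∀ j < N, p.Maps T (Function.update (F (j + 1)) k (F (j + 1) k).tail) (F j))
    {S S' : R → List CircuitSymbol} (hS : S = F N)
    (hS' : S' = Function.update (F 0) k (F 0 k).tail) :
    (whileTick k p).Maps (N * (T + 1) + 1) S S' := by
  -- The induction is on the number of iterations left, with the internal state arbitrary since the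
  -- body may change it.
  subst hS hS'
  refine ⟨fun v => ?_⟩
  induction N generalizing v with
  | zero => exact ⟨_, (Prog.exec_loop_exit (by simpa using hzero)).mono (by omega)⟩
  | succ N ih =>
    obtain ⟨v', hv'⟩ := (hp N (by omega)).exec ((F (N + 1) k).head?)
    obtain ⟨v'', hv''⟩ := ih (fun j hj => htick j (by omega)) (fun j hj => hp j (by omega)) v'
    exact ⟨v'', (Prog.exec_loop_next (by simpa using htick N (by omega)) hv' hv'').mono
      (by rw [Nat.succ_mul]; omega)⟩

/-- The unary representation of a number. -/
def ticks (n : ℕ) : List CircuitSymbol := List.replicate n CircuitSymbol.tick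

@[simp] theorem ticks_zero : ticks 0 = [] := rfl

theorem ticks_succ (n : ℕ) : ticks (n + 1) = CircuitSymbol.tick :: ticks n := rfl

@[simp] theorem tail_ticks (n : ℕ) : (ticks n).tail = ticks (n - 1) := by
  cases n <;> rfl

@[simp] theorem ticks_append_ticks (m n : ℕ) : ticks m ++ ticks n = ticks (m + n) :=
  List.replicate_append_replicate

theorem encodeIndex_eq (n : ℕ) : encodeIndex n = ticks n ++ [CircuitSymbol.sep] := rfl

theorem maps_clear {k : R} {c : ℕ} {S S' : R → List CircuitSymbol} (hc : S k = ticks c)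
    (hS' : S' = Function.update S k []) :
    (whileTick k (.single halt)).Maps (c * 2 + 1) S S' := by
  refine maps_whileTick (fun j => Function.update S k (ticks j)) ?_ ?_ ?_ ?_ ?_
  · simp [ticks_succ]
  · simp
  · intro j _
    exact ⟨fun v => ⟨v, Prog.exec_single (by simp [ticks_succ])⟩⟩
  · simp [← hc]
  · simp [hS']

/-- Reads one unary number: the loop stops at the first symbol of `rest` and swallows it, hence
`rest.tail`. -/
theorem maps_shift {k d : R} (hkd : k ≠ d) {c : ℕ} {rest : List CircuitSymbol}
    {S S' : R → List CircuitSymbol} (hc : S k = ticks c ++ rest)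
    (hrest : rest.head? ≠ some CircuitSymbol.tick)
    (hS' : S' = Function.update (Function.update S k rest.tail) d (ticks c ++ S d)) :
    (whileTick k (pushReg d .tick)).Maps (c * 2 + 1) S S' := by
  -- With `j` ticks left in `k`, the other `c - j` have arrived in `d`.
  refine maps_whileTick
    (fun j => Function.update (Function.update S k (ticks j ++ rest)) d (ticks (c - j) ++ S d))
    ?_ ?_ ?_ ?_ ?_
  · simp [ticks_succ, hkd]
  · simpa [hkd] using hrest
  · intro j hj
    refine maps_pushReg ?_
    funext r
    by_cases hr : r = d
    · subst hr
      simp [hkd.symm, show c - j = c - (j + 1) + 1 by omega, ticks_succ]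
    · by_cases hr' : r = k
      · subst hr'; simp [hr, ticks_succ]
      · simp [hr, hr']
  · funext r
    by_cases hr : r = d
    · subst hr; simp
    · by_cases hr' : r = k
      · subst hr'; simp [hr, hc]
      · simp [hr, hr']
  · subst hS'
    funext r
    by_cases hr : r = d
    · subst hr; simp [hkd.symm]
    · by_cases hr' : r = k
      · subst hr'; simp [hr]
      · simp [hr, hr']

/-- Push the number in the register `k` on the register `d`, using the auxiliary register `t`. -/
def copyReg (t k d : R) : RegProg R :=
  (whileTick k ((pushReg t .tick).seq (pushReg d .tick))).seq (whileTick t (pushReg k .tick))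

/-- Reading a register destroys it, so the number goes to both `t` and `d` at three steps per tick
and is then restored from `t` at two steps per tick. -/
theorem maps_copyReg {t k d : R} (hkd : k ≠ d) (htk : t ≠ k) (htd : t ≠ d) {c : ℕ}
    {S S' : R → List CircuitSymbol} (hc : S k = ticks c) (ht : S t = [])
    (hS' : S' = Function.update S d (ticks c ++ S d)) :
    (copyReg t k d).Maps (5 * c + 2) S S' := by
  refine RegProg.Maps.mono (t := (c * 3 + 1) + (c * 2 + 1)) (RegProg.Maps.seq
    (S' := Function.update (Function.update (Function.update S k []) t (ticks c)) d
      (ticks c ++ S d)) ?_ ?_) (by omega)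
  · refine maps_whileTick (fun j => Function.update (Function.update (Function.update S k (ticks j))
      t (ticks (c - j))) d (ticks (c - j) ++ S d)) ?_ ?_ ?_ ?_ ?_
    · simp [ticks_succ, hkd, htk.symm]
    · simp [hkd, htk.symm]
    · intro j hj
      refine RegProg.Maps.seq (maps_pushReg rfl) (maps_pushReg ?_)
      funext r
      by_cases hr : r = d
      · subst hr
        simp [hkd.symm, htd.symm, show c - j = c - (j + 1) + 1 by omega, ticks_succ]
      · by_cases hr' : r = t
        · subst hr'; simp [hr, htk, ticks_succ, show c - j = c - (j + 1) + 1 by omega]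
        · by_cases hr'' : r = k
          · subst hr''; simp [hr, hr', ticks_succ]
          · simp [hr, hr', hr'']
    · funext r
      by_cases hr : r = d
      · subst hr; simp
      · by_cases hr' : r = t
        · subst hr'; simp [hr, ht]
        · by_cases hr'' : r = k
          · subst hr''; simp [hr, hr', hc]
          · simp [hr, hr', hr'']
    · funext r
      by_cases hr'' : r = k
      · subst hr''; simp [htk.symm, hkd]
      · simp [hr'']
  · refine maps_shift htk (rest := []) (by simp [htd]) (by simp) ?_
    subst hS'
    funext r
    by_cases hr'' : r = k
    · subst hr''; simp [htk.symm, hkd, hc]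
    · by_cases hr' : r = t
      · subst hr'; simp [hr'', htd, ht]
      · simp [hr', hr'', Function.update_apply]

end Registers
end StackProgram

/-! ### The program that writes down the commitment circuit -/

namespace StackProgram

open Turing Turing.TM2 Turing.TM2.Stmt

/-- The registers of the program that writes down the commitment circuit. -/
inductive Reg : Type
  | src | buf | nn | mm | aa | lo | hi | idx | tmp | out
  deriving DecidableEq

instance : Fintype Reg :=
  ⟨{.src, .buf, .nn, .mm, .aa, .lo, .hi, .idx, .tmp, .out}, by intro x; cases x <;> simp⟩

/-- The register contents with the given values. -/
def regs (src buf : List CircuitSymbol) (n m a lo hi idx : ℕ) (out : List CircuitSymbol) :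
    Reg → List CircuitSymbol
  | .src => src
  | .buf => buf
  | .nn => ticks n
  | .mm => ticks m
  | .aa => ticks a
  | .lo => ticks lo
  | .hi => ticks hi
  | .idx => ticks idx
  | .tmp => []
  | .out => out

/-- Write the index in the register `k` in front of the output. -/
def emitIndex (k : Reg) : RegProg Reg := (pushReg .out .sep).seq (copyReg .tmp k .out)

/-- Write a Hadamard gate on the wire in the register `k` in front of the output. -/
def emitH (k : Reg) : RegProg Reg := (emitIndex k).seq (pushReg .out .h)

/-- Write a CNOT gate on the wires in the registers `k` and `k'` in front of the output. -/
def emitCX (k k' : Reg) : RegProg Reg :=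
  (emitIndex k').seq ((emitIndex k).seq (pushReg .out .cx))

theorem update_out_regs (src buf : List CircuitSymbol) (n m a lo hi idx : ℕ)
    (out out' : List CircuitSymbol) :
    Function.update (regs src buf n m a lo hi idx out) .out out' =
      regs src buf n m a lo hi idx out' := by
  funext r; cases r <;> simp [regs]

theorem maps_copyReg_out {src buf : List CircuitSymbol} {n m a lo hi idx : ℕ}
    {out : List CircuitSymbol} {k : Reg} {c : ℕ} (ho : k ≠ .out) (ht : k ≠ .tmp)
    (hc : regs src buf n m a lo hi idx out k = ticks c) :
    (copyReg .tmp k .out).Maps (5 * c + 2) (regs src buf n m a lo hi idx out)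
      (regs src buf n m a lo hi idx (ticks c ++ out)) :=
  maps_copyReg ho ht.symm (by decide) hc rfl (by rw [update_out_regs]; rfl)

theorem maps_pushReg_out (src buf : List CircuitSymbol) (n m a lo hi idx : ℕ)
    (out : List CircuitSymbol) (s : CircuitSymbol) :
    (pushReg Reg.out s).Maps 1 (regs src buf n m a lo hi idx out)
      (regs src buf n m a lo hi idx (s :: out)) :=
  maps_pushReg (by rw [update_out_regs]; rfl)

/-- The output is a stack, so everything is written backwards: the closing separator is pushed
before the ticks. -/
theorem maps_emitIndex {src buf : List CircuitSymbol} {n m a lo hi idx : ℕ}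
    {out : List CircuitSymbol} {k : Reg} {c : ℕ} (ho : k ≠ .out) (ht : k ≠ .tmp)
    (hc : regs src buf n m a lo hi idx [] k = ticks c) :
    (emitIndex k).Maps (5 * c + 3) (regs src buf n m a lo hi idx out)
      (regs src buf n m a lo hi idx (encodeIndex c ++ out)) := by
  have hc' : regs src buf n m a lo hi idx (.sep :: out) k = ticks c := by
    rw [← hc]; cases k <;> first | rfl | exact absurd rfl ho
  exact (RegProg.Maps.seq (maps_pushReg_out ..) (maps_copyReg_out ho ht hc')).congr (by omega)
    (by simp [encodeIndex_eq])

/-- The description of a Hadamard gate. -/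
def descH (i : ℕ) : List CircuitSymbol := CircuitSymbol.h :: encodeIndex i

/-- The description of a CNOT gate. -/
def descCX (i j : ℕ) : List CircuitSymbol := CircuitSymbol.cx :: (encodeIndex i ++ encodeIndex j)

theorem maps_emitH {src buf : List CircuitSymbol} {n m a lo hi idx : ℕ}
    {out : List CircuitSymbol} {k : Reg} {c : ℕ} (ho : k ≠ .out) (ht : k ≠ .tmp)
    (hc : regs src buf n m a lo hi idx [] k = ticks c) :
    (emitH k).Maps (5 * c + 4) (regs src buf n m a lo hi idx out)
      (regs src buf n m a lo hi idx (descH c ++ out)) :=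
  (RegProg.Maps.seq (maps_emitIndex ho ht hc) (maps_pushReg_out ..)).congr (by omega) rfl

theorem maps_emitCX {src buf : List CircuitSymbol} {n m a lo hi idx : ℕ}
    {out : List CircuitSymbol} {k k' : Reg} {c c' : ℕ} (ho : k ≠ .out) (ht : k ≠ .tmp)
    (ho' : k' ≠ .out) (ht' : k' ≠ .tmp) (hc : regs src buf n m a lo hi idx [] k = ticks c)
    (hc' : regs src buf n m a lo hi idx [] k' = ticks c') :
    (emitCX k k').Maps (5 * c + 5 * c' + 7) (regs src buf n m a lo hi idx out)
      (regs src buf n m a lo hi idx (descCX c c' ++ out)) := by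
  exact (RegProg.Maps.seq (maps_emitIndex ho' ht' hc')
    (RegProg.Maps.seq (maps_emitIndex ho ht hc) (maps_pushReg_out ..))).congr (by omega)
    (by simp [descCX])

/-- The description of the gates that encrypt the wire `j` and prepare the key wires `x`, `z`. -/
def descPad (b : Bool) (x z j : ℕ) : List CircuitSymbol :=
  descH x ++ (descH z ++ bif b then descH j ++ (descCX z j ++ (descH j ++ descCX x j)) else [])

/-- Write the gates `descPad` in front of the output. -/
def emitPad : Bool → RegProg Reg
  | false => (emitH .hi).seq (emitH .lo)
  | true => (emitCX .lo .idx).seq ((emitH .idx).seq ((emitCX .hi .idx).seq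
      ((emitH .idx).seq ((emitH .hi).seq (emitH .lo)))))

theorem maps_emitPad (b : Bool) (src buf : List CircuitSymbol) (n m a lo hi idx : ℕ)
    (out : List CircuitSymbol) :
    (emitPad b).Maps (10 * lo + 10 * hi + 20 * idx + 30) (regs src buf n m a lo hi idx out)
      (regs src buf n m a lo hi idx (descPad b lo hi idx ++ out)) := by
  have hlo {out} := maps_emitH (src := src) (buf := buf) (n := n) (m := m) (a := a) (lo := lo)
    (hi := hi) (idx := idx) (out := out) (k := .lo) (c := lo) (by decide) (by decide) rfl
  have hhi {out} := maps_emitH (src := src) (buf := buf) (n := n) (m := m) (a := a) (lo := lo)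
    (hi := hi) (idx := idx) (out := out) (k := .hi) (c := hi) (by decide) (by decide) rfl
  cases b
  · exact (hhi.seq hlo).congr (by omega) (by simp [descPad])
  · have hidx {out} := maps_emitH (src := src) (buf := buf) (n := n) (m := m) (a := a) (lo := lo)
      (hi := hi) (idx := idx) (out := out) (k := .idx) (c := idx) (by decide) (by decide) rfl
    have hx {out} := maps_emitCX (src := src) (buf := buf) (n := n) (m := m) (a := a) (lo := lo)
      (hi := hi) (idx := idx) (out := out) (k := .lo) (k' := .idx) (c := lo) (c' := idx)
      (by decide) (by decide) (by decide) (by decide) rfl rfl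
    have hz {out} := maps_emitCX (src := src) (buf := buf) (n := n) (m := m) (a := a) (lo := lo)
      (hi := hi) (idx := idx) (out := out) (k := .hi) (k' := .idx) (c := hi) (c' := idx)
      (by decide) (by decide) (by decide) (by decide) rfl rfl
    exact (hx.seq (hidx.seq (hz.seq (hidx.seq (hhi.seq hlo))))).congr (by omega)
      (by simp [descPad])

/-- The description of the gates that load the key bit on the wire `k` into the wire `i`. -/
def descLoad (k i : ℕ) : List CircuitSymbol := descH k ++ descCX k i

theorem maps_emitLoad (src buf : List CircuitSymbol) (n m a lo hi idx : ℕ)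
    (out : List CircuitSymbol) :
    RegProg.Maps ((emitCX .lo .idx).seq (emitH .lo)) (10 * lo + 5 * idx + 11)
      (regs src buf n m a lo hi idx out)
      (regs src buf n m a lo hi idx (descLoad lo idx ++ out)) := by
  exact (RegProg.Maps.seq (maps_emitCX (k := .lo) (k' := .idx) (c := lo) (c' := idx)
    (by decide) (by decide) (by decide) (by decide) rfl rfl)
    (maps_emitH (k := .lo) (c := lo) (by decide) (by decide) rfl)).congr (by omega)
    (by simp [descLoad])

/-- Write the gates `descPad` for all wires below the content of `idx`. -/
def emitPads (b : Bool) : RegProg Reg :=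
  whileTick .idx ((dropReg .lo).seq ((dropReg .hi).seq (emitPad b)))

/-- The wires are treated in descending order because each description lands in front of the earlier
ones. Both key counters descend along with `idx` and are decremented before use. -/
theorem maps_emitPads (b : Bool) (src buf : List CircuitSymbol) (n m a lo hi j B : ℕ)
    (out : List CircuitSymbol) (hlo : lo + j ≤ B) (hhi : hi + j ≤ B) :
    (emitPads b).Maps (j * (40 * B + 33) + 1)
      (regs src buf n m a (lo + j) (hi + j) j out)
      (regs src buf n m a lo hi 0
        ((List.range j).flatMap (fun i => descPad b (lo + i) (hi + i) i) ++ out)) := by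
  -- With `i` iterations left, the gates for the wires from `i` up to `j - 1` are written. All
  -- indices are at most `B`, so an iteration takes at most 10B + 10B + 20B + 30 steps and two more
  -- for the decrements.
  refine maps_whileTick (N := j) (T := 40 * B + 32) (fun i => regs src buf n m a (lo + i) (hi + i) i
    (((List.range' i (j - i)).flatMap fun i => descPad b (lo + i) (hi + i) i) ++ out)) ?_ ?_ ?_ ?_ ?_
  · intro i _; rfl
  · simp [regs]
  · intro i hi'
    refine RegProg.Maps.mono (RegProg.Maps.seq (S' := regs src buf n m a (lo + i) (hi + (i + 1)) i
      (((List.range' (i + 1) (j - (i + 1))).flatMap fun i => descPad b (lo + i) (hi + i) i) ++ out))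
      (maps_dropReg ?_) (RegProg.Maps.seq (maps_dropReg (S' := regs src buf n m a (lo + i) (hi + i) i
      (((List.range' (i + 1) (j - (i + 1))).flatMap fun i => descPad b (lo + i) (hi + i) i) ++ out))
      ?_) (S'' := _) ?_)) (by omega : 1 + (1 + (10 * (lo + i) + 10 * (hi + i) + 20 * i + 30)) ≤ _)
    · funext r; cases r <;> simp [regs]
    · funext r; cases r <;> simp [regs]
    · convert maps_emitPad b src buf n m a (lo + i) (hi + i) i _ using 2
      rw [show j - i = j - (i + 1) + 1 by omega, List.range'_succ]
      simp
  · simp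
  · funext r; cases r <;> simp [regs, List.range_eq_range']

/-- Write the gates `descLoad` for all wires below the content of `idx`. -/
def emitLoads : RegProg Reg :=
  whileTick .idx ((dropReg .lo).seq ((emitCX .lo .idx).seq (emitH .lo)))

theorem maps_emitLoads (src buf : List CircuitSymbol) (n m a lo hi j B : ℕ)
    (out : List CircuitSymbol) (hlo : lo + j ≤ B) :
    emitLoads.Maps (j * (40 * B + 33) + 1)
      (regs src buf n m a (lo + j) hi j out)
      (regs src buf n m a lo hi 0
        ((List.range j).flatMap (fun i => descLoad (lo + i) i) ++ out)) := by
  refine maps_whileTick (N := j) (T := 40 * B + 32) (fun i => regs src buf n m a (lo + i) hi i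
    (((List.range' i (j - i)).flatMap fun i => descLoad (lo + i) i) ++ out)) ?_ ?_ ?_ ?_ ?_
  · intro i _; rfl
  · simp [regs]
  · intro i hi'
    refine RegProg.Maps.mono (RegProg.Maps.seq (S' := regs src buf n m a (lo + i) hi i
      (((List.range' (i + 1) (j - (i + 1))).flatMap fun i => descLoad (lo + i) i) ++ out))
      (maps_dropReg ?_) (S'' := _) ?_) (by omega : 1 + (10 * (lo + i) + 5 * i + 11) ≤ _)
    · funext r; cases r <;> simp [regs]
    · convert maps_emitLoad src buf n m a (lo + i) hi i _ using 2
      rw [show j - i = j - (i + 1) + 1 by omega, List.range'_succ]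
      simp
  · simp
  · funext r; cases r <;> simp [regs, List.range_eq_range']

end StackProgram

/-! ### Rewriting the description of the generator circuit -/

namespace StackProgram

open Turing Turing.TM2 Turing.TM2.Stmt

/-- The description of the commitment circuit built from a generator circuit with registers of
`m` and `a` wires, whose gates are described by `gates`. -/
def descCommit (b : Bool) (n m a : ℕ) (gates : List CircuitSymbol) : List CircuitSymbol :=
  encodeIndex m ++ (encodeIndex (a + (n + (m + m))) ++
    ((List.range n).flatMap (fun i => descLoad (m + a + i) i) ++
      (gates ++ (List.range m).flatMap
        fun j => descPad b (m + a + n + j) (m + a + n + m + j) j)))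

/-- Parse the description of the generator circuit, which is in the register `buf` in reverse. -/
def parse : RegProg Reg :=
  (moveReg .buf .src).seq ((whileTick .src (pushReg .mm .tick)).seq
    ((whileTick .src (pushReg .aa .tick)).seq (moveReg .src .buf)))

/-- The first move undoes the reversal, the two shifts read the register sizes together with their
separators, and the last move reverses the gates again, so that a later move to the output puts them
in the right order. -/
theorem maps_parse (n m a : ℕ) (gates : List CircuitSymbol) :
    parse.Maps (4 * (m + a + gates.length) + 10)
      (regs [] (encodeIndex m ++ (encodeIndex a ++ gates)).reverse n 0 0 0 0 0 [])
      (regs [] gates.reverse n m a 0 0 0 []) := by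
  refine (RegProg.Maps.seq (maps_moveReg
      (S' := regs (encodeIndex m ++ (encodeIndex a ++ gates)) [] n 0 0 0 0 0 []) (by decide) ?_)
    (RegProg.Maps.seq (maps_shift (c := m) (rest := .sep :: (encodeIndex a ++ gates))
      (S' := regs (encodeIndex a ++ gates) [] n m 0 0 0 0 []) (by decide) ?_ (by simp) ?_)
    (RegProg.Maps.seq (maps_shift (c := a) (rest := .sep :: gates)
      (S' := regs gates [] n m a 0 0 0 []) (by decide) ?_ (by simp) ?_)
    (maps_moveReg (S' := regs [] gates.reverse n m a 0 0 0 []) (by decide) ?_)))).congr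
    ?_ rfl
  · funext r; cases r <;> simp [regs]
  · simp [regs, encodeIndex_eq]
  · funext r; cases r <;> simp [regs]
  · simp [regs, encodeIndex_eq]
  · funext r; cases r <;> simp [regs]
  · funext r; cases r <;> simp [regs]
  · simp [regs, encodeIndex]; omega

/-- Compute the wire indices needed by `emitPads`. -/
def setup : RegProg Reg :=
  (copyReg .tmp .mm .lo).seq ((copyReg .tmp .nn .lo).seq ((copyReg .tmp .aa .lo).seq
    ((copyReg .tmp .mm .lo).seq ((copyReg .tmp .lo .hi).seq ((copyReg .tmp .mm .hi).seq
      (copyReg .tmp .mm .idx))))))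

/-- The counters start one past the last X-key wire and one past the last Z-key wire, since
`emitPads` decrements before emitting. -/
theorem maps_setup (buf : List CircuitSymbol) (n m a : ℕ) :
    setup.Maps (40 * (n + m + a) + 14) (regs [] buf n m a 0 0 0 [])
      (regs [] buf n m a (m + a + n + m) (m + a + n + m + m) m []) := by
  refine (RegProg.Maps.seq (maps_copyReg (c := m)
      (S' := regs [] buf n m a m 0 0 []) (by decide) (by decide) (by decide) rfl rfl ?_)
    (RegProg.Maps.seq (maps_copyReg (c := n)
      (S' := regs [] buf n m a (n + m) 0 0 []) (by decide) (by decide) (by decide) rfl rfl ?_)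
    (RegProg.Maps.seq (maps_copyReg (c := a)
      (S' := regs [] buf n m a (a + (n + m)) 0 0 []) (by decide) (by decide) (by decide) rfl rfl ?_)
    (RegProg.Maps.seq (maps_copyReg (c := m)
      (S' := regs [] buf n m a (m + a + n + m) 0 0 []) (by decide) (by decide) (by decide) rfl rfl
        ?_)
    (RegProg.Maps.seq (maps_copyReg (c := m + a + n + m)
      (S' := regs [] buf n m a (m + a + n + m) (m + a + n + m) 0 []) (by decide) (by decide)
        (by decide) rfl rfl ?_)
    (RegProg.Maps.seq (maps_copyReg (c := m)
      (S' := regs [] buf n m a (m + a + n + m) (m + a + n + m + m) 0 []) (by decide) (by decide)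
        (by decide) rfl rfl ?_)
    (maps_copyReg (c := m) (S' := regs [] buf n m a (m + a + n + m) (m + a + n + m + m) m [])
      (by decide) (by decide) (by decide) rfl rfl ?_))))))).congr (by omega) rfl
  all_goals
    funext r
    cases r <;> simp [regs] <;> (congr 1; omega)

/-- Write the sizes of the registers. -/
def emitHeader : RegProg Reg :=
  (pushReg .out .sep).seq ((copyReg .tmp .mm .out).seq ((copyReg .tmp .mm .out).seq
    ((copyReg .tmp .nn .out).seq ((copyReg .tmp .aa .out).seq (emitIndex .mm)))))

theorem maps_emitHeader (n m a lo hi : ℕ) (out : List CircuitSymbol) :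
    emitHeader.Maps (20 * (n + m + a) + 20) (regs [] [] n m a lo hi 0 out)
      (regs [] [] n m a lo hi 0 (encodeIndex m ++ (encodeIndex (a + (n + (m + m))) ++ out))) := by
  refine ((maps_pushReg_out ..).seq
    ((maps_copyReg_out (k := .mm) (c := m) (by decide) (by decide) rfl).seq
    ((maps_copyReg_out (k := .mm) (c := m) (by decide) (by decide) rfl).seq
    ((maps_copyReg_out (k := .nn) (c := n) (by decide) (by decide) rfl).seq
    ((maps_copyReg_out (k := .aa) (c := a) (by decide) (by decide) rfl).seq
    (maps_emitIndex (k := .mm) (c := m) (by decide) (by decide) rfl)))))).congr (by omega) ?_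
  simp only [encodeIndex_eq, ← ticks_append_ticks, List.append_assoc, List.singleton_append]

/-- Empty all registers except the output. -/
def cleanup : RegProg Reg :=
  Prog.seq (whileTick .nn (.single halt)) (Prog.seq (whileTick .mm (.single halt))
    (Prog.seq (whileTick .aa (.single halt)) (Prog.seq (whileTick .lo (.single halt))
      (whileTick .hi (.single halt)))))

/-- A halting configuration must have all stacks empty except for the output. -/
theorem maps_cleanup (n m a lo hi : ℕ) (out : List CircuitSymbol) :
    cleanup.Maps (2 * (n + m + a + lo + hi) + 5) (regs [] [] n m a lo hi 0 out)
      (regs [] [] 0 0 0 0 0 0 out) := by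
  refine (RegProg.Maps.seq (maps_clear (c := n) (S' := regs [] [] 0 m a lo hi 0 out) rfl ?_)
    (RegProg.Maps.seq (maps_clear (c := m) (S' := regs [] [] 0 0 a lo hi 0 out) rfl ?_)
    (RegProg.Maps.seq (maps_clear (c := a) (S' := regs [] [] 0 0 0 lo hi 0 out) rfl ?_)
    (RegProg.Maps.seq (maps_clear (c := lo) (S' := regs [] [] 0 0 0 0 hi 0 out) rfl ?_)
    (maps_clear (c := hi) (S' := regs [] [] 0 0 0 0 0 0 out) rfl ?_))))).congr (by omega) rfl
  all_goals
    funext r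
    cases r <;> simp [regs]

/-- Turn the description of the generator circuit into that of the commitment circuit. -/
def writer (b : Bool) : RegProg Reg :=
  parse.seq (setup.seq ((emitPads b).seq ((moveReg .buf .out).seq ((copyReg .tmp .nn .idx).seq
    (emitLoads.seq (emitHeader.seq cleanup))))))

/-- The parts are pushed in reverse: pad, generator gates, key loading, header. After the pad the
counter `lo` stands at m + a + n, one past the last key wire, which is just where `emitLoads` has to
start. -/
theorem maps_writer (b : Bool) (n m a B : ℕ) (gates : List CircuitSymbol)
    (hB : n + m + a + gates.length ≤ B) :
    (writer b).Maps (2 * (B * (120 * B + 33)) + 100 * B + 100)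
      (regs [] (encodeIndex m ++ (encodeIndex a ++ gates)).reverse n 0 0 0 0 0 [])
      (regs [] [] 0 0 0 0 0 0 (descCommit b n m a gates)) := by
  -- All wire counters are at most n + 3m + a ≤ 3B, so the bounds of `emitPads` and `emitLoads` are
  -- used with 3B.
  have h₁ : m * (40 * (3 * B) + 33) ≤ B * (120 * B + 33) := by
    rw [← mul_assoc]; exact Nat.mul_le_mul_right _ (by omega)
  have h₂ : n * (40 * (3 * B) + 33) ≤ B * (120 * B + 33) := by
    rw [← mul_assoc]; exact Nat.mul_le_mul_right _ (by omega)
  refine ((maps_parse n m a gates).seq ((maps_setup _ n m a).seq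
    ((maps_emitPads b [] gates.reverse n m a (m + a + n) (m + a + n + m) m (3 * B) [] (by omega)
      (by omega)).seq
    ((maps_moveReg (S' := regs [] [] n m a (m + a + n) (m + a + n + m) 0 (gates ++
      (List.range m).flatMap fun j => descPad b (m + a + n + j) (m + a + n + m + j) j))
      (by decide) ?_).seq
    ((maps_copyReg (c := n) (S' := regs [] [] n m a (m + a + n) (m + a + n + m) n (gates ++
      (List.range m).flatMap fun j => descPad b (m + a + n + j) (m + a + n + m + j) j))
      (by decide) (by decide) (by decide) rfl rfl ?_).seq
    ((maps_emitLoads [] [] n m a (m + a) (m + a + n + m) n (3 * B) _ (by omega)).seq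
    ((maps_emitHeader ..).seq (maps_cleanup ..)))))))).congr ?_ rfl
  · funext r; cases r <;> simp [regs]
  · funext r; cases r <;> simp [regs]
  · have h₃ : (regs [] gates.reverse n m a (m + a + n) (m + a + n + m) 0
        ((List.range m).flatMap (fun j => descPad b (m + a + n + j) (m + a + n + m + j) j) ++ [])
        Reg.buf).length = gates.length := by simp [regs]
    rw [h₃]
    omega

/-! ### The machine that writes down the commitment circuit -/

section Drain

variable {K : Type} [DecidableEq K] {Γ : K → Type} {σ τ : Type}

/-- Run `p` for each symbol of the stack `k`, with the translated symbol in the internal state. -/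
def drain (k : K) (f : Γ k → τ) (p : Prog Γ (σ × Option τ)) : Prog Γ (σ × Option τ) :=
  p.loop k (fun v o => (v.1, o.map f)) (fun v => v.2.isSome)

/-- `F b l` describes the stacks when the symbols `l` are still to be processed. -/
theorem exec_drain {k : K} {f : Γ k → τ} {p : Prog Γ (σ × Option τ)} {T : ℕ} {β : Type} {v : σ}
    (F : β → List (Γ k) → ∀ k, List (Γ k)) (next : β → Γ k → β) (hF : ∀ b l, F b l k = l)
    (hp : ∀ b x l, p.Exec T (v, some (f x)) (Function.update (F b (x :: l)) k l) (v, some (f x))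
      (F (next b x) l)) (l : List (Γ k)) (b : β) (o : Option τ) :
    (drain k f p).Exec (l.length * (T + 1) + 1) (v, o) (F b l) (v, none)
      (F (l.foldl next b) []) := by
  induction l generalizing b o with
  | nil =>
    have h := Prog.exec_loop_exit (k := k) (g := fun v o => (v.1, o.map f))
      (c := fun v : σ × Option τ => v.2.isSome) (p := p) (v := (v, o)) (S := F b []) (by simp [hF])
    have h' : Function.update (F b []) k [] = F b [] :=
      Function.update_eq_self_iff.2 (hF b []).symm
    simp only [hF, List.head?_nil, Option.map_none, List.tail_nil, h'] at h
    exact h.mono (by omega)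
  | cons x l ih =>
    refine (Prog.exec_loop_next (v' := (v, some (f x))) (S' := F (next b x) l) (t := T) ?_ ?_
      (ih (next b x) (some (f x)))).mono (by rw [List.length_cons, Nat.succ_mul]; omega)
    · simp [hF]
    · simpa [hF] using hp b x l

variable {K₁ K₂ : Type} [DecidableEq K₁] [DecidableEq K₂] {Γ₁ : K₁ → Type} {Γ₂ : K₂ → Type}
  {Λ : Type}

/-- `push` on the first family of stacks. -/
def pushLeft (k : K₁) (f : σ → Γ₁ k) (q : Stmt (Sum.elim Γ₁ Γ₂) Λ σ) :
    Stmt (Sum.elim Γ₁ Γ₂) Λ σ :=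
  push (.inl k) f q

/-- `push` on the second family of stacks. -/
def pushRight (k : K₂) (f : σ → Γ₂ k) (q : Stmt (Sum.elim Γ₁ Γ₂) Λ σ) :
    Stmt (Sum.elim Γ₁ Γ₂) Λ σ :=
  push (.inr k) f q

theorem stepAux_pushLeft (k : K₁) (f : σ → Γ₁ k) (q : Stmt (Sum.elim Γ₁ Γ₂) Λ σ) (v : σ)
    (S₁ : ∀ k, List (Γ₁ k)) (S₂ : ∀ k, List (Γ₂ k)) :
    stepAux (pushLeft k f q) v (sumStacks S₁ S₂) =
      stepAux q v (sumStacks (Function.update S₁ k (f v :: S₁ k)) S₂) :=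
  congrArg (stepAux q v) (update_sumStacks_inl ..)

theorem stepAux_pushRight (k : K₂) (f : σ → Γ₂ k) (q : Stmt (Sum.elim Γ₁ Γ₂) Λ σ) (v : σ)
    (S₁ : ∀ k, List (Γ₁ k)) (S₂ : ∀ k, List (Γ₂ k)) :
    stepAux (pushRight k f q) v (sumStacks S₁ S₂) =
      stepAux q v (sumStacks S₁ (Function.update S₂ k (f v :: S₂ k))) :=
  congrArg (stepAux q v) (update_sumStacks_inr ..)

/-- `drain` on the first family of stacks. -/
def drainLeft (k : K₁) (f : Γ₁ k → τ) (p : Prog (Sum.elim Γ₁ Γ₂) (σ × Option τ)) :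
    Prog (Sum.elim Γ₁ Γ₂) (σ × Option τ) :=
  drain (.inl k) f p

/-- `drain` on the second family of stacks. -/
def drainRight (k : K₂) (f : Γ₂ k → τ) (p : Prog (Sum.elim Γ₁ Γ₂) (σ × Option τ)) :
    Prog (Sum.elim Γ₁ Γ₂) (σ × Option τ) :=
  drain (.inr k) f p

theorem exec_drainLeft {k : K₁} {f : Γ₁ k → τ} {p : Prog (Sum.elim Γ₁ Γ₂) (σ × Option τ)} {T : ℕ}
    {β : Type} {v : σ} (F₁ : β → List (Γ₁ k) → ∀ k, List (Γ₁ k)) (F₂ : β → ∀ k, List (Γ₂ k))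
    (next : β → Γ₁ k → β) (hF : ∀ b l, F₁ b l k = l)
    (hp : ∀ b x l, p.Exec T (v, some (f x))
      (sumStacks (Function.update (F₁ b (x :: l)) k l) (F₂ b)) (v, some (f x))
      (sumStacks (F₁ (next b x) l) (F₂ (next b x)))) (l : List (Γ₁ k)) (b : β) (o : Option τ) :
    (drainLeft k f p).Exec (l.length * (T + 1) + 1) (v, o) (sumStacks (F₁ b l) (F₂ b)) (v, none)
      (sumStacks (F₁ (l.foldl next b) []) (F₂ (l.foldl next b))) :=
  exec_drain (k := Sum.inl k) (Γ := Sum.elim Γ₁ Γ₂) (fun b l => sumStacks (F₁ b l) (F₂ b)) next hF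
    (fun b x l => (update_sumStacks_inl (F₁ b (x :: l)) (F₂ b) k l).symm ▸ hp b x l) l b o

theorem exec_drainRight {k : K₂} {f : Γ₂ k → τ} {p : Prog (Sum.elim Γ₁ Γ₂) (σ × Option τ)} {T : ℕ}
    {β : Type} {v : σ} (F₁ : β → ∀ k, List (Γ₁ k)) (F₂ : β → List (Γ₂ k) → ∀ k, List (Γ₂ k))
    (next : β → Γ₂ k → β) (hF : ∀ b l, F₂ b l k = l)
    (hp : ∀ b x l, p.Exec T (v, some (f x))
      (sumStacks (F₁ b) (Function.update (F₂ b (x :: l)) k l)) (v, some (f x))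
      (sumStacks (F₁ (next b x)) (F₂ (next b x) l))) (l : List (Γ₂ k)) (b : β) (o : Option τ) :
    (drainRight k f p).Exec (l.length * (T + 1) + 1) (v, o) (sumStacks (F₁ b) (F₂ b l)) (v, none)
      (sumStacks (F₁ (l.foldl next b)) (F₂ (l.foldl next b) [])) :=
  exec_drain (k := Sum.inr k) (Γ := Sum.elim Γ₁ Γ₂) (fun b l => sumStacks (F₁ b) (F₂ b l)) next hF
    (fun b x l => (update_sumStacks_inr (F₁ b) (F₂ b (x :: l)) k l).symm ▸ hp b x l) l b o

end Drain

end StackProgram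

/-! ### Running the generator's machine as a subroutine -/

namespace StackProgram

open Turing Turing.TM2 Turing.TM2.Stmt

section Machine

variable (M : FinTM2)

instance : Fintype M.Λ := M.ΛFin

/-- The program of a machine. -/
def ofMachine : Prog M.Γ M.σ where
  Λ := M.Λ
  entry := M.main
  code := M.m

/-- The stacks of `M` that are empty except for `k`. -/
def onlyStack (k : M.K) (l : List (M.Γ k)) : ∀ k, List (M.Γ k) :=
  Function.update (fun _ => []) k l

theorem update_onlyStack (k : M.K) (l l' : List (M.Γ k)) :
    Function.update (onlyStack M k l) k l' = onlyStack M k l' := by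
  simp [onlyStack]

theorem onlyStack_nil (k : M.K) : onlyStack M k [] = fun _ => [] := by
  simp [onlyStack]

theorem initList_eq (l : List (M.Γ M.k₀)) :
    initList M l = ⟨some M.main, M.initialState, onlyStack M M.k₀ l⟩ := by
  unfold initList onlyStack
  congr 1
  funext k
  by_cases h : k = M.k₀
  · subst h; simp
  · simp [h]

theorem haltList_eq (l : List (M.Γ M.k₁)) :
    haltList M l = ⟨none, M.initialState, onlyStack M M.k₁ l⟩ := by
  unfold haltList onlyStack
  congr 1
  funext k
  by_cases h : k = M.k₁
  · subst h; simp
  · simp [h]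

variable {M}

theorem runsIn_of_outputs {l : List (M.Γ M.k₀)} {l' : List (M.Γ M.k₁)} {t : ℕ}
    (h : TM2OutputsInTime M l (some l') t) :
    ∃ t' ≤ t, RunsIn M.m t' ⟨some M.main, M.initialState, onlyStack M M.k₀ l⟩
      ⟨none, M.initialState, onlyStack M M.k₁ l'⟩ := by
  refine ⟨h.steps, h.steps_le_m, runsIn_iff.2 ?_⟩
  rw [← haltList_eq, ← initList_eq]
  exact h.evals_in_steps

/-- The output sits on a stack that has grown by a bounded amount in each step. -/
theorem length_output_le {l : List (M.Γ M.k₀)} {l' : List (M.Γ M.k₁)} {t : ℕ}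
    (h : TM2OutputsInTime M l (some l') t) :
    l'.length ≤ l.length + t * ∑ i, pushes (M.m i) := by
  obtain ⟨t', ht', hr⟩ := runsIn_of_outputs h
  have h₁ := hr.length_le M.k₁
  have h₂ : (onlyStack M M.k₁ l' M.k₁).length = l'.length := by simp [onlyStack]
  have h₃ : (onlyStack M M.k₀ l M.k₁).length ≤ l.length := by
    -- Input and output may share a stack, which then starts with the input; otherwise it starts
    -- empty.
    by_cases h : M.k₁ = M.k₀
    · have : ∀ k, k = M.k₀ → (onlyStack M M.k₀ l k).length ≤ l.length := by
        rintro k rfl; simp [onlyStack]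
      exact this _ h
    · simp [onlyStack, h]
  have h₄ := Nat.mul_le_mul_right (∑ i, pushes (M.m i)) ht'
  simp only [h₂] at h₁
  omega

variable (M) (inA : M.Γ M.k₀ ≃ Bool) (outA : M.Γ M.k₁ ≃ CircuitSymbol) (b : Bool)

/-- The alphabets of the stacks of `M` together with the registers. -/
abbrev commitAlphabet : M.K ⊕ Reg → Type := Sum.elim M.Γ (fun _ => CircuitSymbol)

/-- The internal states of the machine that writes down the commitment circuit. -/
abbrev CommitState : Type := M.σ × Option CircuitSymbol

/-- Move the input to the registers `nn` and `buf`. -/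
def readInput : Prog (commitAlphabet M) (CommitState M) :=
  drainLeft M.k₀ (fun _ => CircuitSymbol.tick)
    (.single (pushRight Reg.nn (fun _ => CircuitSymbol.tick)
      (pushRight Reg.buf (fun _ => CircuitSymbol.tick) halt)))

/-- Move the register `buf` to the input stack. -/
def restoreInput : Prog (commitAlphabet M) (CommitState M) :=
  drainRight Reg.buf id (.single (pushLeft M.k₀ (fun _ => inA.symm true) halt))

/-- Move the output of `M` to the register `buf`. -/
def readOutput : Prog (commitAlphabet M) (CommitState M) :=
  drainLeft M.k₁ outA
    (.single (pushRight Reg.buf (fun v => v.2.getD CircuitSymbol.tick) halt))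

/-- Run `M` on a copy of the input, then write down the commitment circuit. -/
def commitProg : Prog (commitAlphabet M) (CommitState M) :=
  (readInput M).seq ((restoreInput M inA).seq ((ofMachine M).left.seq
    ((readOutput M outA).seq ((writer b).right.seq (.single (load (fun v => (v.1, none)) halt))))))

variable {M}

/-- The input is consumed when read, so its length is recorded twice: in `nn` for the writer and in
`buf` to rebuild the input of `M`. -/
theorem exec_readInput (l : List (M.Γ M.k₀)) (v : M.σ) (o : Option CircuitSymbol) :
    (readInput M).Exec (l.length * 2 + 1) (v, o)
      (sumStacks (onlyStack M M.k₀ l) (regs [] [] 0 0 0 0 0 0 [])) (v, none)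
      (sumStacks (onlyStack M M.k₀ []) (regs [] (ticks l.length) l.length 0 0 0 0 0 [])) := by
  have h := exec_drainLeft (k := M.k₀) (Γ₁ := M.Γ) (Γ₂ := fun _ : Reg => CircuitSymbol) (T := 1)
    (v := v) (f := fun _ => CircuitSymbol.tick)
    (p := .single (pushRight Reg.nn (fun _ => CircuitSymbol.tick)
      (pushRight Reg.buf (fun _ => CircuitSymbol.tick) halt)))
    (fun _ l => onlyStack M M.k₀ l) (fun i => regs [] (ticks i) i 0 0 0 0 0 [])
    (fun i _ => i + 1) (fun i l => by simp [onlyStack]) (fun i x l => ?_) l 0 o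
  · have hl : l.foldl (fun i _ => i + 1) 0 = l.length := by simp
    rw [hl] at h
    exact h
  · refine Prog.exec_single ?_
    rw [update_onlyStack, stepAux_pushRight, stepAux_pushRight]
    simp only [stepAux]
    congr 2
    funext r
    cases r <;> simp [regs, ticks_succ]

theorem exec_restoreInput (n : ℕ) (v : M.σ) (o : Option CircuitSymbol) :
    (restoreInput M inA).Exec (n * 2 + 1) (v, o)
      (sumStacks (onlyStack M M.k₀ []) (regs [] (ticks n) n 0 0 0 0 0 [])) (v, none)
      (sumStacks (onlyStack M M.k₀ (List.replicate n (inA.symm true)))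
        (regs [] [] n 0 0 0 0 0 [])) := by
  have h := exec_drainRight (k := Reg.buf) (Γ₁ := M.Γ) (Γ₂ := fun _ : Reg => CircuitSymbol)
    (T := 1) (v := v) (f := id) (p := .single (pushLeft M.k₀ (fun _ => inA.symm true) halt))
    (fun i => onlyStack M M.k₀ (List.replicate i (inA.symm true)))
    (fun _ l => regs [] l n 0 0 0 0 0 [])
    (fun i _ => i + 1) (fun i l => by simp [regs]) (fun i x l => ?_) (ticks n) 0 o
  · have hl : (ticks n).foldl (fun i _ => i + 1) 0 = n := by simp [ticks]
    rw [hl, show (ticks n).length = n from List.length_replicate] at h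
    exact h
  · refine Prog.exec_single ?_
    rw [stepAux_pushLeft]
    simp only [stepAux]
    congr 2
    · simp [onlyStack, List.replicate_succ]
    · funext r
      cases r <;> simp [regs]

/-- Popping one stack onto another reverses the word, which is why `parse` expects a reversed
description. -/
theorem exec_readOutput (n : ℕ) (l : List (M.Γ M.k₁)) (v : M.σ) (o : Option CircuitSymbol) :
    (readOutput M outA).Exec (l.length * 2 + 1) (v, o)
      (sumStacks (onlyStack M M.k₁ l) (regs [] [] n 0 0 0 0 0 [])) (v, none)
      (sumStacks (onlyStack M M.k₁ []) (regs [] (l.map outA).reverse n 0 0 0 0 0 [])) := by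
  have h := exec_drainLeft (k := M.k₁) (Γ₁ := M.Γ) (Γ₂ := fun _ : Reg => CircuitSymbol) (T := 1)
    (v := v) (f := outA)
    (p := .single (pushRight Reg.buf (fun v => v.2.getD CircuitSymbol.tick) halt))
    (fun _ l => onlyStack M M.k₁ l) (fun acc => regs [] acc n 0 0 0 0 0 [])
    (fun acc x => outA x :: acc) (fun i l => by simp [onlyStack]) (fun acc x l => ?_) l [] o
  · have hl : l.foldl (fun acc x => outA x :: acc) [] = (l.map outA).reverse := by
      rw [← List.foldl_map (g := fun acc x => x :: acc)]
      simp
    rw [hl] at h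
    exact h
  · refine Prog.exec_single ?_
    rw [update_onlyStack, stepAux_pushRight]
    simp only [stepAux]
    congr 2
    funext r
    cases r <;> simp [regs]

theorem exec_commitProg {n m a t B : ℕ} {gates : List CircuitSymbol}
    (h : TM2OutputsInTime M (List.replicate n (inA.symm true))
      (some ((encodeIndex m ++ (encodeIndex a ++ gates)).map outA.symm)) t)
    (hB : n + (encodeIndex m ++ (encodeIndex a ++ gates)).length ≤ B) :
    (commitProg M inA outA b).Exec (t + 2 * (B * (120 * B + 33)) + 106 * B + 110)
      (M.initialState, none)
      (sumStacks (onlyStack M M.k₀ (List.replicate n (inA.symm true))) (regs [] [] 0 0 0 0 0 0 []))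
      (M.initialState, none)
      (sumStacks (fun _ => []) (regs [] [] 0 0 0 0 0 0 (descCommit b n m a gates))) := by
  have h₁ := exec_readInput (List.replicate n (inA.symm true)) M.initialState none
  have h₂ := exec_restoreInput inA n M.initialState none
  have h₃ : (ofMachine M).Exec t M.initialState
    (onlyStack M M.k₀ (List.replicate n (inA.symm true))) M.initialState
    (onlyStack M M.k₁ ((encodeIndex m ++ (encodeIndex a ++ gates)).map outA.symm)) :=
    runsIn_of_outputs h
  have h₄ := exec_readOutput outA n ((encodeIndex m ++ (encodeIndex a ++ gates)).map outA.symm)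
    M.initialState none
  obtain ⟨v, h₅⟩ := (maps_writer b n m a B gates (by
    simp [encodeIndex] at hB; omega)).exec none
  rw [List.length_replicate] at h₁
  have hid : (((encodeIndex m ++ (encodeIndex a ++ gates)).map outA.symm).map outA) =
      encodeIndex m ++ (encodeIndex a ++ gates) := by
    simp
  rw [hid, List.length_map] at h₄
  -- The writer leaves an unknown symbol in the internal state, whereas a halting configuration
  -- requires the initial state.
  have h₆ : (Prog.single (Γ := commitAlphabet M) (load (fun v : CommitState M => (v.1, none))
      halt)).Exec 1 (M.initialState, v)
      (sumStacks (onlyStack M M.k₁ []) (regs [] [] 0 0 0 0 0 0 (descCommit b n m a gates)))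
      (M.initialState, none)
      (sumStacks (onlyStack M M.k₁ []) (regs [] [] 0 0 0 0 0 0 (descCommit b n m a gates))) :=
    Prog.exec_single rfl
  have := h₁.seq (h₂.seq ((h₃.left _ _).seq (h₄.seq ((h₅.right _ _).seq h₆))))
  rw [onlyStack_nil] at this
  exact this.mono (by omega)

/-- The machine that writes down the commitment circuit. -/
def commitMachine : FinTM2 where
  K := M.K ⊕ Reg
  kFin := @instFintypeSum _ _ M.kFin _
  k₀ := .inl M.k₀
  k₁ := .inr .out
  Γ := commitAlphabet M
  Λ := (commitProg M inA outA b).Λ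
  main := (commitProg M inA outA b).entry
  ΛFin := (commitProg M inA outA b).fin
  σ := CommitState M
  initialState := (M.initialState, none)
  σFin := @instFintypeProd _ _ M.σFin _
  Γk₀Fin := M.Γk₀Fin
  m := (commitProg M inA outA b).code

end Machine

theorem unaryEncodeNat_eq (n : ℕ) : Computability.unaryEncodeNat n = List.replicate n true := by
  induction n with
  | zero => rfl
  | succ n ih => rw [Computability.unaryEncodeNat, ih, List.replicate_succ]

theorem initList_commitMachine {M : FinTM2} (inA : M.Γ M.k₀ ≃ Bool)
    (outA : M.Γ M.k₁ ≃ CircuitSymbol) (b : Bool) (l : List (M.Γ M.k₀)) :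
    initList (commitMachine inA outA b) l = ⟨some (commitProg M inA outA b).entry,
      (M.initialState, none), sumStacks (onlyStack M M.k₀ l) (regs [] [] 0 0 0 0 0 0 [])⟩ := by
  have h : onlyStack (commitMachine inA outA b) (Sum.inl M.k₀) l =
      sumStacks (onlyStack M M.k₀ l) (regs [] [] 0 0 0 0 0 0 []) := by
    refine Eq.trans ?_ (update_sumStacks_inl (fun _ => []) (regs [] [] 0 0 0 0 0 0 []) M.k₀ l)
    refine congrArg (fun S : ∀ k, List (commitAlphabet M k) =>
      Function.update S (Sum.inl M.k₀) l) ?_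
    funext k
    rcases k with k | r
    · rfl
    · cases r <;> rfl
  exact (initList_eq (commitMachine inA outA b) l).trans
    (congrArg (fun S => (⟨some (commitProg M inA outA b).entry, (M.initialState, none), S⟩ :
      Cfg (commitAlphabet M) _ (CommitState M))) h)

theorem haltList_commitMachine {M : FinTM2} (inA : M.Γ M.k₀ ≃ Bool)
    (outA : M.Γ M.k₁ ≃ CircuitSymbol) (b : Bool) (l : List CircuitSymbol) :
    haltList (commitMachine inA outA b) l = ⟨none, (M.initialState, none),
      sumStacks (fun _ => []) (regs [] [] 0 0 0 0 0 0 l)⟩ := by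
  have h : onlyStack (commitMachine inA outA b) (Sum.inr Reg.out) l =
      sumStacks (fun _ => []) (regs [] [] 0 0 0 0 0 0 l) := by
    rw [← update_out_regs (out := [])]
    refine Eq.trans ?_ (update_sumStacks_inr (fun _ => []) (regs [] [] 0 0 0 0 0 0 []) Reg.out l)
    refine congrArg (fun S : ∀ k, List (commitAlphabet M k) =>
      Function.update S (Sum.inr Reg.out) l) ?_
    funext k
    rcases k with k | r
    · rfl
    · cases r <;> rfl
  exact (haltList_eq (commitMachine inA outA b) l).trans
    (congrArg (fun S => (⟨none, (M.initialState, none), S⟩ :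
      Cfg (commitAlphabet M) (commitProg M inA outA b).Λ (CommitState M))) h)

/-- If a polynomial-time machine writes down the circuits of a family, then there is also one
which writes down the commitment circuits built from them. -/
theorem polyTime_descCommit (b : Bool) (m a : ℕ → ℕ) (gates : ℕ → List CircuitSymbol)
    (h : TM2ComputableInPolyTime Computability.unaryEncodeNat
      (id : List CircuitSymbol → List CircuitSymbol)
      (fun n => encodeIndex (m n) ++ (encodeIndex (a n) ++ gates n))) :
    Nonempty (TM2ComputableInPolyTime Computability.unaryEncodeNat
      (id : List CircuitSymbol → List CircuitSymbol)
      (fun n => descCommit b n (m n) (a n) (gates n))) := by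
  -- `D` bounds the symbols pushed in one step. The description has length at most n + time · D, so
  -- `Q` bounds that length plus n.
  let D := ∑ i, pushes (h.tm.m i)
  let Q : Polynomial ℕ := 2 * Polynomial.X + h.time * Polynomial.C D
  have hQ : ∀ n, Q.eval n = 2 * n + h.time.eval n * D := by intro n; simp [Q]
  refine ⟨{
    tm := commitMachine h.inputAlphabet h.outputAlphabet b
    inputAlphabet := h.inputAlphabet
    outputAlphabet := Equiv.refl _
    time := h.time + 2 * (Q * (120 * Q + 33)) + 106 * Q + 110
    outputsFun := fun n => Classical.choice ?_ }⟩
  have hn : (Computability.unaryEncodeNat n).length = n := by simp [unaryEncodeNat_eq]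
  have hin : (Computability.unaryEncodeNat n).map h.inputAlphabet.invFun =
      List.replicate n (h.inputAlphabet.symm true) := by
    rw [unaryEncodeNat_eq, List.map_replicate]; rfl
  have ho := h.outputsFun n
  rw [hin, hn] at ho
  have hlen := length_output_le ho
  simp only [List.length_replicate, List.length_map, id] at hlen
  obtain ⟨t, ht, hr⟩ := exec_commitProg (B := Q.eval n) h.inputAlphabet h.outputAlphabet b ho
    (by rw [hQ]; simp only [D]; omega)
  have hin' := initList_commitMachine h.inputAlphabet h.outputAlphabet b
    ((Computability.unaryEncodeNat n).map h.inputAlphabet.invFun)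
  have hout' := haltList_commitMachine h.inputAlphabet h.outputAlphabet b
    ((descCommit b n (m n) (a n) (gates n)).map (Equiv.refl CircuitSymbol).invFun)
  rw [← hin] at hr
  rw [← List.map_id (descCommit b n (m n) (a n) (gates n))] at hr
  refine ⟨⟨⟨t, ?_⟩, ?_⟩⟩
  · exact (congrArg (fun c => (flip bind (commitMachine h.inputAlphabet h.outputAlphabet
      b).step)^[t] (some c)) hin').trans ((runsIn_iff.1 hr).trans (congrArg some hout'.symm))
  · rw [hn]
    simpa using ht

end StackProgram

/-! ### The action of circuits on vectors -/

theorem Circuit.unitary_cons_mulVec {N : ℕ} (g : Gate N) (C : Circuit N) (v : QVec N) :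
    Circuit.unitary (g :: C) *ᵥ v = Circuit.unitary C *ᵥ (g.matrix *ᵥ v) := by
  rw [Circuit.unitary, Matrix.mulVec_mulVec]

theorem Circuit.unitary_nil_mulVec {N : ℕ} (v : QVec N) :
    Circuit.unitary ([] : Circuit N) *ᵥ v = v := by
  rw [Circuit.unitary, Matrix.one_mulVec]

theorem Circuit.unitary_append_mulVec {N : ℕ} (C D : Circuit N) (v : QVec N) :
    Circuit.unitary (C ++ D) *ᵥ v = Circuit.unitary D *ᵥ (Circuit.unitary C *ᵥ v) := by
  induction C generalizing v with
  | nil => rw [List.nil_append, Circuit.unitary_nil_mulVec]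
  | cons g C ih => rw [List.cons_append, Circuit.unitary_cons_mulVec, ih,
      Circuit.unitary_cons_mulVec]

/-- The factor `1 / √2` of the Hadamard gate. -/
noncomputable def invSqrtTwo : ℂ := 1 / ((Real.sqrt 2 : ℝ) : ℂ)

theorem invSqrtTwo_mul_self : invSqrtTwo * invSqrtTwo = 1 / 2 := by
  rw [invSqrtTwo, div_mul_div_comm, one_mul, ← Complex.ofReal_mul,
    Real.mul_self_sqrt (by norm_num)]
  norm_num

/-- The sign `(-1) ^ b`. -/
def boolSign (b : Bool) : ℂ := if b then -1 else 1

/-- Only the two basis labels that agree with `y` off the wire `i` contribute. -/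
theorem Gate.H_mulVec {N : ℕ} (i : Fin N) (v : QVec N) (y : Bits N) :
    ((Gate.H i).matrix *ᵥ v) y = invSqrtTwo * (v (Function.update y i false) +
      boolSign (y i) * v (Function.update y i true)) := by
  rw [Matrix.mulVec, dotProduct, Fintype.sum_eq_add (Function.update y i false)
    (Function.update y i true)]
  · have h (b : Bool) : ∀ j, j ≠ i → y j = Function.update y i b j := fun j hj => by simp [hj]
    simp only [Gate.matrix, Matrix.of_apply, if_pos (h _), invSqrtTwo, boolSign,
      Function.update_self]
    cases y i <;> simp <;> ring
  · intro h
    simpa using congrFun h i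
  · rintro x ⟨h₁, h₂⟩
    simp only [Gate.matrix, Matrix.of_apply]
    rw [if_neg, zero_mul]
    intro h
    cases hx : x i
    · exact h₁ (by rw [Function.eq_update_iff]; exact ⟨hx, fun j hj => (h j hj).symm⟩)
    · exact h₂ (by rw [Function.eq_update_iff]; exact ⟨hx, fun j hj => (h j hj).symm⟩)

/-- CNOT is an involution on labels, as control and target differ, so the preimage of `y` is given
by the same update. -/
theorem Gate.CNOT_mulVec {N : ℕ} (i j : Fin N) (hij : i ≠ j) (v : QVec N) (y : Bits N) :
    ((Gate.CNOT i j hij).matrix *ᵥ v) y = v (Function.update y j (xor (y j) (y i))) := by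
  rw [Matrix.mulVec, dotProduct, Fintype.sum_eq_single (Function.update y j (xor (y j) (y i)))]
  · simp [Gate.matrix, hij]
  · intro x hx
    simp only [Gate.matrix, Matrix.of_apply]
    rw [if_neg, zero_mul]
    rintro rfl
    apply hx
    simp [hij]

theorem Gate.T_mulVec {N : ℕ} (i : Fin N) (v : QVec N) (y : Bits N) :
    ((Gate.T i).matrix *ᵥ v) y =
      (if y i = true then Complex.exp (Real.pi / 4 * Complex.I) else 1) * v y := by
  simp [Gate.matrix, Matrix.mulVec_diagonal]

/-- Hadamard gates turn a CNOT gate into a controlled phase. -/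
theorem Circuit.H_CNOT_H_mulVec {N : ℕ} (i j : Fin N) (hij : i ≠ j) (v : QVec N) (y : Bits N) :
    ((Gate.H j).matrix *ᵥ ((Gate.CNOT i j hij).matrix *ᵥ ((Gate.H j).matrix *ᵥ v))) y =
      boolSign (y i && y j) * v y := by
  simp only [Gate.H_mulVec, Gate.CNOT_mulVec, Function.update_self, Function.update_idem,
    Function.update_of_ne hij]
  have h : y = Function.update y j (y j) := (Function.update_eq_self j y).symm
  have h2 := invSqrtTwo_mul_self
  cases hi : y i <;> cases hj : y j <;> rw [hj] at h <;>
    simp only [boolSign, Bool.xor_false, Bool.not_true, Bool.not_false, Bool.xor_true, if_true,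
      Bool.false_eq_true, if_false, Bool.and_true, Bool.and_false]
  · conv_rhs => rw [h]
    linear_combination (2 * v (Function.update y j false)) * h2
  · conv_rhs => rw [h]
    linear_combination (2 * v (Function.update y j true)) * h2
  · conv_rhs => rw [h]
    linear_combination (2 * v (Function.update y j false)) * h2
  · conv_rhs => rw [h]
    linear_combination (-2 * v (Function.update y j true)) * h2

/-! ### Circuits on a subset of the wires -/

/-- Rename the wires of a gate. -/
def Gate.mapWires {N N' : ℕ} (f : Fin N ↪ Fin N') : Gate N → Gate N'
  | .H i => .H (f i)
  | .T i => .T (f i)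
  | .CNOT i j h => .CNOT (f i) (f j) (f.injective.ne h)

/-- Replace the bits of `y` on the wires in the range of `f` by `s`. -/
noncomputable def splice {N N' : ℕ} (f : Fin N ↪ Fin N') (y : Bits N') (s : Bits N) : Bits N' :=
  Function.extend f s y

theorem splice_apply {N N' : ℕ} (f : Fin N ↪ Fin N') (y : Bits N') (s : Bits N) (i : Fin N) :
    splice f y s (f i) = s i :=
  f.injective.extend_apply s y i

theorem splice_of_notMem {N N' : ℕ} (f : Fin N ↪ Fin N') (y : Bits N') (s : Bits N) (i : Fin N')
    (h : ∀ j, f j ≠ i) : splice f y s i = y i :=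
  Function.extend_apply' _ _ _ fun ⟨j, hj⟩ => h j hj

theorem update_splice {N N' : ℕ} (f : Fin N ↪ Fin N') (y : Bits N') (s : Bits N) (i : Fin N)
    (b : Bool) :
    Function.update (splice f y s) (f i) b = splice f y (Function.update s i b) := by
  funext w
  by_cases hw : ∃ j, f j = w
  · obtain ⟨j, rfl⟩ := hw
    rw [splice_apply]
    by_cases hj : j = i
    · subst hj; simp
    · rw [Function.update_of_ne (f.injective.ne hj), Function.update_of_ne hj, splice_apply]
  · push Not at hw
    rw [splice_of_notMem _ _ _ _ hw, Function.update_of_ne (hw i).symm, splice_of_notMem _ _ _ _ hw]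

theorem splice_self {N N' : ℕ} (f : Fin N ↪ Fin N') (y : Bits N') : splice f y (y ∘ f) = y := by
  funext w
  by_cases hw : ∃ j, f j = w
  · obtain ⟨j, rfl⟩ := hw
    rw [splice_apply]; rfl
  · push Not at hw
    rw [splice_of_notMem _ _ _ _ hw]

/-- A gate on the wires in the range of `f` treats the remaining bits as parameters: it acts
separately on each slice of the vector. -/
theorem Gate.mapWires_mulVec_splice {N N' : ℕ} (f : Fin N ↪ Fin N') (g : Gate N) (v : QVec N')
    (y : Bits N') (s : Bits N) :
    ((g.mapWires f).matrix *ᵥ v) (splice f y s) =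
      (g.matrix *ᵥ fun s => v (splice f y s)) s := by
  cases g with
  | H i => simp only [mapWires, H_mulVec, update_splice, splice_apply]
  | T i => simp only [mapWires, T_mulVec, splice_apply]
  | CNOT i j h => simp only [mapWires, CNOT_mulVec, update_splice, splice_apply]

theorem Circuit.map_mulVec_splice {N N' : ℕ} (f : Fin N ↪ Fin N') (C : Circuit N) (v : QVec N')
    (y : Bits N') (s : Bits N) :
    (Circuit.unitary (C.map (Gate.mapWires f)) *ᵥ v) (splice f y s) =
      (Circuit.unitary C *ᵥ fun s => v (splice f y s)) s := by
  induction C generalizing v with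
  | nil => simp only [List.map_nil, Circuit.unitary_nil_mulVec]
  | cons g C ih =>
    rw [List.map_cons, Circuit.unitary_cons_mulVec, Circuit.unitary_cons_mulVec, ih]
    congr 2
    funext s
    exact Gate.mapWires_mulVec_splice f g v y s

theorem Circuit.map_mulVec {N N' : ℕ} (f : Fin N ↪ Fin N') (C : Circuit N) (v : QVec N')
    (y : Bits N') :
    (Circuit.unitary (C.map (Gate.mapWires f)) *ᵥ v) y =
      (Circuit.unitary C *ᵥ fun s => v (splice f y s)) (y ∘ f) := by
  rw [← Circuit.map_mulVec_splice, splice_self]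

/-! ### Loading a uniformly random key -/

section LoadKey

variable {N n : ℕ} (key inp : Fin n ↪ Fin N)

/-- The uniform superposition over the values of the key bits in `T`, copied to the wires `inp`. -/
noncomputable def loadState (T : Finset (Fin n)) : QVec N := fun y =>
  open scoped Classical in
  invSqrtTwo ^ T.card * if (∀ i, y (inp i) = y (key i)) ∧ (∀ i, i ∉ T → y (key i) = false) ∧
    (∀ w, (∀ i, key i ≠ w) → (∀ i, inp i ≠ w) → y w = false) then 1 else 0

theorem loadState_empty : loadState key inp ∅ = ket fun _ => false := by
  funext y
  rw [loadState, ket, Pi.single_apply, Finset.card_empty, pow_zero, one_mul]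
  congr 1
  refine propext ⟨fun ⟨h₁, h₂, h₃⟩ => ?_, ?_⟩
  · funext w
    by_cases hk : ∃ i, key i = w
    · obtain ⟨i, rfl⟩ := hk
      exact h₂ i (by simp)
    · by_cases hi : ∃ i, inp i = w
      · obtain ⟨i, rfl⟩ := hi
        rw [h₁, h₂ i (by simp)]
      · push Not at hk hi
        exact h₃ w hk hi
  · rintro rfl
    simp

variable {key inp}

/-- The Hadamard gate puts key bit `i`, zero so far, into superposition; CNOT then copies it to the
input wire in the computational basis. -/
theorem loadState_step (hd : ∀ i j, key i ≠ inp j) {T : Finset (Fin n)} {i : Fin n} (hi : i ∉ T) :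
    (Gate.CNOT (key i) (inp i) (hd i i)).matrix *ᵥ ((Gate.H (key i)).matrix *ᵥ
      loadState key inp T) = loadState key inp (insert i T) := by
  funext y
  rw [Gate.CNOT_mulVec, Gate.H_mulVec]
  -- As key bit `i` is still zero, only one of the two Hadamard terms survives.
  have h0 (z : Bits N) : loadState key inp T (Function.update z (key i) true) = 0 := by
    rw [loadState, if_neg, mul_zero]
    rintro ⟨-, h, -⟩
    simpa using h i hi
  rw [h0, mul_zero, add_zero, loadState, loadState, Finset.card_insert_of_notMem hi, pow_succ']
  rw [← mul_assoc]
  congr 2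
  have hk (j : Fin n) (b c : Bool) :
      Function.update (Function.update y (inp i) b) (key i) c (key j) =
        if j = i then c else y (key j) := by
    by_cases hj : j = i
    · subst hj; simp
    · rw [Function.update_of_ne (key.injective.ne hj), Function.update_of_ne (hd j i), if_neg hj]
  have hp (j : Fin n) (b c : Bool) :
      Function.update (Function.update y (inp i) b) (key i) c (inp j) =
        if j = i then b else y (inp j) := by
    rw [Function.update_of_ne (hd i j).symm]
    by_cases hj : j = i
    · subst hj; simp
    · rw [Function.update_of_ne (inp.injective.ne hj), if_neg hj]
  simp only [hk, hp]
  refine propext ⟨fun ⟨h₁, h₂, h₃⟩ => ⟨fun j => ?_, fun j hj => ?_, fun w hw hw' => ?_⟩,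
    fun ⟨h₁, h₂, h₃⟩ => ⟨fun j => ?_, fun j hj => ?_, fun w hw hw' => ?_⟩⟩
  · have := h₁ j
    by_cases hj : j = i
    · subst hj
      simpa using this
    · simpa [hj] using this
  · rw [Finset.mem_insert, not_or] at hj
    simpa [hj.1] using h₂ j hj.2
  · have := h₃ w hw hw'
    rwa [Function.update_of_ne (hw i).symm, Function.update_of_ne (hw' i).symm] at this
  · by_cases hj : j = i
    · subst hj
      simp [h₁]
    · simp [hj, h₁]
  · by_cases hj' : j = i
    · simp [hj']
    · simpa [hj'] using h₂ j (by simp [hj', hj])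
  · rw [Function.update_of_ne (hw i).symm, Function.update_of_ne (hw' i).symm]
    exact h₃ w hw hw'

/-- Put the key wires into uniform superposition and copy them. -/
def loadCircuit (hd : ∀ i j, key i ≠ inp j) (L : List (Fin n)) : Circuit N :=
  L.flatMap fun i => [.H (key i), .CNOT (key i) (inp i) (hd i i)]

/-- Here `T` collects the key bits loaded so far; the induction adds one bit at a time. -/
theorem loadCircuit_mulVec (hd : ∀ i j, key i ≠ inp j) (L : List (Fin n)) (hL : L.Nodup)
    (T : Finset (Fin n)) (hT : ∀ i ∈ L, i ∉ T) :
    (loadCircuit hd L).unitary *ᵥ loadState key inp T = loadState key inp (L.toFinset ∪ T) := by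
  induction L generalizing T with
  | nil => simp [loadCircuit, Circuit.unitary_nil_mulVec]
  | cons i L ih =>
    have h := ih hL.of_cons (insert i T) (fun j hj => by
      rw [Finset.mem_insert, not_or]
      exact ⟨fun h => (List.nodup_cons.1 hL).1 (h ▸ hj), hT j (List.mem_cons_of_mem _ hj)⟩)
    rw [loadCircuit, List.flatMap_cons, Circuit.unitary_append_mulVec,
      Circuit.unitary_cons_mulVec, Circuit.unitary_cons_mulVec, Circuit.unitary_nil_mulVec,
      loadState_step hd (hT i List.mem_cons_self)]
    rw [loadCircuit] at h
    rw [h]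
    congr 1
    ext j
    simp only [List.toFinset_cons, Finset.mem_union, Finset.mem_insert, List.mem_toFinset]
    tauto

end LoadKey

/-! ### The coherent quantum one-time pad -/

section Pad

variable {N m : ℕ} (xw zw : Fin m ↪ Fin N)

/-- The vector `F`, up to normalization restricted to the keys that vanish outside of `T`. -/
noncomputable def padState (F : QVec N) (T : Finset (Fin m)) : QVec N := fun y =>
  open scoped Classical in
  (1 / 2) ^ T.card * if ∀ i, i ∉ T → y (xw i) = false ∧ y (zw i) = false then F y else 0

variable {xw zw}

/-- Both pad keys of wire `i` are still zero, so one of four terms survives, with weight (1/√2)² =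
1/2. -/
theorem padState_H_H (hd : ∀ i j, xw i ≠ zw j) (F : QVec N) {T : Finset (Fin m)} {i : Fin m}
    (hi : i ∉ T) (y : Bits N) :
    ((Gate.H (zw i)).matrix *ᵥ ((Gate.H (xw i)).matrix *ᵥ padState xw zw F T)) y =
      1 / 2 * padState xw zw F T
        (Function.update (Function.update y (zw i) false) (xw i) false) := by
  have h₁ (w : Bits N) : padState xw zw F T (Function.update w (xw i) true) = 0 := by
    rw [padState, if_neg, mul_zero]
    intro h
    simpa using (h i hi).1
  have h₂ (w : Bits N) (b : Bool) : padState xw zw F T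
      (Function.update (Function.update w (zw i) true) (xw i) b) = 0 := by
    rw [padState, if_neg, mul_zero]
    intro h
    simpa [(hd i i).symm] using (h i hi).2
  rw [Gate.H_mulVec, Gate.H_mulVec, Gate.H_mulVec, h₁, h₂, h₂, ← invSqrtTwo_mul_self]
  ring

/-- Handles both values of the committed bit: `y'` is the label to which the controlled Pauli pulls
`y` back and `s` the sign it produces. It is trivial for bit 0. -/
theorem padState_insert (hd : ∀ i j, xw i ≠ zw j) (F : QVec N) {T : Finset (Fin m)} {i : Fin m}
    (hi : i ∉ T) (y y' : Bits N) (s : ℂ)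
    (hy : ∀ j, y' (xw j) = y (xw j)) (hy' : ∀ j, y' (zw j) = y (zw j))
    (hF : s * F (Function.update (Function.update y' (zw i) false) (xw i) false) = F y) :
    s * (1 / 2 * padState xw zw F T
      (Function.update (Function.update y' (zw i) false) (xw i) false)) =
      padState xw zw F (insert i T) y := by
  rw [padState, padState, Finset.card_insert_of_notMem hi, pow_succ']
  have hx (j : Fin m) : Function.update (Function.update y' (zw i) false) (xw i) false (xw j) =
      if j = i then false else y (xw j) := by
    by_cases hj : j = i
    · subst hj; simp
    · rw [Function.update_of_ne (xw.injective.ne hj), Function.update_of_ne (hd j i), if_neg hj, hy]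
  have hz (j : Fin m) : Function.update (Function.update y' (zw i) false) (xw i) false (zw j) =
      if j = i then false else y (zw j) := by
    rw [Function.update_of_ne (hd i j).symm]
    by_cases hj : j = i
    · subst hj; simp
    · rw [Function.update_of_ne (zw.injective.ne hj), if_neg hj, hy']
  simp only [hx, hz]
  have hiff : (∀ j, j ∉ T → (if j = i then false else y (xw j)) = false ∧
      (if j = i then false else y (zw j)) = false) ↔
      ∀ j, j ∉ insert i T → y (xw j) = false ∧ y (zw j) = false := by
    refine forall_congr' fun j => ?_
    by_cases hj : j = i
    · simp [hj]
    · simp [hj]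
  by_cases h : ∀ j, j ∉ insert i T → y (xw j) = false ∧ y (zw j) = false
  · rw [if_pos h, if_pos (hiff.2 h), ← hF]
    ring
  · rw [if_neg h, if_neg (fun h' => h (hiff.1 h'))]
    ring

variable {uw : Fin m ↪ Fin N}

/-- Put the keys `x` and `z` into uniform superposition and, if `b` holds, apply the controlled
Pauli operators to the wires `uw`. -/
def padCircuit (hxu : ∀ i j, xw i ≠ uw j) (hzu : ∀ i j, zw i ≠ uw j) (b : Bool)
    (L : List (Fin m)) : Circuit N :=
  L.flatMap fun i => .H (xw i) :: .H (zw i) :: bif b then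
    [.H (uw i), .CNOT (zw i) (uw i) (hzu i i), .H (uw i), .CNOT (xw i) (uw i) (hxu i i)] else []

/-- The hypotheses say that `F` is determined by its values at vanishing pad keys of wire `i`: it
ignores those keys if `b` is false and follows the controlled Pauli operator if `b` is true. Each
round thus removes one restriction from `padState`. -/
theorem padCircuit_mulVec (hxz : ∀ i j, xw i ≠ zw j) (hxu : ∀ i j, xw i ≠ uw j)
    (hzu : ∀ i j, zw i ≠ uw j) (b : Bool) (F : QVec N)
    (hF : b = false → ∀ i y,
      F (Function.update (Function.update y (zw i) false) (xw i) false) = F y)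
    (hF' : b = true → ∀ i y, boolSign (y (zw i) && xor (y (uw i)) (y (xw i))) *
      F (Function.update (Function.update (Function.update y (uw i) (xor (y (uw i)) (y (xw i))))
        (zw i) false) (xw i) false) = F y)
    (L : List (Fin m)) (hL : L.Nodup) (T : Finset (Fin m)) (hT : ∀ i ∈ L, i ∉ T) :
    (padCircuit hxu hzu b L).unitary *ᵥ padState xw zw F T =
      padState xw zw F (L.toFinset ∪ T) := by
  induction L generalizing T with
  | nil => simp [padCircuit, Circuit.unitary_nil_mulVec]
  | cons i L ih =>
    have h := ih hL.of_cons (insert i T) (fun j hj => by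
      rw [Finset.mem_insert, not_or]
      exact ⟨fun h => (List.nodup_cons.1 hL).1 (h ▸ hj), hT j (List.mem_cons_of_mem _ hj)⟩)
    have hi := hT i List.mem_cons_self
    rw [padCircuit, List.flatMap_cons, Circuit.unitary_append_mulVec,
      Circuit.unitary_cons_mulVec, Circuit.unitary_cons_mulVec]
    have hstep : Circuit.unitary (bif b then [.H (uw i), .CNOT (zw i) (uw i) (hzu i i), .H (uw i),
        .CNOT (xw i) (uw i) (hxu i i)] else []) *ᵥ ((Gate.H (zw i)).matrix *ᵥ
          ((Gate.H (xw i)).matrix *ᵥ padState xw zw F T)) = padState xw zw F (insert i T) := by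
      funext y
      cases b
      · rw [cond_false, Circuit.unitary_nil_mulVec, padState_H_H hxz F hi, ← one_mul (1 / 2 * _)]
        exact padState_insert hxz F hi y y 1 (fun _ => rfl) (fun _ => rfl)
          (by rw [one_mul, hF rfl])
      · simp only [cond_true, Circuit.unitary_cons_mulVec, Circuit.unitary_nil_mulVec]
        -- Amplitudes are traced back from the last gate. The controlled X has already replaced u_i
        -- by u_i ⊕ x_i when the sign of the controlled Z is read off.
        rw [Gate.CNOT_mulVec, Circuit.H_CNOT_H_mulVec, padState_H_H hxz F hi]
        refine padState_insert hxz F hi y _ _ (fun j => ?_) (fun j => ?_) ?_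
        · rw [Function.update_of_ne (hxu j i)]
        · rw [Function.update_of_ne (hzu j i)]
        · rw [Function.update_self, Function.update_of_ne (hzu i i), hF' rfl]
    rw [hstep]
    rw [padCircuit] at h
    rw [h]
    congr 1
    ext j
    simp only [List.toFinset_cons, Finset.mem_union, Finset.mem_insert, List.mem_toFinset]
    tauto

end Pad

/-! ### The commitment circuit -/

/-- On one qubit X^a Z^c |q⟩ = (-1)^{cq} |q ⊕ a⟩, which is checked on all sixteen cases; the tensor
product multiplies the entries. -/
theorem pauli_apply {m : ℕ} (x z u v : Bits m) :
    pauli x z u v = if v = (fun j => xor (u j) (x j)) then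
      ∏ j, boolSign (z j && v j) else 0 := by
  have h (a c p q : Bool) : (pauliX ^ a.toNat * pauliZ ^ c.toNat) p q =
      if q = xor p a then boolSign (c && q) else 0 := by
    cases a <;> cases c <;> cases p <;> cases q <;>
      simp [pauliX, pauliZ, boolSign, Matrix.mul_diagonal]
  simp only [pauli, Matrix.of_apply, h]
  by_cases hv : v = fun j => xor (u j) (x j)
  · rw [if_pos hv]
    exact Finset.prod_congr rfl fun j _ => if_pos (congrFun hv j)
  · rw [if_neg hv]
    obtain ⟨j, hj⟩ := Function.ne_iff.1 hv
    exact Finset.prod_eq_zero (Finset.mem_univ j) (if_neg hj)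

theorem pauli_mulVec {m : ℕ} (x z u : Bits m) (ψ : QVec m) :
    (pauli x z *ᵥ ψ) u = (∏ j, boolSign (z j && xor (u j) (x j))) *
      ψ fun j => xor (u j) (x j) := by
  rw [Matrix.mulVec, dotProduct, Fintype.sum_eq_single fun j => xor (u j) (x j)]
  · rw [pauli_apply, if_pos rfl]
  · intro v hv
    rw [pauli_apply, if_neg hv, zero_mul]

namespace CommitCircuit

variable (n m a : ℕ)

/-- The wires of the commitment register. -/
def outW : Fin m ↪ Fin (m + (a + (n + (m + m)))) := Fin.castAddEmb _

/-- The wires that hold the final ancilla state of the generator. -/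
def ancW : Fin a ↪ Fin (m + (a + (n + (m + m)))) := (Fin.castAddEmb _).trans (Fin.natAddEmb _)

/-- The wires that hold the key of the generator. -/
def keyW : Fin n ↪ Fin (m + (a + (n + (m + m)))) :=
  ((Fin.castAddEmb _).trans (Fin.natAddEmb _)).trans (Fin.natAddEmb _)

/-- The wires that hold the exponents of `X`. -/
def xW : Fin m ↪ Fin (m + (a + (n + (m + m)))) :=
  (((Fin.castAddEmb _).trans (Fin.natAddEmb _)).trans (Fin.natAddEmb _)).trans (Fin.natAddEmb _)

/-- The wires that hold the exponents of `Z`. -/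
def zW : Fin m ↪ Fin (m + (a + (n + (m + m)))) :=
  (((Fin.natAddEmb _).trans (Fin.natAddEmb _)).trans (Fin.natAddEmb _)).trans (Fin.natAddEmb _)

/-- The wires on which the generator acts. -/
def genW : Fin (m + a) ↪ Fin (m + (a + (n + (m + m)))) := Fin.castLEEmb (by omega)

variable {n m a}

@[simp] theorem val_outW (j : Fin m) : (outW n m a j : ℕ) = j := rfl

@[simp] theorem val_ancW (j : Fin a) : (ancW n m a j : ℕ) = m + j := rfl

@[simp] theorem val_keyW (j : Fin n) : (keyW n m a j : ℕ) = m + (a + j) := rfl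

@[simp] theorem val_xW (j : Fin m) : (xW n m a j : ℕ) = m + (a + (n + j)) := rfl

@[simp] theorem val_zW (j : Fin m) : (zW n m a j : ℕ) = m + (a + (n + (m + j))) := rfl

@[simp] theorem val_genW (j : Fin (m + a)) : (genW n m a j : ℕ) = j := rfl

theorem xW_ne_zW (i j : Fin m) : xW n m a i ≠ zW n m a j := by
  intro h
  have := congrArg Fin.val h
  simp at this
  omega

theorem xW_ne_outW (i j : Fin m) : xW n m a i ≠ outW n m a j := by
  intro h
  have := congrArg Fin.val h
  simp at this
  omega

theorem zW_ne_outW (i j : Fin m) : zW n m a i ≠ outW n m a j := by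
  intro h
  have := congrArg Fin.val h
  simp at this
  omega

theorem keyW_ne_genW (i : Fin n) (j : Fin (m + a)) : keyW n m a i ≠ genW n m a j := by
  intro h
  have := congrArg Fin.val h
  simp at this
  omega

theorem genW_ne_xW (i : Fin (m + a)) (j : Fin m) : genW n m a i ≠ xW n m a j := by
  intro h
  have := congrArg Fin.val h
  simp at this
  omega

theorem genW_ne_zW (i : Fin (m + a)) (j : Fin m) : genW n m a i ≠ zW n m a j := by
  intro h
  have := congrArg Fin.val h
  simp at this
  omega

theorem keyW_ne_xW (i : Fin n) (j : Fin m) : keyW n m a i ≠ xW n m a j := by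
  intro h
  have := congrArg Fin.val h
  simp at this
  omega

theorem keyW_ne_zW (i : Fin n) (j : Fin m) : keyW n m a i ≠ zW n m a j := by
  intro h
  have := congrArg Fin.val h
  simp at this
  omega

theorem keyW_ne_outW (i : Fin n) (j : Fin m) : keyW n m a i ≠ outW n m a j := by
  intro h
  have := congrArg Fin.val h
  simp at this
  omega

theorem ancW_ne_xW (i : Fin a) (j : Fin m) : ancW n m a i ≠ xW n m a j := by
  intro h
  have := congrArg Fin.val h
  simp at this
  omega

theorem ancW_ne_zW (i : Fin a) (j : Fin m) : ancW n m a i ≠ zW n m a j := by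
  intro h
  have := congrArg Fin.val h
  simp at this
  omega

theorem ancW_ne_outW (i : Fin a) (j : Fin m) : ancW n m a i ≠ outW n m a j := by
  intro h
  have := congrArg Fin.val h
  simp at this
  omega

theorem exists_wire (w : Fin (m + (a + (n + (m + m))))) :
    (∃ j, genW n m a j = w) ∨ (∃ j, keyW n m a j = w) ∨ (∃ j, xW n m a j = w) ∨
      ∃ j, zW n m a j = w := by
  obtain ⟨w, hw⟩ := w
  by_cases h₁ : w < m + a
  · exact .inl ⟨⟨w, h₁⟩, rfl⟩
  by_cases h₂ : w < m + a + n
  · exact .inr (.inl ⟨⟨w - (m + a), by omega⟩, Fin.ext (by simp; omega)⟩)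
  by_cases h₃ : w < m + a + n + m
  · exact .inr (.inr (.inl ⟨⟨w - (m + a + n), by omega⟩, Fin.ext (by simp; omega)⟩))
  · exact .inr (.inr (.inr ⟨⟨w - (m + a + n + m), by omega⟩, Fin.ext (by simp; omega)⟩))

/-- The wires of the generator on which the key is loaded. -/
def inpW (hn : n ≤ m + a) : Fin n ↪ Fin (m + (a + (n + (m + m)))) :=
  (Fin.castLEEmb hn).trans (genW n m a)

theorem keyW_ne_inpW (hn : n ≤ m + a) (i j : Fin n) : keyW n m a i ≠ inpW hn j :=
  keyW_ne_genW i _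

/-- The circuit that prepares the commitment state: load a uniformly random key, run the generator
`C`, and apply the quantum one-time pad if `b` holds. -/
def circuit (hn : n ≤ m + a) (C : Circuit (m + a)) (b : Bool) :
    Circuit (m + (a + (n + (m + m)))) :=
  loadCircuit (key := keyW n m a) (inp := inpW hn) (keyW_ne_inpW hn)
      (List.finRange n) ++
    (C.map (Gate.mapWires (genW n m a)) ++
      padCircuit (xw := xW n m a) (zw := zW n m a) (uw := outW n m a) xW_ne_outW zW_ne_outW b
        (List.finRange m))

theorem encode_mapWires (C : Circuit (m + a)) :
    (C.map (Gate.mapWires (genW n m a))).flatMap Gate.encode = C.flatMap Gate.encode := by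
  rw [List.flatMap_map]
  congr 1
  funext g
  cases g <;> rfl

theorem flatMap_finRange {α : Type} (n : ℕ) (f : ℕ → List α) :
    (List.finRange n).flatMap (fun i : Fin n => f i) = (List.range n).flatMap f := by
  have h : (List.finRange n).map Fin.val = List.range n := List.ext_getElem (by simp) (by simp)
  rw [← h, List.flatMap_map]

/-- Identifies the word written by the machine with the circuit whose action is analysed below. -/
theorem encode_circuit (hn : n ≤ m + a) (C : Circuit (m + a)) (b : Bool) :
    Circuit.encode m (a + (n + (m + m))) (circuit hn C b) =
      StackProgram.descCommit b n m a (C.flatMap Gate.encode) := by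
  rw [Circuit.encode, StackProgram.descCommit, circuit, List.flatMap_append, List.flatMap_append,
    encode_mapWires, loadCircuit, padCircuit, List.flatMap_assoc, List.flatMap_assoc,
    List.append_assoc, ← flatMap_finRange, ← flatMap_finRange]
  congr 4
  · funext i
    simp [StackProgram.descLoad, StackProgram.descH, StackProgram.descCX, Gate.encode, add_assoc,
      inpW]
  · congr 1
    funext j
    cases b <;>
      simp [StackProgram.descPad, StackProgram.descH, StackProgram.descCX, Gate.encode, add_assoc]

/-- The state after running the generator is supported on vanishing one-time pad keys. -/
theorem map_mulVec_loadState (hn : n ≤ m + a) (C : Circuit (m + a)) (φ : Bits n → QVec m)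
    (η : Bits n → QVec a)
    (hrun : ∀ (k : Bits n) (u : Bits m) (e : Bits a),
      (C.unitary *ᵥ ket (fun i => if h : (i : ℕ) < n then k ⟨i, h⟩ else false)) (Fin.append u e) =
        φ k u * η k e) (F : QVec (m + (a + (n + (m + m)))))
    (hF : ∀ y, (∀ j, y (xW n m a j) = false ∧ y (zW n m a j) = false) →
      F y = invSqrtTwo ^ n * (η (y ∘ keyW n m a) (y ∘ ancW n m a) *
        φ (y ∘ keyW n m a) (y ∘ outW n m a))) :
    Circuit.unitary (C.map (Gate.mapWires (genW n m a))) *ᵥ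
      loadState (keyW n m a) (inpW hn) Finset.univ = padState (xW n m a) (zW n m a) F ∅ := by
  funext y
  rw [Circuit.map_mulVec, padState, Finset.card_empty, pow_zero, one_mul]
  have hgen : y ∘ genW n m a = Fin.append (y ∘ outW n m a) (y ∘ ancW n m a) := by
    funext i
    refine Fin.addCases (fun j => ?_) (fun j => ?_) i
    · rw [Fin.append_left]; rfl
    · rw [Fin.append_right]; rfl
  have hk (s : Bits (m + a)) (i : Fin n) :
      splice (genW n m a) y s (keyW n m a i) = y (keyW n m a i) :=
    splice_of_notMem _ _ _ _ fun j => (keyW_ne_genW i j).symm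
  have hx (s : Bits (m + a)) (i : Fin m) :
      splice (genW n m a) y s (xW n m a i) = y (xW n m a i) :=
    splice_of_notMem _ _ _ _ fun j => genW_ne_xW j i
  have hz (s : Bits (m + a)) (i : Fin m) :
      splice (genW n m a) y s (zW n m a i) = y (zW n m a i) :=
    splice_of_notMem _ _ _ _ fun j => genW_ne_zW j i
  by_cases hxz : ∀ j, y (xW n m a j) = false ∧ y (zW n m a j) = false
  -- On a slice with vanishing pad keys, the loaded state is 2^{-n/2} times the input |k⟩|0…0⟩ of
  -- the generator, `k` being read from the key wires.
  · have hv : (fun s => loadState (keyW n m a) (inpW hn) Finset.univ (splice (genW n m a) y s)) =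
        invSqrtTwo ^ n • ket (fun i => if h : (i : ℕ) < n then (y ∘ keyW n m a) ⟨i, h⟩
          else false) := by
      funext s
      rw [loadState, Finset.card_univ, Fintype.card_fin, Pi.smul_apply, smul_eq_mul, ket,
        Pi.single_apply]
      congr 2
      refine propext ⟨fun ⟨h₁, _, h₃⟩ => ?_,
        fun h => ⟨fun i => ?_, fun i hi => ?_, fun w hw hw' => ?_⟩⟩
      · funext i
        by_cases hi : (i : ℕ) < n
        · have := h₁ ⟨i, hi⟩
          rw [hk, inpW, Function.Embedding.trans_apply, splice_apply] at this
          rw [dif_pos hi]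
          exact this
        · rw [dif_neg hi]
          have := h₃ (genW n m a i) (fun j => keyW_ne_genW j i) (fun j h => hi (by
            have h' : (j : ℕ) = i := congrArg Fin.val h
            omega))
          rwa [splice_apply] at this
      · rw [hk, inpW, Function.Embedding.trans_apply, splice_apply, h]
        exact dif_pos i.2
      · exact absurd (Finset.mem_univ i) hi
      · rcases exists_wire w with ⟨j, rfl⟩ | ⟨j, rfl⟩ | ⟨j, rfl⟩ | ⟨j, rfl⟩
        · rw [splice_apply, h]
          refine dif_neg fun hj => ?_
          exact hw' ⟨j, hj⟩ rfl
        · exact absurd rfl (hw j)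
        · rw [hx, (hxz j).1]
        · rw [hz, (hxz j).2]
    rw [if_pos fun i _ => hxz i, hF y hxz, hv, Matrix.mulVec_smul, Pi.smul_apply, smul_eq_mul, hgen,
      hrun, mul_comm (φ _ _)]
  -- If some pad key is set, the whole slice vanishes, and the generator does not touch the pad
  -- keys.
  · have hv : (fun s => loadState (keyW n m a) (inpW hn) Finset.univ (splice (genW n m a) y s)) =
        0 := by
      funext s
      rw [loadState, if_neg, mul_zero, Pi.zero_apply]
      rintro ⟨-, -, h₃⟩
      refine hxz fun j => ⟨?_, ?_⟩
      · rw [← hx s j]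
        exact h₃ _ (fun i => keyW_ne_xW i j) (fun i => genW_ne_xW _ j)
      · rw [← hz s j]
        exact h₃ _ (fun i => keyW_ne_zW i j) (fun i => genW_ne_zW _ j)
    rw [if_neg fun h => hxz fun j => h j (Finset.notMem_empty j), hv, Matrix.mulVec_zero,
      Pi.zero_apply]

/-- The amplitudes of the commitment state, before the normalization of the one-time pad keys. -/
noncomputable def amplitude (φ : Bits n → QVec m) (η : Bits n → QVec a) (b : Bool) :
    QVec (m + (a + (n + (m + m)))) := fun y =>
  invSqrtTwo ^ n * (η (y ∘ keyW n m a) (y ∘ ancW n m a) *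
    ((pauli (y ∘ xW n m a) (y ∘ zW n m a) ^ b.toNat) *ᵥ φ (y ∘ keyW n m a)) (y ∘ outW n m a))

theorem update_comp_of_ne {N N' : ℕ} {f : Fin N ↪ Fin N'} {w : Fin N'} (h : ∀ j, f j ≠ w)
    (y : Bits N') (b : Bool) : Function.update y w b ∘ f = y ∘ f :=
  Function.update_comp_eq_of_forall_ne y b h

theorem amplitude_false (φ : Bits n → QVec m) (η : Bits n → QVec a) (i : Fin m)
    (y : Bits (m + (a + (n + (m + m))))) :
    amplitude φ η false (Function.update (Function.update y (zW n m a i) false) (xW n m a i) false)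
      = amplitude φ η false y := by
  simp only [amplitude, update_comp_of_ne fun j => keyW_ne_xW j i,
    update_comp_of_ne fun j => keyW_ne_zW j i, update_comp_of_ne fun j => ancW_ne_xW j i,
    update_comp_of_ne fun j => ancW_ne_zW j i, update_comp_of_ne fun j => (xW_ne_outW i j).symm,
    update_comp_of_ne fun j => (zW_ne_outW i j).symm, Bool.toNat_false, pow_zero]

/-- Isolates qubit `i` of the Pauli operator: its X part is the shift of the output bit, its Z part
is the sign in front. -/
theorem amplitude_true (φ : Bits n → QVec m) (η : Bits n → QVec a) (i : Fin m)
    (y : Bits (m + (a + (n + (m + m))))) :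
    boolSign (y (zW n m a i) && xor (y (outW n m a i)) (y (xW n m a i))) *
      amplitude φ η true (Function.update (Function.update (Function.update y (outW n m a i)
        (xor (y (outW n m a i)) (y (xW n m a i)))) (zW n m a i) false) (xW n m a i) false)
      = amplitude φ η true y := by
  simp only [amplitude, update_comp_of_ne fun j => keyW_ne_xW j i,
    update_comp_of_ne fun j => keyW_ne_zW j i, update_comp_of_ne fun j => ancW_ne_xW j i,
    update_comp_of_ne fun j => ancW_ne_zW j i, update_comp_of_ne fun j => (xW_ne_outW i j).symm,
    update_comp_of_ne fun j => (zW_ne_outW i j).symm, update_comp_of_ne fun j => keyW_ne_outW j i,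
    update_comp_of_ne fun j => ancW_ne_outW j i, update_comp_of_ne fun j => (xW_ne_zW j i),
    update_comp_of_ne fun j => (xW_ne_zW i j).symm, update_comp_of_ne fun j => xW_ne_outW j i,
    update_comp_of_ne fun j => zW_ne_outW j i,
    Function.update_comp_eq_of_injective _ (outW n m a).injective,
    Function.update_comp_eq_of_injective _ (xW n m a).injective,
    Function.update_comp_eq_of_injective _ (zW n m a).injective, Bool.toNat_true, pow_one,
    pauli_mulVec]
  -- Adding x_i to the output bit and clearing x_i leaves u ⊕ x unchanged.
  have hφ : (fun j => xor (Function.update (y ∘ outW n m a) i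
      (xor (y (outW n m a i)) (y (xW n m a i))) j)
      (Function.update (y ∘ xW n m a) i false j)) =
      fun j => xor ((y ∘ outW n m a) j) ((y ∘ xW n m a) j) := by
    funext j
    by_cases hj : j = i
    · subst hj; simp
    · simp [hj]
  rw [hφ, ← Finset.mul_prod_erase _ _ (Finset.mem_univ i), ← Finset.mul_prod_erase _
    (fun j => boolSign ((y ∘ zW n m a) j && xor ((y ∘ outW n m a) j) ((y ∘ xW n m a) j)))
    (Finset.mem_univ i)]
  have hprod : ∏ j ∈ Finset.univ.erase i, boolSign (Function.update (y ∘ zW n m a) i false j &&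
      xor (Function.update (y ∘ outW n m a) i (xor (y (outW n m a i)) (y (xW n m a i))) j)
        (Function.update (y ∘ xW n m a) i false j)) =
      ∏ j ∈ Finset.univ.erase i,
        boolSign ((y ∘ zW n m a) j && xor ((y ∘ outW n m a) j) ((y ∘ xW n m a) j)) := by
    refine Finset.prod_congr rfl fun j hj => ?_
    simp [Finset.ne_of_mem_erase hj]
  rw [hprod]
  simp only [Function.update_self, Bool.false_and, Function.comp_apply]
  rw [show boolSign false = 1 by simp [boolSign]]
  ring

theorem pauli_zero {m : ℕ} : pauli (fun _ : Fin m => false) (fun _ => false) = 1 := by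
  ext u v
  rw [pauli_apply, Matrix.one_apply]
  simp [boolSign, eq_comm]

/-- The commitment circuit prepares the commitment state. -/
theorem circuit_mulVec (hn : n ≤ m + a) (C : Circuit (m + a)) (φ : Bits n → QVec m)
    (η : Bits n → QVec a)
    (hrun : ∀ (k : Bits n) (u : Bits m) (e : Bits a),
      (C.unitary *ᵥ ket (fun i => if h : (i : ℕ) < n then k ⟨i, h⟩ else false)) (Fin.append u e) =
        φ k u * η k e) (b : Bool) :
    (circuit hn C b).unitary *ᵥ ket (fun _ => false) = (1 / 2 : ℂ) ^ m • amplitude φ η b := by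
  rw [circuit, Circuit.unitary_append_mulVec, Circuit.unitary_append_mulVec,
    ← loadState_empty (keyW n m a) (inpW hn),
    loadCircuit_mulVec _ _ (List.nodup_finRange n) ∅ (by simp)]
  have h₁ : (List.finRange n).toFinset ∪ ∅ = Finset.univ := by ext; simp
  rw [h₁, map_mulVec_loadState hn C φ η hrun (amplitude φ η b), padCircuit_mulVec xW_ne_zW
    xW_ne_outW zW_ne_outW b _ (by rintro rfl; exact amplitude_false φ η)
    (by rintro rfl; exact amplitude_true φ η) _ (List.nodup_finRange m) ∅ (by simp)]
  · have h₂ : (List.finRange m).toFinset ∪ ∅ = Finset.univ := by ext; simp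
    funext y
    rw [h₂, padState, if_pos (by simp), Finset.card_univ, Fintype.card_fin]
    rfl
  · intro y hy
    have hx : y ∘ xW n m a = fun _ => false := funext fun j => (hy j).1
    have hz : y ∘ zW n m a = fun _ => false := funext fun j => (hy j).2
    rw [amplitude, hx, hz, pauli_zero, one_pow, Matrix.one_mulVec]

theorem normalization (n m : ℕ) :
    (1 / 2 : ℂ) ^ m * invSqrtTwo ^ n = ((1 / Real.sqrt (2 ^ (2 * m + n)) : ℝ) : ℂ) := by
  have h : Real.sqrt (2 ^ (2 * m + n)) = 2 ^ m * Real.sqrt 2 ^ n := by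
    rw [Real.sqrt_eq_iff_mul_self_eq (by positivity) (by positivity), pow_add, pow_mul']
    have : Real.sqrt 2 ^ n * Real.sqrt 2 ^ n = 2 ^ n := by
      rw [← mul_pow, Real.mul_self_sqrt (by norm_num)]
    linear_combination -(2 ^ m * 2 ^ m) * this
  rw [h, invSqrtTwo, div_pow, div_pow]
  push_cast
  rw [one_pow, one_pow, div_mul_div_comm, one_mul]

theorem circuit_mulVec_append (hn : n ≤ m + a) (C : Circuit (m + a)) (φ : Bits n → QVec m)
    (η : Bits n → QVec a)
    (hrun : ∀ (k : Bits n) (u : Bits m) (e : Bits a),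
      (C.unitary *ᵥ ket (fun i => if h : (i : ℕ) < n then k ⟨i, h⟩ else false)) (Fin.append u e) =
        φ k u * η k e) (b : Bool) (u : Bits m) (e : Bits a) (k : Bits n) (x z : Bits m) :
    ((circuit hn C b).unitary *ᵥ ket (fun _ => false))
      (Fin.append u (Fin.append e (Fin.append k (Fin.append x z)))) =
      ((1 / Real.sqrt (2 ^ (2 * m + n)) : ℝ) : ℂ) *
        (η k e * ((pauli x z ^ b.toNat) *ᵥ φ k) u) := by
  rw [circuit_mulVec hn C φ η hrun, Pi.smul_apply, smul_eq_mul, amplitude, ← mul_assoc,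
    normalization]
  have h₁ : Fin.append u (Fin.append e (Fin.append k (Fin.append x z))) ∘ outW n m a = u := by
    funext j; simp [outW]
  have h₂ : Fin.append u (Fin.append e (Fin.append k (Fin.append x z))) ∘ ancW n m a = e := by
    funext j; simp [ancW]
  have h₃ : Fin.append u (Fin.append e (Fin.append k (Fin.append x z))) ∘ keyW n m a = k := by
    funext j; simp [keyW]
  have h₄ : Fin.append u (Fin.append e (Fin.append k (Fin.append x z))) ∘ xW n m a = x := by
    funext j; simp [xW]
  have h₅ : Fin.append u (Fin.append e (Fin.append k (Fin.append x z))) ∘ zW n m a = z := by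
    funext j
    change Fin.append u _ (Fin.natAdd m (Fin.natAdd a (Fin.natAdd n (Fin.natAdd m j)))) = z j
    simp only [Fin.append_right]
  rw [h₁, h₂, h₃, h₄, h₅]

end CommitCircuit

/-! ### The Pauli twirl -/

@[simp] theorem norm_boolSign (b : Bool) : ‖boolSign b‖ = 1 := by
  cases b <;> simp [boolSign]

@[simp] theorem star_boolSign (b : Bool) : star (boolSign b) = boolSign b := by
  cases b <;> simp [boolSign]

/-- The bitwise addition of `x`. -/
def xorEquiv {m : ℕ} (x : Bits m) : Bits m ≃ Bits m :=
  Function.Involutive.toPerm (fun u j => xor (u j) (x j)) fun u => by funext j; simp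

theorem xorEquiv_apply {m : ℕ} (x u : Bits m) : xorEquiv x u = fun j => xor (u j) (x j) := rfl

theorem norm_pauli_mulVec {m : ℕ} (x z u : Bits m) (ψ : QVec m) :
    ‖(pauli x z *ᵥ ψ) u‖ = ‖ψ (xorEquiv x u)‖ := by
  rw [pauli_mulVec, norm_mul, norm_prod, Finset.prod_congr rfl fun j _ => norm_boolSign _,
    Finset.prod_const_one, one_mul]
  rfl

theorem sum_norm_sq_pauli_mulVec {m : ℕ} (x z : Bits m) (ψ : QVec m) :
    ∑ u, ‖(pauli x z *ᵥ ψ) u‖ ^ 2 = ∑ u, ‖ψ u‖ ^ 2 := by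
  simp only [norm_pauli_mulVec]
  exact (xorEquiv x).sum_comp fun u => ‖ψ u‖ ^ 2

/-- Orthogonality of the characters of (ℤ/2)^m; the sum over `z` factorizes over the qubits. -/
theorem sum_prod_boolSign {m : ℕ} (u u' : Bits m) :
    ∑ z : Bits m, (∏ j, boolSign (z j && u j)) * (∏ j, boolSign (z j && u' j)) =
      if u = u' then 2 ^ m else 0 := by
  simp only [← Finset.prod_mul_distrib]
  have h := Finset.prod_univ_sum (fun _ : Fin m => (Finset.univ : Finset Bool))
    (fun j b => boolSign (b && u j) * boolSign (b && u' j))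
  rw [Fintype.piFinset_univ] at h
  rw [← h]
  have h₁ (j : Fin m) : ∑ b : Bool, boolSign (b && u j) * boolSign (b && u' j) =
      if u j = u' j then 2 else 0 := by
    cases u j <;> cases u' j <;> (simp [boolSign]; try norm_num)
  simp only [h₁]
  by_cases huu : u = u'
  · subst huu; simp
  · rw [if_neg huu]
    obtain ⟨j, hj⟩ := Function.ne_iff.1 huu
    exact Finset.prod_eq_zero (Finset.mem_univ j) (if_neg hj)

/-- The sum over `z` kills the off-diagonal entries by character orthogonality and yields the factor
2^m. The sum over `x` shifts the diagonal through all positions, so each entry becomes ‖ψ‖² = 1. -/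
theorem sum_pureState_pauli {m : ℕ} (ψ : QVec m) (hψ : ∑ u, ‖ψ u‖ ^ 2 = 1) :
    ∑ x : Bits m, ∑ z : Bits m, pureState (pauli x z *ᵥ ψ) =
      ((2 : ℝ) ^ m) • (1 : Matrix _ _ ℂ) := by
  ext u u'
  simp only [Matrix.sum_apply, pureState, Matrix.vecMulVec_apply, Pi.star_apply, pauli_mulVec,
    Matrix.smul_apply, star_mul', star_prod, star_boolSign]
  have h (x : Bits m) : ∑ z : Bits m, (∏ j, boolSign (z j && xor (u j) (x j))) *
      ψ (fun j => xor (u j) (x j)) * ((∏ j, boolSign (z j && xor (u' j) (x j))) *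
      star (ψ fun j => xor (u' j) (x j))) =
      (if u = u' then 2 ^ m else 0) * (ψ (xorEquiv x u) * star (ψ (xorEquiv x u'))) := by
    have h₁ := sum_prod_boolSign (xorEquiv x u) (xorEquiv x u')
    simp only [EmbeddingLike.apply_eq_iff_eq] at h₁
    rw [← h₁, Finset.sum_mul]
    refine Finset.sum_congr rfl fun z _ => ?_
    simp only [xorEquiv_apply]
    ring
  simp only [h]
  by_cases huu : u = u'
  · subst huu
    have h₂ : ∑ x : Bits m, ψ (xorEquiv x u) * star (ψ (xorEquiv x u)) = 1 := by
      have h₃ (x : Bits m) : xorEquiv x u = xorEquiv u x := by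
        funext j; exact Bool.xor_comm _ _
      simp only [h₃]
      rw [(xorEquiv u).sum_comp fun v => ψ v * star (ψ v)]
      have h₄ (v : Bits m) : ψ v * star (ψ v) = ((‖ψ v‖ ^ 2 : ℝ) : ℂ) := by
        rw [Complex.star_def, Complex.mul_conj, Complex.normSq_eq_norm_sq]
      simp only [h₄]
      rw [← Complex.ofReal_sum, hψ, Complex.ofReal_one]
    rw [if_pos rfl, ← Finset.mul_sum, h₂, Matrix.one_apply_eq, mul_one, Complex.real_smul, mul_one]
    norm_cast
  · simp [huu]

/-! ### The acceptance probability is linear in the input state -/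

/-- The acceptance probability of a distinguisher as a linear function of the input. -/
noncomputable def Distinguisher.probLin {q : ℕ → ℕ} (A : Distinguisher q) (n : ℕ) :
    Matrix (Bits (q n)) (Bits (q n)) ℂ →ₗ[ℝ] ℝ where
  toFun := A.prob n
  map_add' ρ ρ' := by
    have h : withAncilla (A.anc n + 1) (ρ + ρ') =
        withAncilla (A.anc n + 1) ρ + withAncilla (A.anc n + 1) ρ' := by
      ext y y'
      simp only [withAncilla, Matrix.of_apply, Matrix.add_apply]
      split_ifs <;> simp
    simp only [Distinguisher.prob, h, Matrix.mul_add, Matrix.add_mul, Matrix.add_apply,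
      Complex.add_re, ← Finset.sum_add_distrib]
    refine Finset.sum_congr rfl fun y _ => ?_
    split_ifs <;> simp
  map_smul' c ρ := by
    have h : withAncilla (A.anc n + 1) (c • ρ) = c • withAncilla (A.anc n + 1) ρ := by
      ext y y'
      simp only [withAncilla, Matrix.of_apply, Matrix.smul_apply]
      split_ifs <;> simp
    simp only [Distinguisher.prob, h, Matrix.mul_smul, Matrix.smul_mul, Matrix.smul_apply,
      RingHom.id_apply, smul_eq_mul, Finset.mul_sum, Complex.smul_re]
    refine Finset.sum_congr rfl fun y _ => ?_
    split_ifs <;> simp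

theorem Distinguisher.probLin_apply {q : ℕ → ℕ} (A : Distinguisher q) (n : ℕ)
    (ρ : Matrix (Bits (q n)) (Bits (q n)) ℂ) : A.probLin n ρ = A.prob n ρ := rfl

/-! ### The average of a Haar random state -/

section Haar

open MeasureTheory

variable {m : ℕ}

instance : IsProbabilityMeasure (haarState m) := by
  refine ⟨?_⟩
  rw [haarState, Measure.smul_apply, smul_eq_mul]
  refine ENNReal.inv_mul_cancel ?_ (measure_ne_top _ _)
  rw [Ne, Measure.measure_univ_eq_zero]
  exact Measure.toSphere_ne_zero _

/-- The map of the unit sphere induced by a linear isometry. -/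
def sphereMap {E : Type*} [NormedAddCommGroup E] [NormedSpace ℝ E] (f : E ≃ₗᵢ[ℝ] E) :
    Metric.sphere (0 : E) 1 → Metric.sphere (0 : E) 1 :=
  fun ψ => ⟨f ψ, by simp⟩

theorem continuous_sphereMap {E : Type*} [NormedAddCommGroup E] [NormedSpace ℝ E]
    (f : E ≃ₗᵢ[ℝ] E) : Continuous (sphereMap f) :=
  (f.continuous.comp continuous_subtype_val).subtype_mk _

open scoped Pointwise in
-- The surface measure of a set is a constant times the volume of the cone over it; a linear
-- isometry maps cones to cones and preserves volume.
theorem map_sphereMap_haarState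
    (f : EuclideanSpace ℂ (Bits m) ≃ₗᵢ[ℝ] EuclideanSpace ℂ (Bits m)) :
    (haarState m).map (sphereMap f) = haarState m := by
  ext s hs
  have hmeas := (continuous_sphereMap f).measurable
  rw [Measure.map_apply hmeas hs, haarState, Measure.smul_apply, Measure.smul_apply,
    Measure.toSphere_apply' _ hs, Measure.toSphere_apply' _ (hmeas hs)]
  congr 2
  have hset : Set.Ioo (0 : ℝ) 1 • (Subtype.val '' (sphereMap f ⁻¹' s)) =
      f ⁻¹' (Set.Ioo (0 : ℝ) 1 • (Subtype.val '' s)) := by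
    ext v
    simp only [Set.mem_smul, Set.mem_image, Set.mem_preimage]
    constructor
    · rintro ⟨r, hr, _, ⟨ψ, hψ, rfl⟩, rfl⟩
      exact ⟨r, hr, _, ⟨_, hψ, rfl⟩, by simp [sphereMap]⟩
    · rintro ⟨r, hr, _, ⟨ψ, hψ, rfl⟩, h⟩
      refine ⟨r, hr, f.symm ψ, ⟨⟨f.symm ψ, by simp⟩, ?_, rfl⟩, ?_⟩
      · have : sphereMap f ⟨f.symm ψ, by simp⟩ = ψ := Subtype.ext (by simp [sphereMap])
        rw [this]; exact hψ
      · rw [← map_smul, h]; simp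
  rw [hset]
  exact f.measurePreserving.measure_preimage_equiv (f := f.toHomeomorph.toMeasurableEquiv) _

/-- A Pauli operator as an isometry. -/
noncomputable def pauliIsometry (x z : Bits m) :
    EuclideanSpace ℂ (Bits m) ≃ₗᵢ[ℝ] EuclideanSpace ℂ (Bits m) :=
  LinearIsometry.toLinearIsometryEquiv
    { toFun := fun ψ => WithLp.toLp 2 (pauli x z *ᵥ WithLp.ofLp ψ)
      map_add' := fun ψ ψ' => by simp [Matrix.mulVec_add]
      map_smul' := fun c ψ => by simp [Matrix.mulVec_smul]
      norm_map' := fun ψ => by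
        simp only [LinearMap.coe_mk, AddHom.coe_mk, EuclideanSpace.norm_eq]
        rw [sum_norm_sq_pauli_mulVec] } rfl

/-- Averaging over the finitely many Pauli operators does not change the integral, but makes the
integrand constant by the twirl. No other invariance of the measure is needed. -/
theorem integral_haarState (L : Matrix (Bits m) (Bits m) ℂ →ₗ[ℝ] ℝ) :
    ∫ ψ, L (pureState (WithLp.ofLp ψ.1)) ∂(haarState m) = L (((2 : ℝ) ^ m)⁻¹ • 1) := by
  have hL : Continuous L := L.continuous_of_finiteDimensional
  have hcont : Continuous fun ψ : Metric.sphere (0 : EuclideanSpace ℂ (Bits m)) 1 =>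
      L (pureState (WithLp.ofLp ψ.1)) := by
    refine hL.comp ?_
    refine continuous_matrix fun u u' => ?_
    simp only [pureState, Matrix.vecMulVec_apply, Pi.star_apply]
    fun_prop
  have hintegrable (x z : Bits m) : Integrable
      (fun ψ : Metric.sphere (0 : EuclideanSpace ℂ (Bits m)) 1 =>
      L (pureState (pauli x z *ᵥ WithLp.ofLp ψ.1))) (haarState m) :=
    (hcont.comp (continuous_sphereMap (pauliIsometry x z))).integrable_of_hasCompactSupport
      (HasCompactSupport.of_compactSpace _)
  have hinv (x z : Bits m) : ∫ ψ, L (pureState (pauli x z *ᵥ WithLp.ofLp ψ.1)) ∂(haarState m) =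
      ∫ ψ, L (pureState (WithLp.ofLp ψ.1)) ∂(haarState m) := by
    conv_rhs => rw [← map_sphereMap_haarState (pauliIsometry x z)]
    rw [integral_map (continuous_sphereMap _).aemeasurable hcont.aestronglyMeasurable]
    rfl
  have hsum : ∑ x : Bits m, ∑ z : Bits m,
      ∫ ψ, L (pureState (pauli x z *ᵥ WithLp.ofLp ψ.1)) ∂(haarState m) =
      L ((2 : ℝ) ^ m • 1) := by
    have h₁ (x : Bits m) := integral_finsetSum (μ := haarState m) Finset.univ
      fun z _ => hintegrable x z
    have h₂ := integral_finsetSum (μ := haarState m) (Finset.univ : Finset (Bits m))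
      fun x _ => integrable_finsetSum (Finset.univ : Finset (Bits m)) fun z _ => hintegrable x z
    simp only [h₁] at h₂
    rw [← h₂]
    have h₃ (ψ : Metric.sphere (0 : EuclideanSpace ℂ (Bits m)) 1) :
        ∑ x : Bits m, ∑ z : Bits m, L (pureState (pauli x z *ᵥ WithLp.ofLp ψ.1)) =
          L ((2 : ℝ) ^ m • 1) := by
      simp only [← map_sum]
      rw [sum_pureState_pauli]
      have := EuclideanSpace.norm_sq_eq ψ.1
      rw [← this]
      simp
    simp only [h₃]
    simp
  -- Each of the 4^m summands equals the integral sought, and they add up to 2^m L(1).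
  simp only [hinv, Finset.sum_const, Finset.card_univ, Fintype.card_pi, Fintype.card_bool,
    Finset.prod_const, Fintype.card_fin, nsmul_eq_mul] at hsum
  rw [map_smul, smul_eq_mul] at hsum ⊢
  have h2 : (2 : ℝ) ^ m ≠ 0 := by positivity
  field_simp
  push_cast at hsum
  apply mul_left_cancel₀ h2
  linear_combination hsum

end Haar

/-! ### Sum-binding from nearly orthogonal projections -/

section Vectors

variable {ι : Type} [Fintype ι]

/-- The squared norm of a vector. -/
noncomputable def normSq (v : ι → ℂ) : ℝ := ∑ i, ‖v i‖ ^ 2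

theorem inner_toLp (v w : ι → ℂ) :
    inner ℂ (WithLp.toLp 2 v) (WithLp.toLp 2 w) = star v ⬝ᵥ w := by
  rw [EuclideanSpace.inner_toLp_toLp, dotProduct_comm]

theorem norm_toLp (v : ι → ℂ) : ‖WithLp.toLp 2 v‖ ^ 2 = normSq v :=
  EuclideanSpace.norm_sq_eq _

theorem star_dotProduct_self (v : ι → ℂ) : star v ⬝ᵥ v = (normSq v : ℂ) := by
  rw [← inner_toLp, inner_self_eq_norm_sq_to_K, ← norm_toLp]
  norm_cast

theorem normSq_nonneg (v : ι → ℂ) : 0 ≤ normSq v :=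
  Finset.sum_nonneg fun _ _ => by positivity

theorem norm_star_dotProduct_le (v w : ι → ℂ) :
    ‖star v ⬝ᵥ w‖ ≤ Real.sqrt (normSq v) * Real.sqrt (normSq w) := by
  rw [← inner_toLp, ← norm_toLp, ← norm_toLp, Real.sqrt_sq (norm_nonneg _),
    Real.sqrt_sq (norm_nonneg _)]
  exact norm_inner_le_norm _ _

theorem star_mulVec_dotProduct [DecidableEq ι] (U : Matrix ι ι ℂ) (v w : ι → ℂ) :
    star (Uᴴ *ᵥ v) ⬝ᵥ w = star v ⬝ᵥ (U *ᵥ w) := by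
  rw [Matrix.star_mulVec, Matrix.conjTranspose_conjTranspose, Matrix.dotProduct_mulVec]

theorem normSq_conjTranspose_mulVec [DecidableEq ι] {U : Matrix ι ι ℂ} (hU : U * Uᴴ = 1)
    (v : ι → ℂ) : normSq (Uᴴ *ᵥ v) = normSq v := by
  have h : (normSq (Uᴴ *ᵥ v) : ℂ) = normSq v := by
    rw [← star_dotProduct_self, ← star_dotProduct_self, star_mulVec_dotProduct,
      Matrix.mulVec_mulVec, hU, Matrix.one_mulVec]
  exact_mod_cast h

end Vectors

/-- Cauchy–Schwarz gives p + q = ⟨f + g, Ψ⟩ ≤ ‖f + g‖, and expanding the square gives ‖f + g‖² ≤ (1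
+ δ)(p + q), as 2√p√q ≤ p + q. Together (p + q)² ≤ (1 + δ)(p + q). -/
theorem add_le_one_add_of_inner {H : Type*} [NormedAddCommGroup H] [InnerProductSpace ℂ H]
    {Ψ f g : H} {p q δ : ℝ} (hΨ : ‖Ψ‖ ^ 2 = 1) (hf : inner ℂ f Ψ = (p : ℂ))
    (hg : inner ℂ g Ψ = (q : ℂ)) (hf' : ‖f‖ ^ 2 = p) (hg' : ‖g‖ ^ 2 = q) (hδ : 0 ≤ δ)
    (hfg : ‖inner ℂ f g‖ ≤ δ * (Real.sqrt p * Real.sqrt q)) : p + q ≤ 1 + δ := by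
  have hp : 0 ≤ p := hf' ▸ by positivity
  have hq : 0 ≤ q := hg' ▸ by positivity
  have hΨ1 : ‖Ψ‖ = 1 := by
    rw [← Real.sqrt_sq (norm_nonneg Ψ), hΨ, Real.sqrt_one]
  have h₁ : p + q ≤ ‖f + g‖ := by
    have h := norm_inner_le_norm (𝕜 := ℂ) (f + g) Ψ
    rw [inner_add_left, hf, hg, hΨ1, mul_one, ← Complex.ofReal_add, Complex.norm_real,
      Real.norm_of_nonneg (by positivity)] at h
    exact h
  have h₂ : ‖f + g‖ ^ 2 ≤ (1 + δ) * (p + q) := by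
    have h := norm_add_sq (𝕜 := ℂ) f g
    have h₃ : RCLike.re (inner ℂ f g) ≤ δ * (Real.sqrt p * Real.sqrt q) :=
      (RCLike.re_le_norm _).trans hfg
    have h₄ : 2 * (Real.sqrt p * Real.sqrt q) ≤ p + q := by
      nlinarith [sq_nonneg (Real.sqrt p - Real.sqrt q), Real.sq_sqrt hp, Real.sq_sqrt hq]
    rw [h, hf', hg']
    nlinarith [mul_le_mul_of_nonneg_left h₄ hδ]
  by_contra! hlt
  -- The assumed bound makes p + q positive, so the quadratic inequality may be divided by it.
  have h₅ : 0 < p + q := by linarith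
  nlinarith [norm_nonneg (f + g), mul_self_le_mul_self h₅.le h₁]

section Binding

variable {E R C κ : Type} [Fintype E] [Fintype R] [Fintype C] [Fintype κ]

/-- The result of the measurement of `RC` in the direction `ψ`, as a vector on `E`. -/
def partialInner (ψ : C × R → ℂ) (χ : (E × R) × C → ℂ) (e : E) : ℂ :=
  ∑ p : C × R, star (ψ p) * χ ((e, p.2), p.1)

/-- The tensor product of a vector on `E` and a vector on `RC`. -/
def tensor (v : E → ℂ) (ψ : C × R → ℂ) (x : (E × R) × C) : ℂ := v x.1.1 * ψ (x.2, x.1.2)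

theorem sum_registers {M : Type} [AddCommMonoid M] (F : (E × R) × C → M) :
    ∑ x, F x = ∑ e : E, ∑ p : C × R, F ((e, p.2), p.1) := by
  rw [Fintype.sum_prod_type, Fintype.sum_prod_type]
  refine Finset.sum_congr rfl fun e _ => ?_
  rw [Fintype.sum_prod_type, Finset.sum_comm]

/-- Tensoring with ψ and the partial inner product with ψ are adjoint. Hence `tensor (partialInner ψ
χ) ψ` is (I ⊗ |ψ⟩⟨ψ|)χ. -/
theorem star_tensor_dotProduct (v : E → ℂ) (ψ : C × R → ℂ) (χ : (E × R) × C → ℂ) :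
    star (tensor v ψ) ⬝ᵥ χ = star v ⬝ᵥ partialInner ψ χ := by
  rw [dotProduct, sum_registers, dotProduct]
  refine Finset.sum_congr rfl fun e _ => ?_
  rw [partialInner, Finset.mul_sum]
  refine Finset.sum_congr rfl fun p _ => ?_
  simp only [tensor, Pi.star_apply, star_mul']
  ring

theorem normSq_tensor (v : E → ℂ) (ψ : C × R → ℂ) : normSq (tensor v ψ) = normSq v * normSq ψ := by
  rw [normSq, sum_registers, normSq, normSq, Finset.sum_mul]
  refine Finset.sum_congr rfl fun e _ => ?_
  rw [Finset.mul_sum]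
  refine Finset.sum_congr rfl fun p _ => ?_
  simp only [tensor, norm_mul, mul_pow]

theorem kronecker_one_mulVec {Q : Type} [Fintype Q] [DecidableEq C] (W : Matrix Q Q ℂ)
    (χ : Q × C → ℂ) (x : Q)
    (c : C) : ((W ⊗ₖ (1 : Matrix C C ℂ)) *ᵥ χ) (x, c) = (W *ᵥ fun y => χ (y, c)) x := by
  simp only [Matrix.mulVec, dotProduct, Fintype.sum_prod_type, Matrix.kroneckerMap_apply,
    Matrix.one_apply, mul_ite, mul_one, mul_zero, ite_mul, zero_mul, Finset.sum_ite_eq,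
    Finset.mem_univ, if_true]

/-- The probability to open `ψ` is the squared norm of the partial inner product. -/
theorem re_dotProduct_revealed (ψ : C × R → ℂ) (χ : (E × R) × C → ℂ) :
    (star ψ ⬝ᵥ ((Matrix.of fun p p' : C × R => ∑ e : E,
      pureState χ ((e, p.2), p.1) ((e, p'.2), p'.1)) *ᵥ ψ)).re = normSq (partialInner ψ χ) := by
  have h : star ψ ⬝ᵥ ((Matrix.of fun p p' : C × R => ∑ e : E,
      pureState χ ((e, p.2), p.1) ((e, p'.2), p'.1)) *ᵥ ψ) = (normSq (partialInner ψ χ) : ℂ) := by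
    rw [← star_dotProduct_self, dotProduct_comm (star (partialInner ψ χ))]
    simp only [dotProduct, Matrix.mulVec, Matrix.of_apply, pureState, Matrix.vecMulVec_apply,
      Pi.star_apply, partialInner, star_sum, star_mul', star_star, Finset.mul_sum, Finset.sum_mul]
    simp only [Finset.sum_comm (s := (Finset.univ : Finset (C × R)))
      (t := (Finset.univ : Finset E))]
    refine Finset.sum_congr rfl fun e _ => ?_
    rw [Finset.sum_comm]
    refine Finset.sum_congr rfl fun p _ => Finset.sum_congr rfl fun p' _ => ?_
    ring
  rw [h, Complex.ofReal_re]

/-- `W` acts trivially on `C`, so contracting `C` with φ_k commutes with it. The inner product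
splits into terms ⟨v ⊗ ζ_k, W(w ⊗ χ_k)⟩, where χ_k is the component of ψ₁ along φ_k; each is bounded
by Cauchy–Schwarz and the isometry of `W`. -/
theorem norm_star_tensor_kronecker_le [DecidableEq E] [DecidableEq R] [DecidableEq C]
    {ψ₀ ψ₁ : C × R → ℂ} {ζ : κ → R → ℂ} {φ : κ → C → ℂ}
    (hψ₀ : ∀ c r, ψ₀ (c, r) = ∑ k, ζ k r * φ k c) {s t : ℝ} (hζ : ∀ k, normSq (ζ k) = s)
    (hφ : ∀ k, normSq (fun r => ∑ c, star (φ k c) * ψ₁ (c, r)) = t)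
    {W : Matrix (E × R) (E × R) ℂ} (hW : Wᴴ * W = 1) (v w : E → ℂ) :
    ‖star (tensor v ψ₀) ⬝ᵥ ((W ⊗ₖ (1 : Matrix C C ℂ)) *ᵥ tensor w ψ₁)‖ ≤
      Fintype.card κ * (Real.sqrt s * Real.sqrt t) *
        (Real.sqrt (normSq v) * Real.sqrt (normSq w)) := by
  have hprod (v : E → ℂ) (ζ : R → ℂ) :
      normSq (fun q : E × R => v q.1 * ζ q.2) = normSq v * normSq ζ := by
    simp only [normSq, Fintype.sum_prod_type, norm_mul, mul_pow, Finset.sum_mul_sum]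
  have h : star (tensor v ψ₀) ⬝ᵥ ((W ⊗ₖ (1 : Matrix C C ℂ)) *ᵥ tensor w ψ₁) =
      ∑ k, star (fun q : E × R => v q.1 * ζ k q.2) ⬝ᵥ
        (W *ᵥ fun q : E × R => w q.1 * ∑ c, star (φ k c) * ψ₁ (c, q.2)) := by
    have hlin (k : κ) (q : E × R) :
        (W *ᵥ fun q : E × R => w q.1 * ∑ c, star (φ k c) * ψ₁ (c, q.2)) q =
          ∑ c, star (φ k c) * (W *ᵥ fun y => tensor w ψ₁ (y, c)) q := by
      simp only [Matrix.mulVec, dotProduct, tensor, Finset.mul_sum]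
      rw [Finset.sum_comm]
      exact Finset.sum_congr rfl fun c _ => Finset.sum_congr rfl fun y _ => by ring
    rw [dotProduct, Fintype.sum_prod_type]
    simp only [dotProduct, kronecker_one_mulVec, hlin]
    rw [Finset.sum_comm (s := (Finset.univ : Finset κ))]
    refine Finset.sum_congr rfl fun q _ => ?_
    simp only [Finset.mul_sum]
    rw [Finset.sum_comm (s := (Finset.univ : Finset κ))]
    refine Finset.sum_congr rfl fun c _ => ?_
    rw [Pi.star_apply, tensor, hψ₀, star_mul', star_sum, Finset.mul_sum, Finset.sum_mul]
    refine Finset.sum_congr rfl fun k _ => ?_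
    simp only [Pi.star_apply, star_mul']
    ring
  rw [h]
  refine (norm_sum_le _ _).trans ?_
  have hk (k : κ) : ‖star (fun q : E × R => v q.1 * ζ k q.2) ⬝ᵥ
        (W *ᵥ fun q : E × R => w q.1 * ∑ c, star (φ k c) * ψ₁ (c, q.2))‖ ≤
      (Real.sqrt s * Real.sqrt t) * (Real.sqrt (normSq v) * Real.sqrt (normSq w)) := by
    refine (norm_star_dotProduct_le _ _).trans (le_of_eq ?_)
    have h₁ := normSq_conjTranspose_mulVec (U := Wᴴ) (by rwa [Matrix.conjTranspose_conjTranspose])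
      (fun q : E × R => w q.1 * ∑ c, star (φ k c) * ψ₁ (c, q.2))
    rw [Matrix.conjTranspose_conjTranspose] at h₁
    rw [h₁, hprod v (ζ k), hprod w (fun r => ∑ c, star (φ k c) * ψ₁ (c, r)), hζ, hφ,
      Real.sqrt_mul (normSq_nonneg _), Real.sqrt_mul (normSq_nonneg _)]
    ring
  refine (Finset.sum_le_sum fun k _ => hk k).trans (le_of_eq ?_)
  rw [Finset.sum_const, Finset.card_univ, nsmul_eq_mul]
  ring

/-- Applies the two-projection bound to f_b = U_b†(I ⊗ |ψ_b⟩⟨ψ_b|)U_b Ψ; the overlap of f_0 and f_1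
involves the unitary U_0 U_1† on E and R only. -/
theorem sum_binding [DecidableEq E] [DecidableEq R] [DecidableEq C] {ψ₀ ψ₁ : C × R → ℂ}
    (h₀ : normSq ψ₀ = 1) (h₁ : normSq ψ₁ = 1)
    {ζ : κ → R → ℂ} {φ : κ → C → ℂ}
    (hψ₀ : ∀ c r, ψ₀ (c, r) = ∑ k, ζ k r * φ k c) {s t : ℝ} (hζ : ∀ k, normSq (ζ k) = s)
    (hφ : ∀ k, normSq (fun r => ∑ c, star (φ k c) * ψ₁ (c, r)) = t)
    (U₀ U₁ : Matrix.unitaryGroup (E × R) ℂ) {Ψ : (E × R) × C → ℂ} (hΨ : normSq Ψ = 1) :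
    normSq (partialInner ψ₀ (((U₀ : Matrix (E × R) (E × R) ℂ) ⊗ₖ (1 : Matrix C C ℂ)) *ᵥ Ψ)) +
      normSq (partialInner ψ₁ (((U₁ : Matrix (E × R) (E × R) ℂ) ⊗ₖ (1 : Matrix C C ℂ)) *ᵥ Ψ)) ≤
        1 + Fintype.card κ * (Real.sqrt s * Real.sqrt t) := by
  have hU (U : Matrix.unitaryGroup (E × R) ℂ) :
      ((U : Matrix (E × R) (E × R) ℂ) ⊗ₖ (1 : Matrix C C ℂ)) *
      ((U : Matrix (E × R) (E × R) ℂ) ⊗ₖ (1 : Matrix C C ℂ))ᴴ = 1 := by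
    rw [Matrix.conjTranspose_kronecker, ← Matrix.mul_kronecker_mul, Matrix.conjTranspose_one,
      mul_one, ← Matrix.star_eq_conjTranspose, Unitary.mul_star_self_of_mem U.2,
      Matrix.one_kronecker_one]
  refine add_le_one_add_of_inner (Ψ := WithLp.toLp 2 Ψ)
    (f := WithLp.toLp 2 (((U₀ : Matrix (E × R) (E × R) ℂ) ⊗ₖ (1 : Matrix C C ℂ))ᴴ *ᵥ
      tensor (partialInner ψ₀
      (((U₀ : Matrix (E × R) (E × R) ℂ) ⊗ₖ (1 : Matrix C C ℂ)) *ᵥ Ψ)) ψ₀))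
    (g := WithLp.toLp 2 (((U₁ : Matrix (E × R) (E × R) ℂ) ⊗ₖ (1 : Matrix C C ℂ))ᴴ *ᵥ
      tensor (partialInner ψ₁
      (((U₁ : Matrix (E × R) (E × R) ℂ) ⊗ₖ (1 : Matrix C C ℂ)) *ᵥ Ψ)) ψ₁))
    (by rw [norm_toLp, hΨ]) ?_ ?_ ?_ ?_ (by positivity) ?_
  · rw [inner_toLp, star_mulVec_dotProduct, star_tensor_dotProduct, star_dotProduct_self]
  · rw [inner_toLp, star_mulVec_dotProduct, star_tensor_dotProduct, star_dotProduct_self]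
  · rw [norm_toLp, normSq_conjTranspose_mulVec (hU U₀), normSq_tensor, h₀, mul_one]
  · rw [norm_toLp, normSq_conjTranspose_mulVec (hU U₁), normSq_tensor, h₁, mul_one]
  · rw [inner_toLp, star_mulVec_dotProduct, Matrix.mulVec_mulVec, Matrix.conjTranspose_kronecker,
      ← Matrix.mul_kronecker_mul, Matrix.conjTranspose_one, mul_one]
    refine norm_star_tensor_kronecker_le hψ₀ hζ hφ ?_ _ _
    rw [Matrix.conjTranspose_mul, Matrix.conjTranspose_conjTranspose, mul_assoc,
      ← mul_assoc (U₀ : Matrix (E × R) (E × R) ℂ)ᴴ,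
      ← Matrix.star_eq_conjTranspose (U₀ : Matrix (E × R) (E × R) ℂ),
      Unitary.star_mul_self_of_mem U₀.2, one_mul, ← Matrix.star_eq_conjTranspose,
      Unitary.mul_star_self_of_mem U₁.2]

end Binding

/-! ### The commitment states -/

theorem sum_bits_append {M : Type} [AddCommMonoid M] {p q : ℕ} (F : Bits (p + q) → M) :
    ∑ v, F v = ∑ s : Bits p, ∑ t : Bits q, F (Fin.append s t) := by
  rw [← Fintype.sum_prod_type' (f := fun s t => F (Fin.append s t)),
    ← (Fin.appendEquiv p q).sum_comp]
  rfl

/-- The probability to find `f` in the first register of `ψ`. -/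
theorem normSq_sum_star_mul {C R : Type} [Fintype C] [Fintype R] (f : C → ℂ) (ψ : C × R → ℂ) :
    (normSq (fun r => ∑ c, star (f c) * ψ (c, r)) : ℂ) =
      star f ⬝ᵥ ((Matrix.of fun u u' => ∑ v, pureState ψ (u, v) (u', v)) *ᵥ f) := by
  rw [← star_dotProduct_self, dotProduct_comm]
  simp only [dotProduct, Matrix.mulVec, Matrix.of_apply, pureState, Matrix.vecMulVec_apply,
    Pi.star_apply, star_sum, star_mul', star_star, Finset.mul_sum, Finset.sum_mul]
  rw [Finset.sum_comm (s := (Finset.univ : Finset C))]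
  simp only [Finset.sum_comm (s := (Finset.univ : Finset C)) (t := (Finset.univ : Finset R))]
  rw [Finset.sum_comm (s := (Finset.univ : Finset R))]
  simp only [Finset.sum_comm (s := (Finset.univ : Finset C)) (t := (Finset.univ : Finset R))]
  refine Finset.sum_congr rfl fun r _ => Finset.sum_congr rfl fun c _ =>
    Finset.sum_congr rfl fun c' _ => ?_
  ring

section CommitStates

variable {n m a : ℕ}

theorem sum_opening {M : Type} [AddCommMonoid M] (F : Bits (a + (n + (m + m))) → M) :
    ∑ v, F v = ∑ k : Bits n, ∑ x : Bits m, ∑ z : Bits m, ∑ e : Bits a,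
      F (Fin.append e (Fin.append k (Fin.append x z))) := by
  simp only [sum_bits_append]
  rw [Finset.sum_comm]
  refine Finset.sum_congr rfl fun k _ => ?_
  rw [Finset.sum_comm]
  refine Finset.sum_congr rfl fun x _ => ?_
  rw [Finset.sum_comm]

/-- `ψ` is `2^{-(2m+n)/2} ∑_{x,z,k} (P_{x,z}^b |φ_k⟩) ⊗ |η_k⟩ ⊗ |k⟩ ⊗ |x⟩ ⊗ |z⟩`. -/
def IsCommitState (φ : Bits n → QVec m) (η : Bits n → QVec a) (b : Bool)
    (ψ : Bits m × Bits (a + (n + (m + m))) → ℂ) : Prop :=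
  ∀ u e k x z, ψ (u, Fin.append e (Fin.append k (Fin.append x z))) =
    ((1 / Real.sqrt (2 ^ (2 * m + n)) : ℝ) : ℂ) * (η k e * ((pauli x z ^ b.toNat) *ᵥ φ k) u)

variable {φ : Bits n → QVec m} {η : Bits n → QVec a} {b : Bool}
  {ψ : Bits m × Bits (a + (n + (m + m))) → ℂ}

theorem sum_norm_sq_pauli_pow_mulVec (x z : Bits m) (b : Bool) (ψ : QVec m) :
    ∑ u, ‖((pauli x z ^ b.toNat) *ᵥ ψ) u‖ ^ 2 = ∑ u, ‖ψ u‖ ^ 2 := by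
  cases b
  · simp
  · simpa using sum_norm_sq_pauli_mulVec x z ψ

theorem one_div_sqrt_sq (N : ℕ) : (1 / Real.sqrt (2 ^ N)) ^ 2 = ((2 : ℝ) ^ N)⁻¹ := by
  rw [div_pow, Real.sq_sqrt (by positivity), one_pow, one_div]

theorem IsCommitState.normSq_eq_one (h : IsCommitState φ η b ψ) (hφ : ∀ k, ∑ u, ‖φ k u‖ ^ 2 = 1)
    (hη : ∀ k, ∑ e, ‖η k e‖ ^ 2 = 1) : normSq ψ = 1 := by
  rw [normSq, Fintype.sum_prod_type, Finset.sum_comm, sum_opening]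
  have hk (k : Bits n) (x z : Bits m) :
      ∑ e : Bits a, ∑ u : Bits m,
        ‖ψ (u, Fin.append e (Fin.append k (Fin.append x z)))‖ ^ 2 = ((2 : ℝ) ^ (2 * m + n))⁻¹ := by
    simp only [h _ _ _ _ _, norm_mul, mul_pow, Complex.norm_real, Real.norm_eq_abs, sq_abs,
      one_div_sqrt_sq, ← Finset.mul_sum, sum_norm_sq_pauli_pow_mulVec, hφ, hη, mul_one]
  simp only [hk, Finset.sum_const, Finset.card_univ, Fintype.card_fun, Fintype.card_bool,
    Fintype.card_fin, nsmul_eq_mul]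
  push_cast
  rw [← mul_assoc, ← mul_assoc, ← pow_add, ← pow_add, show n + m + m = 2 * m + n by ring]
  exact mul_inv_cancel₀ (by positivity)

/-- The opening register contains k, x and z in the computational basis, so tracing it out leaves a
classical mixture; the vectors η_k contribute only their norm 1. -/
theorem IsCommitState.reduced (h : IsCommitState φ η b ψ) (hη : ∀ k, ∑ e, ‖η k e‖ ^ 2 = 1) :
    (Matrix.of fun u u' => ∑ v, pureState ψ (u, v) (u', v)) =
      ((2 : ℝ) ^ (2 * m + n))⁻¹ • ∑ k, ∑ x, ∑ z, pureState ((pauli x z ^ b.toNat) *ᵥ φ k) := by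
  ext u u'
  simp only [Matrix.of_apply, Matrix.smul_apply, Matrix.sum_apply, sum_opening, Finset.smul_sum]
  refine Finset.sum_congr rfl fun k _ => Finset.sum_congr rfl fun x _ =>
    Finset.sum_congr rfl fun z _ => ?_
  simp only [pureState, Matrix.vecMulVec_apply, Pi.star_apply, h _ _ _ _ _, star_mul']
  set γ : ℝ := 1 / Real.sqrt (2 ^ (2 * m + n)) with hγ
  rw [← one_div_sqrt_sq, ← hγ]
  generalize (pauli x z ^ b.toNat) *ᵥ φ k = v
  have he : ∑ e, η k e * star (η k e) = 1 := by
    have := hη k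
    simp only [Complex.star_def, Complex.mul_conj, Complex.normSq_eq_norm_sq]
    exact_mod_cast this
  rw [Complex.real_smul, ← mul_one (((γ ^ 2 : ℝ) : ℂ) * _), ← he, Finset.mul_sum]
  refine Finset.sum_congr rfl fun e _ => ?_
  rw [show star (γ : ℂ) = γ from Complex.conj_ofReal γ]
  push_cast
  ring

theorem IsCommitState.reduced_false (h : IsCommitState φ η false ψ)
    (hη : ∀ k, ∑ e, ‖η k e‖ ^ 2 = 1) :
    (Matrix.of fun u u' => ∑ v, pureState ψ (u, v) (u', v)) =
      ((2 : ℝ) ^ n)⁻¹ • ∑ k, pureState (φ k) := by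
  rw [h.reduced hη]
  simp only [Bool.toNat_false, pow_zero, Matrix.one_mulVec, Finset.sum_const, Finset.card_univ,
    Fintype.card_fun, Fintype.card_bool, Fintype.card_fin, ← Finset.smul_sum]
  rw [← Nat.cast_smul_eq_nsmul ℝ, ← Nat.cast_smul_eq_nsmul ℝ, smul_smul, smul_smul]
  congr 1
  push_cast
  field_simp
  ring

theorem IsCommitState.reduced_true (h : IsCommitState φ η true ψ)
    (hφ : ∀ k, ∑ u, ‖φ k u‖ ^ 2 = 1) (hη : ∀ k, ∑ e, ‖η k e‖ ^ 2 = 1) :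
    (Matrix.of fun u u' => ∑ v, pureState ψ (u, v) (u', v)) =
      ((2 : ℝ) ^ m)⁻¹ • (1 : Matrix (Bits m) (Bits m) ℂ) := by
  rw [h.reduced hη]
  simp only [Bool.toNat_true, pow_one, sum_pureState_pauli _ (hφ _), Finset.sum_const,
    Finset.card_univ, Fintype.card_fun, Fintype.card_bool, Fintype.card_fin]
  rw [← Nat.cast_smul_eq_nsmul ℝ, smul_smul, smul_smul]
  congr 1
  push_cast
  field_simp
  ring

/-- The part of the opening register that belongs to the key `k`. -/
noncomputable def keyPart (η : Bits n → QVec a) (k : Bits n) (v : Bits (a + (n + (m + m)))) : ℂ :=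
  if (fun i => v (Fin.natAdd a (Fin.castAdd (m + m) i))) = k then
    ((1 / Real.sqrt (2 ^ (2 * m + n)) : ℝ) : ℂ) * η k (fun i => v (Fin.castAdd _ i)) else 0

theorem keyPart_append (k k' : Bits n) (e : Bits a) (x z : Bits m) :
    keyPart η k (Fin.append e (Fin.append k' (Fin.append x z))) =
      if k' = k then ((1 / Real.sqrt (2 ^ (2 * m + n)) : ℝ) : ℂ) * η k e else 0 := by
  simp only [keyPart, Fin.append_right, Fin.append_left]

/-- There are 4^m choices of the pad keys, each of weight 2^{-(2m+n)}. -/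
theorem normSq_keyPart (hη : ∀ k, ∑ e, ‖η k e‖ ^ 2 = 1) (k : Bits n) :
    normSq (keyPart (m := m) η k) = ((2 : ℝ) ^ n)⁻¹ := by
  rw [normSq, sum_opening, Finset.sum_eq_single k]
  · simp only [keyPart_append, if_true, norm_mul, mul_pow, Complex.norm_real, Real.norm_eq_abs,
      sq_abs, one_div_sqrt_sq, ← Finset.mul_sum, hη, mul_one, Finset.sum_const, Finset.card_univ,
      Fintype.card_fun, Fintype.card_bool, Fintype.card_fin, nsmul_eq_mul]
    push_cast
    field_simp
    ring
  · intro k' _ hk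
    simp only [keyPart_append, if_neg hk, norm_zero]
    simp
  · simp

theorem IsCommitState.eq_sum_keyPart (h : IsCommitState φ η false ψ) (u : Bits m)
    (v : Bits (a + (n + (m + m)))) : ψ (u, v) = ∑ k, keyPart η k v * φ k u := by
  obtain ⟨⟨e, w⟩, rfl⟩ := (Fin.appendEquiv a (n + (m + m))).surjective v
  obtain ⟨⟨k, w⟩, rfl⟩ := (Fin.appendEquiv n (m + m)).surjective w
  obtain ⟨⟨x, z⟩, rfl⟩ := (Fin.appendEquiv m m).surjective w
  change ψ (u, Fin.append e (Fin.append k (Fin.append x z))) =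
    ∑ k', keyPart η k' (Fin.append e (Fin.append k (Fin.append x z))) * φ k' u
  simp only [keyPart_append, ite_mul, zero_mul, Finset.sum_ite_eq, Finset.mem_univ, if_true]
  rw [h, Bool.toNat_false, pow_zero, Matrix.one_mulVec]
  ring

/-- The squared norm is ⟨φ_k|ρ|φ_k⟩ for the reduced state ρ = I/2^m. -/
theorem IsCommitState.normSq_overlap (h : IsCommitState φ η true ψ)
    (hφ : ∀ k, ∑ u, ‖φ k u‖ ^ 2 = 1) (hη : ∀ k, ∑ e, ‖η k e‖ ^ 2 = 1) (k : Bits n) :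
    normSq (fun v => ∑ u, star (φ k u) * ψ (u, v)) = ((2 : ℝ) ^ m)⁻¹ := by
  have h' : (normSq (fun v => ∑ u, star (φ k u) * ψ (u, v)) : ℂ) = (((2 : ℝ) ^ m)⁻¹ : ℝ) := by
    rw [normSq_sum_star_mul, h.reduced_true hφ hη, Matrix.smul_mulVec, Matrix.one_mulVec,
      dotProduct_smul, star_dotProduct_self, normSq, hφ, Complex.real_smul, Complex.ofReal_one,
      mul_one]
  exact_mod_cast h'

end CommitStates

/-! ### The commitment scheme of a state generator -/

namespace StateGen

variable (G : StateGen)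

/-- The commitment scheme of a state generator, which hides the bit by a quantum one-time pad. -/
def commitScheme : QuantumCommitment G.m (fun n => G.a n + (n + (G.m n + G.m n))) where
  circ b n := CommitCircuit.circuit (G.input_le n) (G.circ n) b
  uniform b := by
    obtain ⟨h⟩ := G.uniform
    simp only [Circuit.encode, List.append_assoc] at h
    simpa only [PolyTimeUniform, CommitCircuit.encode_circuit] using
      StackProgram.polyTime_descCommit b G.m G.a (fun n => (G.circ n).flatMap Gate.encode) h

theorem isCommitState_commitScheme (n : ℕ) (b : Bool) :
    IsCommitState (G.φ n) (G.η n) b (G.commitScheme.state n b) :=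
  fun u e k x z => CommitCircuit.circuit_mulVec_append (G.input_le n) (G.circ n) (G.φ n) (G.η n)
    (G.run n) b u e k x z

theorem normSq_commitScheme_state (n : ℕ) (b : Bool) : normSq (G.commitScheme.state n b) = 1 :=
  (G.isCommitState_commitScheme n b).normSq_eq_one (G.φ_norm n) (G.η_norm n)

theorem perfectlyCorrect_commitScheme : G.commitScheme.PerfectlyCorrect := by
  intro n b
  rw [QuantumCommitment.openProb, pureState, Matrix.vecMulVec_mulVec, dotProduct_smul,
    star_dotProduct_self, normSq_commitScheme_state]
  simp

theorem commitment_false (n : ℕ) :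
    G.commitScheme.commitment n false = ((2 : ℝ) ^ n)⁻¹ • ∑ k, pureState (G.φ n k) :=
  (G.isCommitState_commitScheme n false).reduced_false (G.η_norm n)

theorem commitment_true (n : ℕ) :
    G.commitScheme.commitment n true = ((2 : ℝ) ^ G.m n)⁻¹ • 1 :=
  (G.isCommitState_commitScheme n true).reduced_true (G.φ_norm n) (G.η_norm n)

end StateGen

/-- A distinguisher for `m n` qubits also runs on one copy of an `m n`-qubit state. -/
theorem Distinguisher.exists_one_copy {q m : ℕ → ℕ} (hq : ∀ n, q n = m n) (A : Distinguisher m) :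
    ∃ B : Distinguisher q, ∀ n (ψ : QVec (m n)),
      B.prob n (pureState fun y => ψ fun j => y (Fin.cast (hq n).symm j)) =
        A.prob n (pureState ψ) := by
  obtain rfl := funext hq
  exact ⟨A, fun n ψ => rfl⟩

/-- One copy lives on `1 * m` wires, equal to `m` only propositionally, hence the cast. -/
theorem copies_one {m : ℕ} (ψ : QVec m) :
    copies 1 ψ = fun y => ψ fun j => y (Fin.cast (one_mul m).symm j) := by
  funext y
  simp only [copies, Finset.univ_unique, Finset.prod_singleton]
  congr 1

/-- The two commitments are the average key state and the average Haar state, so the advantage is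
exactly that of the single-copy game, with the same negligible bound. -/
theorem StateGen.computationallyHiding_commitScheme (G : StateGen) (hG : G.IsSingleCopyPRSG) :
    G.commitScheme.ComputationallyHiding := by
  intro A
  obtain ⟨B, hB⟩ := A.exists_one_copy (q := fun n => 1 * G.m n) fun n => one_mul _
  obtain ⟨negl, hnegl, h⟩ := hG B
  refine ⟨negl, hnegl, fun n => (le_of_eq ?_).trans (h n)⟩
  have hhaar : ∫ ψ, A.prob n (pureState (WithLp.ofLp ψ.1)) ∂(haarState (G.m n)) =
      A.prob n (G.commitScheme.commitment n true) := by
    rw [G.commitment_true]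
    exact integral_haarState (A.probLin n)
  have hkeys : (∑ k, A.prob n (pureState (G.φ n k))) / 2 ^ n =
      A.prob n (G.commitScheme.commitment n false) := by
    rw [G.commitment_false, ← A.probLin_apply, map_smul, map_sum, smul_eq_mul, div_eq_inv_mul]
    rfl
  simp only [copies_one, hB, hhaar, hkeys]

theorem negligible_two_rpow_neg {δ : ℝ} (hδ : 0 < δ) :
    Negligible fun n : ℕ => (2 : ℝ) ^ (-(δ * n)) := by
  intro d _
  have h := (isLittleO_rpow_exp_pos_mul_atTop d (b := Real.log 2 * δ)
    (mul_pos (Real.log_pos one_lt_two) hδ)).comp_tendsto tendsto_natCast_atTop_atTop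
  -- Any constant below 1 would do; it turns the asymptotic bound into the strict inequality
  -- required.
  filter_upwards [h.bound (c := 1 / 2) (by norm_num), Filter.eventually_gt_atTop 0] with n hn hpos
  have hn0 : (0 : ℝ) < n := by exact_mod_cast hpos
  have hpow : (0 : ℝ) < (n : ℝ) ^ d := Real.rpow_pos_of_pos hn0 d
  have hexp : Real.exp (Real.log 2 * δ * n) = (2 : ℝ) ^ (δ * n) := by
    rw [Real.rpow_def_of_pos two_pos, mul_assoc]
  simp only [Function.comp_apply, Real.norm_of_nonneg hpow.le, hexp,
    Real.norm_of_nonneg (Real.rpow_nonneg zero_le_two _)] at hn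
  have h2 : (0 : ℝ) < 2 ^ (δ * (n : ℝ)) := Real.rpow_pos_of_pos two_pos _
  rw [Real.rpow_neg hn0.le, Real.rpow_neg zero_le_two]
  exact inv_strictAnti₀ hpow (by linarith)

/-- The 2^n keys contribute 2^{-n/2} · 2^{-m/2} each. -/
theorem StateGen.cheatProb_commitScheme_le (G : StateGen)
    (A : BindingAdversary G.m (fun n => G.a n + (n + (G.m n + G.m n)))) (n : ℕ) :
    G.commitScheme.cheatProb A n false + G.commitScheme.cheatProb A n true ≤
      1 + (2 : ℝ) ^ (((n : ℝ) - G.m n) / 2) := by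
  have hcheat (b : Bool) : G.commitScheme.cheatProb A n b =
      normSq (partialInner (E := Fin (A.dimE n)) (G.commitScheme.state n b)
        (((A.U b n : Matrix _ _ ℂ) ⊗ₖ (1 : Matrix (Bits (G.m n)) (Bits (G.m n)) ℂ)) *ᵥ A.Ψ n)) := by
    rw [QuantumCommitment.cheatProb, QuantumCommitment.openProb, BindingAdversary.revealed]
    exact re_dotProduct_revealed (G.commitScheme.state n b) _
  have h₀ := G.isCommitState_commitScheme n false
  have h₁ := G.isCommitState_commitScheme n true
  rw [hcheat, hcheat]
  refine (sum_binding (G.normSq_commitScheme_state n false) (G.normSq_commitScheme_state n true)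
    h₀.eq_sum_keyPart (normSq_keyPart (G.η_norm n))
    (h₁.normSq_overlap (G.φ_norm n) (G.η_norm n)) _ _ (A.Ψ_norm n)).trans (le_of_eq ?_)
  rw [Fintype.card_fun, Fintype.card_bool, Fintype.card_fin, Nat.cast_pow, Nat.cast_ofNat]
  congr 1
  have hs (N : ℕ) : Real.sqrt ((2 : ℝ) ^ N)⁻¹ = (2 : ℝ) ^ (-(N : ℝ) / 2) := by
    rw [Real.sqrt_eq_rpow, ← Real.rpow_natCast, ← Real.rpow_neg zero_le_two,
      ← Real.rpow_mul zero_le_two]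
    ring_nf
  rw [hs, hs, ← Real.rpow_natCast, ← Real.rpow_add two_pos, ← Real.rpow_add two_pos]
  ring_nf

theorem theorem1 (c : ℝ) (hc : 1 < c) (G : StateGen) (hm : ∀ n : ℕ, c * n ≤ G.m n)
    (hG : G.IsSingleCopyPRSG) :
    ∃ S : QuantumCommitment G.m (fun n => G.a n + (n + (G.m n + G.m n))),
      -- `|ψ_b⟩ = 2^{-(2m+n)/2} ∑_{x,z,k} (|η_k⟩ ⊗ |k⟩ ⊗ |x⟩ ⊗ |z⟩)_R ⊗ (P_{x,z}^b |φ_k⟩)_C`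
      (∀ (n : ℕ) (b : Bool) (u : Bits (G.m n)) (e : Bits (G.a n)) (k : Bits n)
          (x z : Bits (G.m n)),
        S.state n b (u, Fin.append e (Fin.append k (Fin.append x z))) =
          ((1 / Real.sqrt (2 ^ (2 * G.m n + n)) : ℝ) : ℂ) *
            (G.η n k e * ((pauli x z ^ b.toNat) *ᵥ G.φ n k) u)) ∧
      S.PerfectlyCorrect ∧
      S.ComputationallyHiding ∧
      S.StatisticallySumBinding ∧
      (∀ (A : BindingAdversary G.m (fun n => G.a n + (n + (G.m n + G.m n)))) (n : ℕ),
        S.cheatProb A n false + S.cheatProb A n true ≤ 1 + (2 : ℝ) ^ (-((c - 1) * n / 2))) := by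
  have hbind (A : BindingAdversary G.m (fun n => G.a n + (n + (G.m n + G.m n)))) (n : ℕ) :
      G.commitScheme.cheatProb A n false + G.commitScheme.cheatProb A n true ≤
        1 + (2 : ℝ) ^ (-((c - 1) * n / 2)) := by
    refine (G.cheatProb_commitScheme_le A n).trans ?_
    -- From m ≥ cn the exponent (n - m)/2 is at most -(c - 1)n/2.
    have h := hm n
    gcongr
    · exact one_le_two
    · linarith
  refine ⟨G.commitScheme, G.isCommitState_commitScheme, G.perfectlyCorrect_commitScheme,
    G.computationallyHiding_commitScheme hG,
    fun A => ⟨fun n => (2 : ℝ) ^ (-((c - 1) / 2 * n)),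
      negligible_two_rpow_neg (by linarith), fun n => ?_⟩, hbind⟩
  simpa only [div_mul_eq_mul_div] using hbind A n
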